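/- **Setting.** Let $(\mathbf X,\mathbf Y_1,\mathbf Y_2)$ be zero-mean jointly Gaussian random vectors of sizes $k,k_1,k_2$. For a random object $\mathbf Z$ write $K_{\mathbf X|\mathbf Z}=E[(\mathbf X-E[\mathbf X|\mathbf Z])(\mathbf X-E[\mathbf X|\mathbf Z])^T]$, and $A\preceq B$ if $B-A$ is positive semidefinite. Assume $K_{\mathbf X|\mathbf Y_1}$ and $K_{\mathbf X|\mathbf Y_2}$ are invertible. For $i\in\{1,2\}$ let $\Gamma_i$ map positive semidefinite $k\times k$ matrices to positive semidefinite $k_0\times k_0$ matrices, linearly (additively and positively homogeneously) and monotonically ($A\preceq B\Rightarrow\Gamma_i(A)\preceq\Gamma_i(B)$), and let $D_1,D_2$ be positive definite $k_0\times k_0$ matrices, $\mathbf D=(D_1,D_2)$. Let $S_G$ be the set of random vectors $\mathbf Y$ (of any finite size) that are jointly zero-mean Gaussian with $(\mathbf X,\mathbf Y_1,\mathbf Y_2)$ and satisfy the Markov chain $\mathbf X\leftrightarrow\mathbf Y\leftrightarrow(\mathbf Y_1,\mathbf Y_2)$. Assume that $K_{\mathbf X|\mathbf Y}$ is invertible for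 at least one $\mathbf Y\in S_G$. For random vectors $(\mathbf W,\mathbf U,\mathbf V)$ (of any finite sizes) put $$R_{lo1}=I(\mathbf X;\mathbf W,\mathbf U|\mathbf Y_1)+I(\mathbf X;\mathbf V|\mathbf W,\mathbf U,\mathbf Y),\qquad R_{lo2}=I(\mathbf X;\mathbf W,\mathbf V|\mathbf Y_2)+I(\mathbf X;\mathbf U|\mathbf W,\mathbf V,\mathbf Y),$$ with values in $[0,\infty]$. Given $\mathbf Y\in S_G$, consider only $(\mathbf W,\mathbf U,\mathbf V)$ with $(\mathbf W,\mathbf U,\mathbf V)\leftrightarrow\mathbf X\leftrightarrow(\mathbf Y_1,\mathbf Y_2,\mathbf Y)$, and among these let * $C_l(\mathbf D)$ be those with $\Gamma_1(K_{\mathbf X|\mathbf W,\mathbf U,\mathbf Y_1})\preceq D_1$ and $\Gamma_2(K_{\mathbf X|\mathbf W,\mathbf V,\mathbf Y_2})\preceq D_2$; * $\bar C_{l1}(\mathbf D)$ (when $K_{\mathbf X|\mathbf Y}$ is invertible) be those with $K_{\mathbf X|\mathbf W,\mathbf U,\mathbf V,\mathbf Y}$ invertible, $\Gamma_1(K_{\mathbf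 X|\mathbf W,\mathbf U,\mathbf Y_1})\preceq D_1$ and $\Gamma_2\big((K_{\mathbf X|\mathbf W,\mathbf U,\mathbf V,\mathbf Y}^{-1}-\widetilde K)^{-1}\big)\preceq D_2$, where $\widetilde K=K_{\mathbf X|\mathbf Y}^{-1}-K_{\mathbf X|\mathbf Y_2}^{-1}$; * $\bar C_{l2}(\mathbf D)$ (when $K_{\mathbf X|\mathbf Y}$ is invertible) be those with $K_{\mathbf X|\mathbf W,\mathbf U,\mathbf V,\mathbf Y}$ invertible, $\Gamma_1\big((K_{\mathbf X|\mathbf W,\mathbf U,\mathbf V,\mathbf Y}^{-1}-\widehat K)^{-1}\big)\preceq D_1$ and $\Gamma_2(K_{\mathbf X|\mathbf W,\mathbf V,\mathbf Y_2})\preceq D_2$, where $\widehat K=K_{\mathbf X|\mathbf Y}^{-1}-K_{\mathbf X|\mathbf Y_1}^{-1}$. Define the Maximin bound and the Enhanced-Enhancement bound by $$R_{\mathrm{MLB}}(\mathbf D)=\max\Big\{\sup_{\mathbf Y\in S_G}\inf_{C_l(\mathbf D)}R_{lo1},\ \sup_{\mathbf Y\in S_G}\inf_{C_l(\mathbf D)}R_{lo2}\Big\},$$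 $$R_{\mathrm{E^2LB}}(\mathbf D)=\max\Big\{\sup_{\mathbf Y}\inf_{\bar C_{l1}(\mathbf D)}R_{lo1},\ \sup_{\mathbf Y}\inf_{\bar C_{l2}(\mathbf D)}R_{lo2}\Big\},$$ the suprema in the second being over $\mathbf Y\in S_G$ with $K_{\mathbf X|\mathbf Y}$ invertible (so that the constraints are defined). Let $R^G_{\mathrm{MLB}}(\mathbf D)$ be defined as $R_{\mathrm{MLB}}(\mathbf D)$, with the infima restricted to those $(\mathbf W,\mathbf U,\mathbf V)\in C_l(\mathbf D)$ that are jointly (zero-mean) Gaussian with $(\mathbf X,\mathbf Y_1,\mathbf Y_2,\mathbf Y)$. **Proposition.** $R_{\mathrm{MLB}}(\mathbf D)=R_{\mathrm{E^2LB}}(\mathbf D)$. Moreover Gaussian auxiliaries are optimal for the Maximin bound: $R^G_{\mathrm{MLB}}(\mathbf D)=R_{\mathrm{MLB}}(\mathbf D)$. -/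

import Mathlib

open MeasureTheory ProbabilityTheory
open scoped ENNReal

noncomputable section

namespace VecGaussianRD

/-! ### Information-theoretic and second-order notions -/

section Generic

variable {Ω α β γ : Type*} [MeasurableSpace Ω] [MeasurableSpace α] [MeasurableSpace β]
  [MeasurableSpace γ]

/-- Conditional mutual information `I(A; B | C)` in nats: the Kullback-Leibler divergence between
the law of `(C, A, B)` and the law under which `A` and `B` are made conditionally independent
given `C`. It takes values in `[0, ∞]`. -/
def condMutualInfo (P : Measure Ω) [IsFiniteMeasure P]
    [StandardBorelSpace α] [Nonempty α] [StandardBorelSpace β] [Nonempty β]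
    (A : Ω → α) (B : Ω → β) (C : Ω → γ) : ℝ≥0∞ :=
  InformationTheory.klDiv (P.map (fun ω => (C ω, A ω, B ω)))
    (P.map C ⊗ₘ (condDistrib A C P ×ₖ condDistrib B C P))

/-- The Markov chain `A ↔ B ↔ C`: `A` and `C` are conditionally independent given `B`. -/
def IsMarkovChain [StandardBorelSpace Ω] (P : Measure Ω) [IsFiniteMeasure P]
    (A : Ω → α) (B : Ω → β) (C : Ω → γ) : Prop :=
  ∃ hB : Measurable B, CondIndepFun (MeasurableSpace.comap B inferInstance) hB.comap_le A C P

/-- The conditional (error) covariance matrix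
`K_{X|Z} = E[(X - E[X|Z]) (X - E[X|Z])ᵀ]` of a random vector `X` given `Z`. -/
def condCov (P : Measure Ω) {k : ℕ} (X : Ω → Fin k → ℝ) (Z : Ω → γ) :
    Matrix (Fin k) (Fin k) ℝ :=
  Matrix.of fun i j =>
    ∫ ω, (X ω i - (P[fun ω' => X ω' i | MeasurableSpace.comap Z inferInstance]) ω) *
      (X ω j - (P[fun ω' => X ω' j | MeasurableSpace.comap Z inferInstance]) ω) ∂P

end Generic

/-- The order `A ⪯ B` on matrices: `B - A` is positive semidefinite. -/
def LoewnerLE {n : ℕ} (A B : Matrix (Fin n) (Fin n) ℝ) : Prop := (B - A).PosSemidef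

/-- A (possibly degenerate) zero-mean Gaussian law on a finite-dimensional space. -/
def IsCenteredGaussian {E : Type*} [NormedAddCommGroup E] [NormedSpace ℝ E] [MeasurableSpace E]
    (P : Measure E) : Prop :=
  IsGaussian P ∧ ∫ x, x ∂P = 0

/-- A distortion mapping: it sends positive semidefinite `k × k` matrices to positive semidefinite
`k₀ × k₀` matrices, linearly and monotonically. Only its values on positive semidefinite matrices
are constrained. -/
structure IsDistortionMap {k k₀ : ℕ}
    (Γ : Matrix (Fin k) (Fin k) ℝ → Matrix (Fin k₀) (Fin k₀) ℝ) : Prop where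
  map_posSemidef : ∀ A, A.PosSemidef → (Γ A).PosSemidef
  map_add : ∀ A B, A.PosSemidef → B.PosSemidef → Γ (A + B) = Γ A + Γ B
  map_smul : ∀ (c : ℝ) A, 0 ≤ c → A.PosSemidef → Γ (c • A) = c • Γ A
  mono : ∀ A B, A.PosSemidef → B.PosSemidef → LoewnerLE A B → LoewnerLE (Γ A) (Γ B)

/-! ### The sample spaces

Random vectors are coordinates on a product space and are given through their joint law. Adjoining
new random vectors to given ones means choosing a law on a larger product whose marginal is the
given law. -/

/-- Real vectors of size `n`. -/
abbrev Vec (n : ℕ) : Type := Fin n → ℝ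

/-- Values of `(X, Y₁, Y₂)`. -/
abbrev Src (k k₁ k₂ : ℕ) : Type := Vec k × Vec k₁ × Vec k₂

/-- Values of `((X, Y₁, Y₂), Y)`. -/
abbrev SrcY (k k₁ k₂ m : ℕ) : Type := Src k k₁ k₂ × Vec m

/-- Values of `(((X, Y₁, Y₂), Y), (W, U, V))`. -/
abbrev Full (k k₁ k₂ m p q r : ℕ) : Type := SrcY k k₁ k₂ m × (Vec p × Vec q × Vec r)

instance (k k₁ k₂ : ℕ) : StandardBorelSpace (Src k k₁ k₂) :=
  inferInstanceAs (StandardBorelSpace (Vec k × Vec k₁ × Vec k₂))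

instance (k k₁ k₂ m : ℕ) : StandardBorelSpace (SrcY k k₁ k₂ m) :=
  inferInstanceAs (StandardBorelSpace (Src k k₁ k₂ × Vec m))

instance (k k₁ k₂ m p q r : ℕ) : StandardBorelSpace (Full k k₁ k₂ m p q r) :=
  have : StandardBorelSpace (Vec p × Vec q × Vec r) := inferInstance
  inferInstanceAs (StandardBorelSpace (SrcY k k₁ k₂ m × (Vec p × Vec q × Vec r)))

section Bounds

variable {k k₁ k₂ k₀ m p q r : ℕ}

/-! Coordinates of `Full`. -/

/-- The coordinate `X`. -/
def cX (ω : Full k k₁ k₂ m p q r) : Vec k := ω.1.1.1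
/-- The coordinate `Y₁`. -/
def cY₁ (ω : Full k k₁ k₂ m p q r) : Vec k₁ := ω.1.1.2.1
/-- The coordinate `Y₂`. -/
def cY₂ (ω : Full k k₁ k₂ m p q r) : Vec k₂ := ω.1.1.2.2
/-- The coordinate `Y`. -/
def cY (ω : Full k k₁ k₂ m p q r) : Vec m := ω.1.2
/-- The coordinate `W`. -/
def cW (ω : Full k k₁ k₂ m p q r) : Vec p := ω.2.1
/-- The coordinate `U`. -/
def cU (ω : Full k k₁ k₂ m p q r) : Vec q := ω.2.2.1
/-- The coordinate `V`. -/
def cV (ω : Full k k₁ k₂ m p q r) : Vec r := ω.2.2.2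

/-- `K_{X|Y₁}` for a law of `(X, Y₁, Y₂)`. -/
def covXgivenY₁ (μ : Measure (Src k k₁ k₂)) : Matrix (Fin k) (Fin k) ℝ :=
  condCov μ (fun ω => ω.1) (fun ω => ω.2.1)

/-- `K_{X|Y₂}` for a law of `(X, Y₁, Y₂)`. -/
def covXgivenY₂ (μ : Measure (Src k k₁ k₂)) : Matrix (Fin k) (Fin k) ℝ :=
  condCov μ (fun ω => ω.1) (fun ω => ω.2.2)

/-- `K_{X|Y}` for a law of `((X, Y₁, Y₂), Y)`. -/
def covXgivenY (P : Measure (SrcY k k₁ k₂ m)) : Matrix (Fin k) (Fin k) ℝ :=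
  condCov P (fun ω => ω.1.1) (fun ω => ω.2)

/-- The set `S_G` (for `Y` of size `m`): joint laws of `((X, Y₁, Y₂), Y)` extending the law `μ` of
`(X, Y₁, Y₂)`, jointly Gaussian and such that `X ↔ Y ↔ (Y₁, Y₂)`. -/
def SG (μ : ProbabilityMeasure (Src k k₁ k₂)) (m : ℕ) :
    Set (ProbabilityMeasure (SrcY k k₁ k₂ m)) :=
  {P | (P : Measure (SrcY k k₁ k₂ m)).map Prod.fst = (μ : Measure (Src k k₁ k₂)) ∧
    IsCenteredGaussian (P : Measure (SrcY k k₁ k₂ m)) ∧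
    IsMarkovChain (P : Measure (SrcY k k₁ k₂ m))
      (fun ω => ω.1.1) (fun ω => ω.2) (fun ω => ω.1.2)}

/-- `R_lo1 = I(X; W, U | Y₁) + I(X; V | W, U, Y)`. -/
def Rlo₁ (Q : ProbabilityMeasure (Full k k₁ k₂ m p q r)) : ℝ≥0∞ :=
  condMutualInfo (Q : Measure (Full k k₁ k₂ m p q r)) cX (fun ω => (cW ω, cU ω)) cY₁ +
  condMutualInfo (Q : Measure (Full k k₁ k₂ m p q r)) cX cV (fun ω => (cW ω, cU ω, cY ω))

/-- `R_lo2 = I(X; W, V | Y₂) + I(X; U | W, V, Y)`. -/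
def Rlo₂ (Q : ProbabilityMeasure (Full k k₁ k₂ m p q r)) : ℝ≥0∞ :=
  condMutualInfo (Q : Measure (Full k k₁ k₂ m p q r)) cX (fun ω => (cW ω, cV ω)) cY₂ +
  condMutualInfo (Q : Measure (Full k k₁ k₂ m p q r)) cX cU (fun ω => (cW ω, cV ω, cY ω))

/-- `Q` adjoins auxiliary vectors `(W, U, V)` to the law `P` of `((X, Y₁, Y₂), Y)` in such a way
that `(W, U, V) ↔ X ↔ (Y₁, Y₂, Y)`. -/
def IsAuxiliary (P : ProbabilityMeasure (SrcY k k₁ k₂ m))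
    (Q : ProbabilityMeasure (Full k k₁ k₂ m p q r)) : Prop :=
  (Q : Measure (Full k k₁ k₂ m p q r)).map Prod.fst = (P : Measure (SrcY k k₁ k₂ m)) ∧
  IsMarkovChain (Q : Measure (Full k k₁ k₂ m p q r))
    (fun ω => (cW ω, cU ω, cV ω)) cX (fun ω => (cY₁ ω, cY₂ ω, cY ω))

/-- `K_{X|W,U,Y₁}`. -/
def covXgivenWUY₁ (Q : ProbabilityMeasure (Full k k₁ k₂ m p q r)) : Matrix (Fin k) (Fin k) ℝ :=
  condCov (Q : Measure (Full k k₁ k₂ m p q r)) cX (fun ω => (cW ω, cU ω, cY₁ ω))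

/-- `K_{X|W,V,Y₂}`. -/
def covXgivenWVY₂ (Q : ProbabilityMeasure (Full k k₁ k₂ m p q r)) : Matrix (Fin k) (Fin k) ℝ :=
  condCov (Q : Measure (Full k k₁ k₂ m p q r)) cX (fun ω => (cW ω, cV ω, cY₂ ω))

/-- `K_{X|W,U,V,Y}`. -/
def covXgivenWUVY (Q : ProbabilityMeasure (Full k k₁ k₂ m p q r)) : Matrix (Fin k) (Fin k) ℝ :=
  condCov (Q : Measure (Full k k₁ k₂ m p q r)) cX (fun ω => (cW ω, cU ω, cV ω, cY ω))

variable (Γ₁ Γ₂ : Matrix (Fin k) (Fin k) ℝ → Matrix (Fin k₀) (Fin k₀) ℝ)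
  (D₁ D₂ : Matrix (Fin k₀) (Fin k₀) ℝ)

/-- The feasible set `C_{l1}(D) = C_{l2}(D)` of the Maximin bound (the two sets are given by the
same conditions). -/
def Cl (P : ProbabilityMeasure (SrcY k k₁ k₂ m)) (p q r : ℕ) :
    Set (ProbabilityMeasure (Full k k₁ k₂ m p q r)) :=
  {Q | IsAuxiliary P Q ∧
    LoewnerLE (Γ₁ (covXgivenWUY₁ Q)) D₁ ∧ LoewnerLE (Γ₂ (covXgivenWVY₂ Q)) D₂}

/-- The feasible set of the Enhanced-Enhancement bound for the first objective. Here
`Ktilde = K_{X|Y}⁻¹ - K_{X|Y₂}⁻¹`; the constraint on `K_{X|W,U,V,Y}⁻¹` presupposes that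
`K_{X|W,U,V,Y}` is invertible. -/
def ClBar₁ (μ : ProbabilityMeasure (Src k k₁ k₂)) (P : ProbabilityMeasure (SrcY k k₁ k₂ m))
    (p q r : ℕ) : Set (ProbabilityMeasure (Full k k₁ k₂ m p q r)) :=
  {Q | IsAuxiliary P Q ∧
    LoewnerLE (Γ₁ (covXgivenWUY₁ Q)) D₁ ∧
    (covXgivenWUVY Q).PosDef ∧
    LoewnerLE (Γ₂ ((covXgivenWUVY Q)⁻¹ -
      ((covXgivenY (P : Measure (SrcY k k₁ k₂ m)))⁻¹ -
        (covXgivenY₂ (μ : Measure (Src k k₁ k₂)))⁻¹))⁻¹) D₂}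

/-- The feasible set of the Enhanced-Enhancement bound for the second objective. Here
`Khat = K_{X|Y}⁻¹ - K_{X|Y₁}⁻¹`. -/
def ClBar₂ (μ : ProbabilityMeasure (Src k k₁ k₂)) (P : ProbabilityMeasure (SrcY k k₁ k₂ m))
    (p q r : ℕ) : Set (ProbabilityMeasure (Full k k₁ k₂ m p q r)) :=
  {Q | IsAuxiliary P Q ∧
    (covXgivenWUVY Q).PosDef ∧
    LoewnerLE (Γ₁ ((covXgivenWUVY Q)⁻¹ -
      ((covXgivenY (P : Measure (SrcY k k₁ k₂ m)))⁻¹ -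
        (covXgivenY₁ (μ : Measure (Src k k₁ k₂)))⁻¹))⁻¹) D₁ ∧
    LoewnerLE (Γ₂ (covXgivenWVY₂ Q)) D₂}

/-- The Maximin bound `R_MLB(D)`. -/
def RMLB (μ : ProbabilityMeasure (Src k k₁ k₂)) : ℝ≥0∞ :=
  max
    (⨆ (m : ℕ) (P : ProbabilityMeasure (SrcY k k₁ k₂ m)) (_ : P ∈ SG μ m),
      ⨅ (p : ℕ) (q : ℕ) (r : ℕ) (Q : ProbabilityMeasure (Full k k₁ k₂ m p q r))
        (_ : Q ∈ Cl Γ₁ Γ₂ D₁ D₂ P p q r), Rlo₁ Q)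
    (⨆ (m : ℕ) (P : ProbabilityMeasure (SrcY k k₁ k₂ m)) (_ : P ∈ SG μ m),
      ⨅ (p : ℕ) (q : ℕ) (r : ℕ) (Q : ProbabilityMeasure (Full k k₁ k₂ m p q r))
        (_ : Q ∈ Cl Γ₁ Γ₂ D₁ D₂ P p q r), Rlo₂ Q)

/-- The Maximin bound with auxiliaries `(W, U, V)` restricted to be jointly Gaussian with
`(X, Y₁, Y₂, Y)`. -/
def RMLBGauss (μ : ProbabilityMeasure (Src k k₁ k₂)) : ℝ≥0∞ :=
  max
    (⨆ (m : ℕ) (P : ProbabilityMeasure (SrcY k k₁ k₂ m)) (_ : P ∈ SG μ m),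
      ⨅ (p : ℕ) (q : ℕ) (r : ℕ) (Q : ProbabilityMeasure (Full k k₁ k₂ m p q r))
        (_ : Q ∈ Cl Γ₁ Γ₂ D₁ D₂ P p q r)
        (_ : IsCenteredGaussian (Q : Measure (Full k k₁ k₂ m p q r))), Rlo₁ Q)
    (⨆ (m : ℕ) (P : ProbabilityMeasure (SrcY k k₁ k₂ m)) (_ : P ∈ SG μ m),
      ⨅ (p : ℕ) (q : ℕ) (r : ℕ) (Q : ProbabilityMeasure (Full k k₁ k₂ m p q r))
        (_ : Q ∈ Cl Γ₁ Γ₂ D₁ D₂ P p q r)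
        (_ : IsCenteredGaussian (Q : Measure (Full k k₁ k₂ m p q r))), Rlo₂ Q)

/-- The Enhanced-Enhancement bound. The supremum is over those `Y` in `S_G` for which the
constraints, which involve `K_{X|Y}⁻¹`, are defined. -/
def RE2LB (μ : ProbabilityMeasure (Src k k₁ k₂)) : ℝ≥0∞ :=
  max
    (⨆ (m : ℕ) (P : ProbabilityMeasure (SrcY k k₁ k₂ m)) (_ : P ∈ SG μ m)
        (_ : (covXgivenY (P : Measure (SrcY k k₁ k₂ m))).PosDef),
      ⨅ (p : ℕ) (q : ℕ) (r : ℕ) (Q : ProbabilityMeasure (Full k k₁ k₂ m p q r))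
        (_ : Q ∈ ClBar₁ Γ₁ Γ₂ D₁ D₂ μ P p q r), Rlo₁ Q)
    (⨆ (m : ℕ) (P : ProbabilityMeasure (SrcY k k₁ k₂ m)) (_ : P ∈ SG μ m)
        (_ : (covXgivenY (P : Measure (SrcY k k₁ k₂ m))).PosDef),
      ⨅ (p : ℕ) (q : ℕ) (r : ℕ) (Q : ProbabilityMeasure (Full k k₁ k₂ m p q r))
        (_ : Q ∈ ClBar₂ Γ₁ Γ₂ D₁ D₂ μ P p q r), Rlo₂ Q)

end Bounds

end VecGaussianRD

end

namespace VecGaussianRD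

/-! ### Loewner order, Gaussian posterior covariances and determinants. -/

section Matrices

open Matrix

variable {n l : ℕ}

/-- The error covariance of a centred vector with covariance `K` after the observation of
`H X + N` with standard Gaussian noise `N`. -/
noncomputable def posteriorCov (K : Matrix (Fin n) (Fin n) ℝ) (H : Matrix (Fin l) (Fin n) ℝ) :
    Matrix (Fin n) (Fin n) ℝ :=
  K - K * Hᵀ * (1 + H * K * Hᵀ)⁻¹ * H * K

theorem LoewnerLE.trans {A B C : Matrix (Fin n) (Fin n) ℝ} (h₁ : LoewnerLE A B)
    (h₂ : LoewnerLE B C) : LoewnerLE A C := by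
  unfold LoewnerLE at *
  simpa using h₂.add h₁

theorem _root_.Matrix.PosDef.of_loewnerLE {A B : Matrix (Fin n) (Fin n) ℝ} (hA : A.PosDef)
    (h : LoewnerLE A B) : B.PosDef := by
  simpa using hA.add_posSemidef h

/-- The block matrix with rows `(A⁻¹, 1)` and `(1, B)` has Schur complements `B - A` and `A⁻¹ -
B⁻¹`, so these are positive semidefinite together. -/
theorem LoewnerLE.inv {A B : Matrix (Fin n) (Fin n) ℝ} (hA : A.PosDef) (h : LoewnerLE A B) :
    LoewnerLE B⁻¹ A⁻¹ := by
  have hB : B.PosDef := hA.of_loewnerLE h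
  let _ := hA.isUnit.invertible
  let _ := hB.isUnit.invertible
  let _ := hA.inv.isUnit.invertible
  have h₁ : (fromBlocks A⁻¹ 1 (1 : Matrix (Fin n) (Fin n) ℝ)ᴴ B).PosSemidef := by
    rw [PosDef.fromBlocks₁₁ _ _ hA.inv]
    simpa [LoewnerLE] using h
  rw [PosDef.fromBlocks₂₂ _ _ hB] at h₁
  simpa [LoewnerLE] using h₁

theorem exists_transpose_mul_self_eq {J : Matrix (Fin n) (Fin n) ℝ} (hJ : J.PosSemidef) :
    ∃ H : Matrix (Fin n) (Fin n) ℝ, Hᵀ * H = J := by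
  open scoped MatrixOrder in
  obtain ⟨H, hH⟩ := CStarAlgebra.nonneg_iff_eq_star_mul_self.mp hJ.nonneg
  exact ⟨H, by rw [hH]; simp [star_eq_conjTranspose]⟩

theorem _root_.Matrix.PosSemidef.mul_mul_transpose_same {m : ℕ} {A : Matrix (Fin n) (Fin n) ℝ}
    (hA : A.PosSemidef) (B : Matrix (Fin m) (Fin n) ℝ) : (B * A * Bᵀ).PosSemidef := by
  rw [← conjTranspose_eq_transpose_of_trivial]
  exact hA.mul_mul_conjTranspose_same B

theorem posSemidef_mul_transpose_self (H : Matrix (Fin l) (Fin n) ℝ) : (H * Hᵀ).PosSemidef := by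
  rw [← conjTranspose_eq_transpose_of_trivial]
  exact posSemidef_self_mul_conjTranspose H

theorem posSemidef_transpose_mul_self (H : Matrix (Fin l) (Fin n) ℝ) : (Hᵀ * H).PosSemidef := by
  simpa using posSemidef_conjTranspose_mul_self H

theorem posDef_one_add_mul_mul_transpose {K : Matrix (Fin n) (Fin n) ℝ} (hK : K.PosSemidef)
    (H : Matrix (Fin l) (Fin n) ℝ) : (1 + H * K * Hᵀ).PosDef :=
  PosDef.one.add_posSemidef (by
    rw [← conjTranspose_eq_transpose_of_trivial]; exact hK.mul_mul_conjTranspose_same H)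

/-- The left side is the error covariance of the linear estimator with gain `G`; completing the
square in `G` isolates the optimal gain. No inverse of `K` occurs, which matters because `K_{X|Y}`
may be singular for a general `Y` in `S_G`. -/
theorem posteriorCov_eq_of_gain {K : Matrix (Fin n) (Fin n) ℝ} (hK : K.PosSemidef)
    (H : Matrix (Fin l) (Fin n) ℝ) (G : Matrix (Fin n) (Fin l) ℝ) :
    (1 - G * H) * K * (1 - G * H)ᵀ + G * Gᵀ = posteriorCov K H +
      (G - K * Hᵀ * (1 + H * K * Hᵀ)⁻¹) * (1 + H * K * Hᵀ) *
        (G - K * Hᵀ * (1 + H * K * Hᵀ)⁻¹)ᵀ := by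
  have hS := posDef_one_add_mul_mul_transpose hK H
  have hKt : Kᵀ = K := by simpa using hK.isHermitian.eq
  set S := 1 + H * K * Hᵀ with hSdef
  have hSt : Sᵀ = S := by simpa using hS.isHermitian.eq
  have hSi : S⁻¹ᵀ = S⁻¹ := by rw [transpose_nonsing_inv, hSt]
  have h1 : S * S⁻¹ = 1 := mul_nonsing_inv _ ((isUnit_iff_isUnit_det _).mp hS.isUnit)
  have h2 : S⁻¹ * S = 1 := nonsing_inv_mul _ ((isUnit_iff_isUnit_det _).mp hS.isUnit)
  have h3 : (G - K * Hᵀ * S⁻¹) * S * (G - K * Hᵀ * S⁻¹)ᵀ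
      = G * S * Gᵀ - G * H * K - K * Hᵀ * Gᵀ + K * Hᵀ * S⁻¹ * H * K := by
    have e1 : (G - K * Hᵀ * S⁻¹) * S = G * S - K * Hᵀ := by
      rw [Matrix.sub_mul, Matrix.mul_assoc _ S⁻¹ S, h2, Matrix.mul_one]
    have e2 : (G - K * Hᵀ * S⁻¹)ᵀ = Gᵀ - S⁻¹ * H * K := by
      simp [transpose_mul, hSi, hKt, Matrix.mul_assoc]
    rw [e1, e2, Matrix.sub_mul, Matrix.mul_sub, Matrix.mul_sub]
    have e3 : G * S * (S⁻¹ * H * K) = G * H * K := by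
      calc G * S * (S⁻¹ * H * K) = G * (S * S⁻¹) * H * K := by simp only [Matrix.mul_assoc]
        _ = _ := by rw [h1, Matrix.mul_one]
    rw [e3]
    simp only [Matrix.mul_assoc]
    abel
  have h4 : G * S * Gᵀ = G * Gᵀ + G * H * K * Hᵀ * Gᵀ := by
    rw [hSdef, Matrix.mul_add, Matrix.add_mul, Matrix.mul_one]
    simp only [Matrix.mul_assoc]
  rw [h3, h4, posteriorCov, ← hSdef]
  simp only [transpose_sub, transpose_one, transpose_mul, Matrix.mul_sub, Matrix.sub_mul,
    Matrix.mul_one, Matrix.one_mul, Matrix.mul_assoc]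
  abel

theorem posSemidef_posteriorCov {K : Matrix (Fin n) (Fin n) ℝ} (hK : K.PosSemidef)
    (H : Matrix (Fin l) (Fin n) ℝ) : (posteriorCov K H).PosSemidef := by
  have h := posteriorCov_eq_of_gain hK H (K * Hᵀ * (1 + H * K * Hᵀ)⁻¹)
  simp only [sub_self, Matrix.zero_mul, add_zero] at h
  rw [← h]
  exact (hK.mul_mul_transpose_same _).add (posSemidef_mul_transpose_self _)

/-- For a fixed gain the error covariance is monotone in the prior. With the gain that is optimal
for `L`, the square term vanishes for `L` and is nonnegative for `K`. -/
theorem LoewnerLE.posteriorCov {K L : Matrix (Fin n) (Fin n) ℝ} (hK : K.PosSemidef)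
    (hL : L.PosSemidef) (h : LoewnerLE K L) (H : Matrix (Fin l) (Fin n) ℝ) :
    LoewnerLE (posteriorCov K H) (posteriorCov L H) := by
  set G := L * Hᵀ * (1 + H * L * Hᵀ)⁻¹
  have h₁ := posteriorCov_eq_of_gain hK H G
  have h₂ := posteriorCov_eq_of_gain hL H G
  rw [show G - L * Hᵀ * (1 + H * L * Hᵀ)⁻¹ = 0 from sub_self _] at h₂
  simp only [Matrix.zero_mul, add_zero] at h₂
  have h₃ : VecGaussianRD.posteriorCov L H - VecGaussianRD.posteriorCov K H =
      (1 - G * H) * (L - K) * (1 - G * H)ᵀ +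
      (G - K * Hᵀ * (1 + H * K * Hᵀ)⁻¹) * (1 + H * K * Hᵀ) *
        (G - K * Hᵀ * (1 + H * K * Hᵀ)⁻¹)ᵀ := by
    rw [← h₂, Matrix.mul_sub (1 - G * H) L K,
      Matrix.sub_mul ((1 - G * H) * L) ((1 - G * H) * K), sub_eq_iff_eq_add, add_assoc, add_comm _
      (VecGaussianRD.posteriorCov K H), ← h₁]
    abel
  rw [LoewnerLE, h₃]
  exact (PosSemidef.mul_mul_transpose_same h _).add
    ((posDef_one_add_mul_mul_transpose hK H).posSemidef.mul_mul_transpose_same _)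

/-- Woodbury's identity: precisions add. -/
theorem posteriorCov_eq_inv {K : Matrix (Fin n) (Fin n) ℝ} (hK : K.PosDef)
    (H : Matrix (Fin l) (Fin n) ℝ) : posteriorCov K H = (K⁻¹ + Hᵀ * H)⁻¹ := by
  have hu : IsUnit K.det := (isUnit_iff_isUnit_det _).mp hK.isUnit
  have h := Matrix.add_mul_mul_inv_eq_sub (A := K⁻¹) (U := Hᵀ) (C := 1) (V := H) hK.inv.isUnit
    isUnit_one (by
      simpa [nonsing_inv_nonsing_inv _ hu]
        using (posDef_one_add_mul_mul_transpose hK.posSemidef H).isUnit)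
  simpa [nonsing_inv_nonsing_inv _ hu, posteriorCov] using h.symm

/-- Sylvester's determinant identity turns the left side into `det (1 + K Hᵀ H)`. -/
theorem det_one_add_mul_mul_transpose {K : Matrix (Fin n) (Fin n) ℝ} (hK : K.PosDef)
    (H : Matrix (Fin l) (Fin n) ℝ) :
    (1 + H * K * Hᵀ).det = K.det * (K⁻¹ + Hᵀ * H).det := by
  have hu : IsUnit K.det := (isUnit_iff_isUnit_det _).mp hK.isUnit
  rw [Matrix.mul_assoc, det_one_add_mul_comm, ← det_mul, mul_add, mul_nonsing_inv _ hu,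
    Matrix.mul_assoc]

theorem one_le_det_one_add {A : Matrix (Fin n) (Fin n) ℝ} (hA : A.PosSemidef) :
    1 ≤ (1 + A).det := by
  have h1 : (1 + A).PosDef := PosDef.one.add_posSemidef hA
  rw [h1.isHermitian.det_eq_prod_eigenvalues]
  have : ∀ i, 1 ≤ h1.isHermitian.eigenvalues i := by
    intro i
    set v : Fin n → ℝ := (h1.isHermitian.eigenvectorBasis i).ofLp with hv
    have hv1 : v ⬝ᵥ v = 1 := by
      have := h1.isHermitian.eigenvectorBasis.orthonormal.1 i
      have h2 : ‖h1.isHermitian.eigenvectorBasis i‖ ^ 2 = 1 := by rw [this]; norm_num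
      rw [EuclideanSpace.norm_sq_eq] at h2
      simp only [dotProduct, hv]
      rw [← h2]
      refine Finset.sum_congr rfl fun j _ => ?_
      rw [Real.norm_eq_abs, sq_abs, sq]
    have h3 := h1.isHermitian.mulVec_eigenvectorBasis i
    have h4 : v ⬝ᵥ ((1 + A) *ᵥ v) = h1.isHermitian.eigenvalues i := by
      rw [hv, h3]
      rw [dotProduct_smul, ← hv, hv1]; simp
    rw [← h4, add_mulVec, one_mulVec, dotProduct_add, hv1]
    have := hA.dotProduct_mulVec_nonneg v
    simp only [star_trivial] at this
    linarith
  simpa using Finset.prod_le_prod (s := Finset.univ) (f := fun _ : Fin n => (1 : ℝ))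
    (fun _ _ => zero_le_one) (fun i _ => this i)

theorem LoewnerLE.det_le {A B : Matrix (Fin n) (Fin n) ℝ} (hA : A.PosDef) (h : LoewnerLE A B) :
    A.det ≤ B.det := by
  obtain ⟨H, hH⟩ := exists_transpose_mul_self_eq hA.posSemidef
  have hdet : H.det * H.det = A.det := by rw [← hH, det_mul, det_transpose]
  have hu : IsUnit H.det := by
    rw [isUnit_iff_ne_zero]
    intro h0
    have := hA.det_pos
    rw [← hdet, h0] at this
    simp at this
  -- With `A = Hᵀ H` factored out, `B` is congruent to the identity plus a positive semidefinite
  -- matrix, whose determinant is at least one.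
  have h1 : B = Hᵀ * (1 + H⁻¹ᵀ * (B - A) * H⁻¹) * H := by
    have e1 : Hᵀ * (H⁻¹ᵀ * (B - A) * H⁻¹) * H = B - A := by
      calc Hᵀ * (H⁻¹ᵀ * (B - A) * H⁻¹) * H = (H⁻¹ * H)ᵀ * (B - A) * (H⁻¹ * H) := by
            simp only [transpose_mul, Matrix.mul_assoc]
        _ = _ := by rw [nonsing_inv_mul _ hu]; simp
    rw [mul_add, add_mul, e1, Matrix.mul_one, hH]; abel
  have h2 : (H⁻¹ᵀ * (B - A) * H⁻¹).PosSemidef := by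
    simpa using PosSemidef.conjTranspose_mul_mul_same h H⁻¹
  have h3 : B.det = A.det * (1 + H⁻¹ᵀ * (B - A) * H⁻¹).det := by
    conv_lhs => rw [h1]
    rw [det_mul, det_mul, det_transpose, ← hdet]; ring
  rw [h3]
  exact le_mul_of_one_le_right hA.det_pos.le (one_le_det_one_add h2)

theorem det_one_add_mul_mul_transpose_mono {K L : Matrix (Fin n) (Fin n) ℝ} (hK : K.PosSemidef)
    (h : LoewnerLE K L) (H : Matrix (Fin l) (Fin n) ℝ) :
    (1 + H * K * Hᵀ).det ≤ (1 + H * L * Hᵀ).det := by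
  refine LoewnerLE.det_le (posDef_one_add_mul_mul_transpose hK H) ?_
  have := PosSemidef.mul_mul_transpose_same h H
  rw [Matrix.mul_sub, Matrix.sub_mul] at this
  simpa [LoewnerLE] using this

theorem eq_of_loewnerLE_of_loewnerLE {A B : Matrix (Fin n) (Fin n) ℝ} (h₁ : LoewnerLE A B)
    (h₂ : LoewnerLE B A) : A = B := by
  open scoped MatrixOrder in
  exact le_antisymm (show A ≤ B from h₁) (show B ≤ A from h₂)

end Matrices

/-! ### Divergence, conditional mutual information and Markov chains in terms of kernels. -/

section Information

open InformationTheory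

section KL

variable {α β γ : Type*} [MeasurableSpace α] [MeasurableSpace β] [MeasurableSpace γ]

theorem klDiv_map_measurableEquiv (μ ν : Measure α) [IsFiniteMeasure μ] [IsFiniteMeasure ν]
    (e : α ≃ᵐ β) : klDiv (μ.map e) (ν.map e) = klDiv μ ν := by
  refine le_antisymm (klDiv_map_le _ _ e.measurable) ?_
  have h := klDiv_map_le (μ.map e) (ν.map e) e.symm.measurable
  rwa [Measure.map_map e.symm.measurable e.measurable,
    Measure.map_map e.symm.measurable e.measurable, MeasurableEquiv.symm_comp_self,
    Measure.map_id, Measure.map_id] at h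

theorem compProd_prod_eq_map (μ : Measure α) [IsFiniteMeasure μ] (κ : Kernel α β) (η : Kernel α γ)
    [IsMarkovKernel κ] [IsMarkovKernel η] :
    μ ⊗ₘ (κ ×ₖ η) =
      ((μ ⊗ₘ κ) ⊗ₘ (η.prodMkRight β)).map (MeasurableEquiv.prodAssoc : (α × β) × γ ≃ᵐ _) := by
  refine Measure.ext_of_lintegral _ fun f hf => ?_
  rw [lintegral_map hf (MeasurableEquiv.measurable _), Measure.lintegral_compProd hf,
    Measure.lintegral_compProd (by fun_prop), Measure.lintegral_compProd (by fun_prop)]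
  refine lintegral_congr fun a => ?_
  rw [Kernel.lintegral_prod _ _ _ (by fun_prop)]
  rfl

/-- Properties of a density when the divergence is finite. -/
theorem log_density_of_klDiv_ne_top {p r : Measure α} [IsProbabilityMeasure p]
    [IsProbabilityMeasure r] (h : klDiv p r ≠ ∞) {d : α → ℝ≥0∞} (hd : Measurable d)
    (hp : p = r.withDensity d) :
    (∀ᵐ x ∂p, d x ≠ 0) ∧ (∀ᵐ x ∂p, d x ≠ ∞) ∧ Integrable (fun x => Real.log (d x).toReal) p ∧
      ∫ x, Real.log (d x).toReal ∂p = (klDiv p r).toReal := by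
  obtain ⟨hac, hint⟩ := klDiv_ne_top_iff.mp h
  have hdr : p.rnDeriv r =ᵐ[r] d := by
    conv_lhs => rw [hp]
    exact Measure.rnDeriv_withDensity r hd
  have hdp : p.rnDeriv r =ᵐ[p] d := hac.ae_eq hdr
  have hl : llr p r =ᵐ[p] fun x => Real.log (d x).toReal := by
    filter_upwards [hdp] with x hx
    rw [llr, hx]
  refine ⟨?_, ?_, hint.congr hl, ?_⟩
  · filter_upwards [hdp, Measure.rnDeriv_pos hac] with x hx hx2
    rw [← hx]; exact hx2.ne'
  · filter_upwards [hdp, hac.ae_le (Measure.rnDeriv_ne_top p r)] with x hx hx2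
    rw [← hx]; exact hx2
  · rw [toReal_klDiv_of_measure_eq hac (by simp), integral_congr_ae hl]

theorem compProd_eq_withDensity_rnDeriv [MeasurableSpace.CountableOrCountablyGenerated α β]
    {μ : Measure α} [IsFiniteMeasure μ] {κ η : Kernel α β} [IsMarkovKernel κ] [IsMarkovKernel η]
    (h : ∀ᵐ a ∂μ, κ a ≪ η a) :
    μ ⊗ₘ κ = (μ ⊗ₘ η).withDensity (fun z => Kernel.rnDeriv κ η z.1 z.2) := by
  rw [← Measure.compProd_withDensity (Kernel.measurable_rnDeriv κ η)]
  refine Measure.compProd_congr ?_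
  filter_upwards [h] with a ha
  exact (Kernel.withDensity_rnDeriv_eq ha).symm

end KL

section Info

variable {Ω α β γ : Type*} [MeasurableSpace Ω] [MeasurableSpace α] [MeasurableSpace β]
  [MeasurableSpace γ] [StandardBorelSpace α] [Nonempty α] [StandardBorelSpace β] [Nonempty β]

/-- Over the common law of `(C, A)` the two laws differ only in the kernel that produces `B`, so
densities can be handled fibre by fibre. -/
theorem condMutualInfo_eq_klDiv_compProd (P : Measure Ω) [IsProbabilityMeasure P] {A : Ω → α}
    {B : Ω → β} {C : Ω → γ} (hA : Measurable A) (hB : Measurable B) (hC : Measurable C) :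
    condMutualInfo P A B C = klDiv (P.map fun ω => ((C ω, A ω), B ω))
      ((P.map fun ω => (C ω, A ω)) ⊗ₘ (condDistrib B C P).prodMkRight α) := by
  have : IsProbabilityMeasure (P.map C) := Measure.isProbabilityMeasure_map hC.aemeasurable
  rw [condMutualInfo, compProd_prod_eq_map, compProd_map_condDistrib hA.aemeasurable,
    ← klDiv_map_measurableEquiv _ _ (MeasurableEquiv.prodAssoc : (γ × α) × β ≃ᵐ _),
    Measure.map_map (MeasurableEquiv.measurable _) (by fun_prop)]
  rfl

theorem IsMarkovChain.map_eq_compProd [StandardBorelSpace Ω] {P : Measure Ω}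
    [IsProbabilityMeasure P] {A : Ω → α} {B : Ω → γ} {C : Ω → β} (h : IsMarkovChain P A B C)
    (hA : Measurable A) (hC : Measurable C) :
    (P.map fun ω => ((B ω, C ω), A ω)) =
      (P.map fun ω => (B ω, C ω)) ⊗ₘ (condDistrib A B P).prodMkRight β := by
  obtain ⟨hB, h⟩ := h
  rw [← condDistrib_ae_eq_iff_measure_eq_compProd _ hA.aemeasurable]
  exact (condIndepFun_iff_condDistrib_prod_ae_eq_prodMkRight hA hC hB).mp h.symm

end Info

section MarkovChain

variable {Ω α β γ δ ε : Type*} [MeasurableSpace Ω] [MeasurableSpace α] [MeasurableSpace β]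
  [MeasurableSpace γ] [MeasurableSpace δ] [MeasurableSpace ε] [StandardBorelSpace Ω]
  {P : Measure Ω} [IsProbabilityMeasure P] {A : Ω → α} {B : Ω → β} {C : Ω → γ}

theorem IsMarkovChain.comp (h : IsMarkovChain P A B C) {f : α → δ} {g : γ → ε}
    (hf : Measurable f) (hg : Measurable g) :
    IsMarkovChain P (fun ω => f (A ω)) B (fun ω => g (C ω)) := by
  obtain ⟨hB, h⟩ := h
  exact ⟨hB, h.comp hf hg⟩

theorem IsMarkovChain.symm (h : IsMarkovChain P A B C) : IsMarkovChain P C B A := by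
  obtain ⟨hB, h⟩ := h
  exact ⟨hB, h.symm⟩

end MarkovChain

end Information

/-! ### A Donsker-Varadhan bound for the sum of two conditional informations. -/

section Variational

open InformationTheory

variable {Ω α β β' γ δ ε : Type*} [MeasurableSpace Ω] [MeasurableSpace α] [MeasurableSpace β]
  [MeasurableSpace β'] [MeasurableSpace γ] [MeasurableSpace δ] [MeasurableSpace ε]

/-- Only an inequality, since `r` may charge the set where `d` vanishes. -/
theorem lintegral_div_le_of_withDensity {p r : Measure α} {d F : α → ℝ≥0∞} (hd : Measurable d)
    (hF : Measurable F) (h : p = r.withDensity d) : ∫⁻ x, F x / d x ∂p ≤ ∫⁻ x, F x ∂r := by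
  rw [h, lintegral_withDensity_eq_lintegral_mul _ hd (by fun_prop)]
  exact lintegral_mono fun x => ENNReal.mul_div_le

theorem integral_le_of_lintegral_exp_le_one {P : Measure Ω} [IsProbabilityMeasure P] {f : Ω → ℝ}
    (hf : Integrable f P) (h : ∫⁻ ω, ENNReal.ofReal (Real.exp (f ω)) ∂P ≤ 1) :
    ∫ ω, f ω ∂P ≤ 0 := by
  have hm : AEStronglyMeasurable (fun ω => Real.exp (f ω)) P :=
    Real.continuous_exp.comp_aestronglyMeasurable hf.1
  have hint : Integrable (fun ω => Real.exp (f ω)) P := by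
    rw [← lintegral_ofReal_ne_top_iff_integrable hm
      (Filter.Eventually.of_forall fun ω => (Real.exp_pos _).le)]
    exact (h.trans_lt ENNReal.one_lt_top).ne
  have h1 : ∫ ω, Real.exp (f ω) ∂P ≤ 1 := by
    rw [integral_eq_lintegral_of_nonneg_ae
      (Filter.Eventually.of_forall fun ω => (Real.exp_pos _).le) hm]
    exact ENNReal.toReal_le_of_le_ofReal zero_le_one (by simpa using h)
  have h2 : ∫ ω, f ω ∂P ≤ ∫ ω, (Real.exp (f ω) - 1) ∂P := by
    refine integral_mono hf (hint.sub (integrable_const _)) fun ω => ?_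
    have := Real.add_one_le_exp (f ω)
    simp only
    linarith
  rw [integral_sub hint (integrable_const _)] at h2
  simp at h2
  linarith

variable [StandardBorelSpace Ω] [StandardBorelSpace α] [Nonempty α] [StandardBorelSpace β]
  [Nonempty β] [StandardBorelSpace γ] [Nonempty γ] [StandardBorelSpace δ] [Nonempty δ]
  [StandardBorelSpace ε] [Nonempty ε]

/-- A variational lower bound for `I(X; A | Y₁) + I(X; V | A, Y)` when `Y₁` is a function of `Y`
and `A ↔ X ↔ Y`. -/
theorem integral_le_condMutualInfo_add {P : Measure Ω} [IsProbabilityMeasure P] {X : Ω → α}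
    {Y : Ω → β} {Y₁ : Ω → β'} {W : Ω → γ} {U : Ω → δ} {V : Ω → ε} (hX : Measurable X)
    (hY : Measurable Y) (hY₁ : Measurable Y₁) (hW : Measurable W) (hU : Measurable U)
    (hV : Measurable V) {g : β → β'} (hg : Measurable g) (hgY : Y₁ =ᵐ[P] fun ω => g (Y ω))
    (hM : IsMarkovChain P (fun ω => (W ω, U ω)) X Y)
    {f : (γ × δ × β) × α × ε → ℝ} (hf : Measurable f)
    (hfint : Integrable (fun ω => f ((W ω, U ω, Y ω), X ω, V ω)) P)
    {E : β × (γ × δ) → ℝ≥0∞}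
    (hfE : ∀ᵐ y ∂P.map Y, ∀ w u v, ∫⁻ x, ENNReal.ofReal (Real.exp (f ((w, u, y), x, v)))
      ∂condDistrib X Y P y ≤ E (y, (w, u)))
    (hE1 : ∫⁻ y, ∫⁻ a, E (y, a) ∂condDistrib (fun ω => (W ω, U ω)) Y₁ P (g y) ∂P.map Y ≤ 1) :
    ENNReal.ofReal (∫ ω, f ((W ω, U ω, Y ω), X ω, V ω) ∂P) ≤
      condMutualInfo P X (fun ω => (W ω, U ω)) Y₁ +
      condMutualInfo P X V (fun ω => (W ω, U ω, Y ω)) := by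
  set A : Ω → γ × δ := fun ω => (W ω, U ω) with hAdef
  set C : Ω → γ × δ × β := fun ω => (W ω, U ω, Y ω) with hCdef
  have hA : Measurable A := by fun_prop
  have hC : Measurable C := by fun_prop
  have pY : IsProbabilityMeasure (P.map Y) := Measure.isProbabilityMeasure_map hY.aemeasurable
  by_cases hI₁ : condMutualInfo P X A Y₁ = ∞
  · simp [hI₁]
  by_cases hI₃ : condMutualInfo P X V C = ∞
  · simp [hI₃]
  rw [condMutualInfo_eq_klDiv_compProd P hX hA hY₁] at hI₁ ⊢
  rw [condMutualInfo_eq_klDiv_compProd P hX hV hC] at hI₃ ⊢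
  set κA := condDistrib A X P
  set ηA := condDistrib A Y₁ P
  set κV := condDistrib V C P
  set κX := condDistrib X Y P
  have hp1Y : IsProbabilityMeasure (P.map fun ω => (Y₁ ω, X ω)) :=
    Measure.isProbabilityMeasure_map (by fun_prop)
  have hp1CX : IsProbabilityMeasure (P.map fun ω => (C ω, X ω)) :=
    Measure.isProbabilityMeasure_map (by fun_prop)
  have hp1 : IsProbabilityMeasure (P.map fun ω => ((Y₁ ω, X ω), A ω)) :=
    Measure.isProbabilityMeasure_map (by fun_prop)
  have hp3 : IsProbabilityMeasure (P.map fun ω => ((C ω, X ω), V ω)) :=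
    Measure.isProbabilityMeasure_map (by fun_prop)
  -- the joint laws
  have hYXA : (P.map fun ω => ((Y ω, X ω), A ω)) =
      (P.map fun ω => (Y ω, X ω)) ⊗ₘ κA.prodMkLeft β := by
    have h := hM.map_eq_compProd hA hY
    have h2 : (P.map fun ω => ((Y ω, X ω), A ω)) =
        (P.map fun ω => ((X ω, Y ω), A ω)).map (Prod.map Prod.swap id) := by
      rw [Measure.map_map (by fun_prop) (by fun_prop)]; rfl
    rw [h2, h]
    refine Measure.ext_of_lintegral _ fun F hF => ?_
    rw [lintegral_map hF (by fun_prop), Measure.lintegral_compProd (by fun_prop),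
      Measure.lintegral_compProd hF,
      lintegral_map (Measurable.lintegral_kernel_prod_right' (κ := κA.prodMkRight β)
        (f := fun z => F (Prod.map Prod.swap id z)) (by fun_prop)) (by fun_prop),
      lintegral_map (Measurable.lintegral_kernel_prod_right' (by fun_prop)) (by fun_prop)]
    rfl
  have hmap1 : (P.map fun ω => (Y₁ ω, X ω)) = (P.map fun ω => (Y ω, X ω)).map
      (Prod.map g id) := by
    rw [Measure.map_map (by fun_prop) (by fun_prop)]
    refine Measure.map_congr ?_
    filter_upwards [hgY] with ω hω
    simp [hω]
  have hY1XA : (P.map fun ω => ((Y₁ ω, X ω), A ω)) =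
      (P.map fun ω => (Y₁ ω, X ω)) ⊗ₘ κA.prodMkLeft β' := by
    have h2 : (P.map fun ω => ((Y₁ ω, X ω), A ω)) =
        (P.map fun ω => ((Y ω, X ω), A ω)).map (Prod.map (Prod.map g id) id) := by
      rw [Measure.map_map (by fun_prop) (by fun_prop)]
      refine Measure.map_congr ?_
      filter_upwards [hgY] with ω hω
      simp [hω]
    rw [h2, hYXA, hmap1]
    refine Measure.ext_of_lintegral _ fun F hF => ?_
    rw [lintegral_map hF (by fun_prop), Measure.lintegral_compProd (by fun_prop),
      Measure.lintegral_compProd hF,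
      lintegral_map (Measurable.lintegral_kernel_prod_right' hF) (by fun_prop)]
    rfl
  -- the densities
  set d₁ : (β' × α) × (γ × δ) → ℝ≥0∞ :=
    fun z => Kernel.rnDeriv (κA.prodMkLeft β') (ηA.prodMkRight α) z.1 z.2 with hd₁def
  have hd₁ : Measurable d₁ := Kernel.measurable_rnDeriv _ _
  have hac₁ : ∀ᵐ z ∂P.map fun ω => (Y₁ ω, X ω), κA.prodMkLeft β' z ≪ ηA.prodMkRight α z := by
    have := (klDiv_ne_top_iff.mp hI₁).1
    rw [hY1XA] at this
    exact Measure.absolutelyContinuous_compProd_right_iff.mp this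
  obtain ⟨h10, h1t, h1i, h1e⟩ := log_density_of_klDiv_ne_top hI₁ hd₁
    (by rw [hY1XA]; exact compProd_eq_withDensity_rnDeriv hac₁)
  set r₃ := (P.map fun ω => (C ω, X ω)) ⊗ₘ κV.prodMkRight α
  set d₃ := (P.map fun ω => ((C ω, X ω), V ω)).rnDeriv r₃
  have hd₃ : Measurable d₃ := Measure.measurable_rnDeriv _ _
  have hwd₃ : (P.map fun ω => ((C ω, X ω), V ω)) = r₃.withDensity d₃ :=
    (Measure.withDensity_rnDeriv_eq _ _ (klDiv_ne_top_iff.mp hI₃).1).symm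
  obtain ⟨h30, h3t, h3i, h3e⟩ := log_density_of_klDiv_ne_top hI₃ hd₃ hwd₃
  have l1 : Measurable fun x => Real.log (d₁ x).toReal :=
    Real.measurable_log.comp hd₁.ennreal_toReal
  have l3 : Measurable fun x => Real.log (d₃ x).toReal :=
    Real.measurable_log.comp hd₃.ennreal_toReal
  have m1 : AEMeasurable (fun ω => ((Y₁ ω, X ω), A ω)) P := by fun_prop
  have m3 : AEMeasurable (fun ω => ((C ω, X ω), V ω)) P := by fun_prop
  rw [integral_map m1 l1.aestronglyMeasurable] at h1e
  rw [integral_map m3 l3.aestronglyMeasurable] at h3e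
  replace h10 := ae_of_ae_map m1 h10
  replace h1t := ae_of_ae_map m1 h1t
  replace h30 := ae_of_ae_map m3 h30
  replace h3t := ae_of_ae_map m3 h3t
  replace h1i := (integrable_map_measure l1.aestronglyMeasurable m1).mp h1i
  replace h3i := (integrable_map_measure l3.aestronglyMeasurable m3).mp h3i
  -- the exponential moment
  set F : (γ × δ × β) × α × ε → ℝ≥0∞ := fun z => ENNReal.ofReal (Real.exp (f z)) with hFdef
  have hF : Measurable F := by fun_prop
  set D₁ : (γ × δ × β) × α → ℝ≥0∞ := fun z => d₁ ((g z.1.2.2, z.2), (z.1.1, z.1.2.1)) with hD₁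
  have hD₁m : Measurable D₁ := by fun_prop
  set h : (γ × δ × β) × α → ℝ≥0∞ := fun z => ∫⁻ v, F (z.1, z.2, v) ∂κV z.1 with hhdef
  have hhm : Measurable h := by
    have : Measurable fun z : ((γ × δ × β) × α) × ε => F (z.1.1, z.1.2, z.2) := by fun_prop
    exact Measurable.lintegral_kernel_prod_right' (κ := κV.prodMkRight α) this
  -- Dividing by `d₃` makes `V` independent of `X` given `C`; dividing by `d₁` redraws `A` from its
  -- law given `Y₁`. Then `X` is integrated last, against its law given `Y`, where `hfE` applies.
  have key : ∫⁻ ω, F (C ω, X ω, V ω) / D₁ (C ω, X ω) / d₃ ((C ω, X ω), V ω) ∂P ≤ 1 := by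
    calc ∫⁻ ω, F (C ω, X ω, V ω) / D₁ (C ω, X ω) / d₃ ((C ω, X ω), V ω) ∂P
        = ∫⁻ z, F (z.1.1, z.1.2, z.2) / D₁ z.1 / d₃ z ∂P.map fun ω => ((C ω, X ω), V ω) := by
          rw [lintegral_map (by fun_prop) (by fun_prop)]
      _ ≤ ∫⁻ z, F (z.1.1, z.1.2, z.2) / D₁ z.1 ∂r₃ :=
          lintegral_div_le_of_withDensity hd₃ (by fun_prop) hwd₃
      _ = ∫⁻ z, h z / D₁ z ∂P.map fun ω => (C ω, X ω) := by
          rw [Measure.lintegral_compProd (by fun_prop)]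
          refine lintegral_congr fun z => ?_
          simp only [div_eq_mul_inv]
          rw [lintegral_mul_const _ (by fun_prop)]
          rfl
      _ = ∫⁻ z, h ((z.2.1, z.2.2, z.1.1), z.1.2) / D₁ ((z.2.1, z.2.2, z.1.1), z.1.2)
            ∂P.map fun ω => ((Y ω, X ω), A ω) := by
          rw [lintegral_map (by fun_prop) (by fun_prop), lintegral_map (by fun_prop) (by fun_prop)]
      _ = ∫⁻ z, ∫⁻ a, h ((a.1, a.2, z.1), z.2) / d₁ ((g z.1, z.2), a) ∂κA z.2
            ∂P.map fun ω => (Y ω, X ω) := by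
          rw [hYXA, Measure.lintegral_compProd (by fun_prop)]
          rfl
      _ ≤ ∫⁻ z, ∫⁻ a, h ((a.1, a.2, z.1), z.2) ∂ηA (g z.1) ∂P.map fun ω => (Y ω, X ω) := by
          refine lintegral_mono_ae ?_
          rw [hmap1] at hac₁
          filter_upwards [ae_of_ae_map (by fun_prop) hac₁] with z hz
          refine lintegral_div_le_of_withDensity (by fun_prop) (by fun_prop) ?_
          refine (Kernel.withDensity_rnDeriv_eq hz).symm.trans ?_
          rw [Kernel.withDensity_apply _ (Kernel.measurable_rnDeriv _ _)]
          rfl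
      _ = ∫⁻ y, ∫⁻ x, ∫⁻ a, ∫⁻ v, F ((a.1, a.2, y), x, v) ∂κV (a.1, a.2, y) ∂ηA (g y) ∂κX y
            ∂P.map Y := by
          rw [← compProd_map_condDistrib hX.aemeasurable, Measure.lintegral_compProd]
          have : Measurable fun z : (β × α) × (γ × δ) => h ((z.2.1, z.2.2, z.1.1), z.1.2) := by
            fun_prop
          exact Measurable.lintegral_kernel_prod_right'
            (κ := (ηA.comap g hg).prodMkRight α) this
      _ = ∫⁻ y, ∫⁻ a, ∫⁻ v, ∫⁻ x, F ((a.1, a.2, y), x, v) ∂κX y ∂κV (a.1, a.2, y) ∂ηA (g y)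
            ∂P.map Y := by
          refine lintegral_congr fun y => ?_
          have hm : Measurable fun z : α × (γ × δ) => h ((z.2.1, z.2.2, y), z.1) := by fun_prop
          rw [lintegral_lintegral_swap hm.aemeasurable]
          refine lintegral_congr fun a => ?_
          have hm : Measurable fun z : α × ε => F ((a.1, a.2, y), z.1, z.2) := by fun_prop
          rw [lintegral_lintegral_swap hm.aemeasurable]
      _ ≤ ∫⁻ y, ∫⁻ a, E (y, a) ∂ηA (g y) ∂P.map Y := by
          refine lintegral_mono_ae ?_
          filter_upwards [hfE] with y hy
          refine lintegral_mono fun a => ?_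
          calc ∫⁻ v, ∫⁻ x, F ((a.1, a.2, y), x, v) ∂κX y ∂κV (a.1, a.2, y)
              ≤ ∫⁻ v, E (y, a) ∂κV (a.1, a.2, y) := lintegral_mono fun v => hy a.1 a.2 v
            _ = E (y, a) := by simp
      _ ≤ 1 := hE1
  -- Jensen's inequality for `f - log d₁ - log d₃`, whose mean is the mean of `f` minus the two
  -- informations.
  have hfin := integral_le_of_lintegral_exp_le_one ((hfint.sub h1i).sub h3i) (by
    refine le_of_eq_of_le (lintegral_congr_ae ?_) key
    filter_upwards [h10, h1t, h30, h3t, hgY] with ω a1 a2 a3 a4 a5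
    have e1 : D₁ (C ω, X ω) = d₁ ((Y₁ ω, X ω), A ω) := by simp [hD₁, hCdef, a5, hAdef]
    have p1 := ENNReal.toReal_pos a1 a2
    have p3 := ENNReal.toReal_pos a3 a4
    simp only [Pi.sub_apply, Function.comp]
    rw [Real.exp_sub, Real.exp_sub, Real.exp_log p1, Real.exp_log p3,
      ENNReal.ofReal_div_of_pos p3, ENNReal.ofReal_div_of_pos p1, ENNReal.ofReal_toReal a2,
      ENNReal.ofReal_toReal a4, e1])
  rw [integral_sub' (hfint.sub h1i) h3i, integral_sub' hfint h1i] at hfin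
  simp only [Function.comp] at hfin
  rw [h1e, h3e] at hfin
  rw [← ENNReal.ofReal_toReal hI₁, ← ENNReal.ofReal_toReal hI₃, ← ENNReal.ofReal_add
    ENNReal.toReal_nonneg ENNReal.toReal_nonneg]
  exact ENNReal.ofReal_le_ofReal (by linarith)

end Variational

/-! ### Second-moment matrices of square integrable vectors. -/

section SecondOrder

open Matrix

variable {Ω : Type*} [MeasurableSpace Ω] {P : Measure Ω} {n m l : ℕ}

/-- A random vector with square integrable coordinates. -/
def SqIntegrable (P : Measure Ω) (Z : Ω → Vec n) : Prop := ∀ i, MemLp (fun ω => Z ω i) 2 P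

/-- The matrix `E[Z Z'ᵀ]`. -/
noncomputable def crossMoment (P : Measure Ω) (Z : Ω → Vec n) (Z' : Ω → Vec m) :
    Matrix (Fin n) (Fin m) ℝ :=
  Matrix.of fun i j => ∫ ω, Z ω i * Z' ω j ∂P

theorem SqIntegrable.add {Z Z' : Ω → Vec n} (h : SqIntegrable P Z) (h' : SqIntegrable P Z') :
    SqIntegrable P (fun ω => Z ω + Z' ω) := fun i => (h i).add (h' i)

theorem SqIntegrable.sub {Z Z' : Ω → Vec n} (h : SqIntegrable P Z) (h' : SqIntegrable P Z') :
    SqIntegrable P (fun ω => Z ω - Z' ω) := fun i => (h i).sub (h' i)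

theorem SqIntegrable.mulVec {Z : Ω → Vec n} (h : SqIntegrable P Z)
    (A : Matrix (Fin m) (Fin n) ℝ) : SqIntegrable P (fun ω => A *ᵥ Z ω) := by
  intro i
  have : (fun ω => (A *ᵥ Z ω) i) = fun ω => ∑ j, A i j * Z ω j := by
    ext ω; simp [Matrix.mulVec, dotProduct]
  rw [this]
  exact memLp_finsetSum _ fun j _ => (h j).const_mul _

theorem SqIntegrable.integrable_mul {Z : Ω → Vec n} {Z' : Ω → Vec m} (h : SqIntegrable P Z)
    (h' : SqIntegrable P Z') (i : Fin n) (j : Fin m) : Integrable (fun ω => Z ω i * Z' ω j) P :=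
  (h i).integrable_mul (h' j)

theorem SqIntegrable.congr {Z Z' : Ω → Vec n} (h : SqIntegrable P Z) (hZ : Z =ᵐ[P] Z') :
    SqIntegrable P Z' := fun i => (memLp_congr_ae (by
  filter_upwards [hZ] with ω hω; rw [hω])).mp (h i)

theorem crossMoment_congr {Z Y : Ω → Vec n} {Z' Y' : Ω → Vec m} (h : Z =ᵐ[P] Y)
    (h' : Z' =ᵐ[P] Y') : crossMoment P Z Z' = crossMoment P Y Y' := by
  ext i j
  refine integral_congr_ae ?_
  filter_upwards [h, h'] with ω a b
  rw [a, b]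

theorem crossMoment_transpose (Z : Ω → Vec n) (Z' : Ω → Vec m) :
    (crossMoment P Z Z')ᵀ = crossMoment P Z' Z := by
  ext i j
  simp only [crossMoment, transpose_apply, of_apply]
  exact integral_congr_ae (.of_forall fun ω => mul_comm _ _)

theorem crossMoment_add_left {Z Y : Ω → Vec n} {Z' : Ω → Vec m} (h : SqIntegrable P Z)
    (hY : SqIntegrable P Y) (h' : SqIntegrable P Z') :
    crossMoment P (fun ω => Z ω + Y ω) Z' = crossMoment P Z Z' + crossMoment P Y Z' := by
  ext i j
  simp only [crossMoment, of_apply, Matrix.add_apply, Pi.add_apply, add_mul]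
  exact integral_add (h.integrable_mul h' i j) (hY.integrable_mul h' i j)

theorem crossMoment_sub_left {Z Y : Ω → Vec n} {Z' : Ω → Vec m} (h : SqIntegrable P Z)
    (hY : SqIntegrable P Y) (h' : SqIntegrable P Z') :
    crossMoment P (fun ω => Z ω - Y ω) Z' = crossMoment P Z Z' - crossMoment P Y Z' := by
  ext i j
  simp only [crossMoment, of_apply, Matrix.sub_apply, Pi.sub_apply, sub_mul]
  exact integral_sub (h.integrable_mul h' i j) (hY.integrable_mul h' i j)

theorem crossMoment_mulVec_left {Z : Ω → Vec n} {Z' : Ω → Vec m} (h : SqIntegrable P Z)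
    (h' : SqIntegrable P Z') (A : Matrix (Fin l) (Fin n) ℝ) :
    crossMoment P (fun ω => A *ᵥ Z ω) Z' = A * crossMoment P Z Z' := by
  ext i j
  simp only [crossMoment, of_apply, Matrix.mul_apply, Matrix.mulVec, dotProduct, Finset.sum_mul,
    mul_assoc]
  rw [integral_finsetSum _ fun a _ => (h.integrable_mul h' a j).const_mul _]
  exact Finset.sum_congr rfl fun a _ => integral_const_mul _ _

theorem crossMoment_add_right {Z : Ω → Vec n} {Z' Y' : Ω → Vec m} (h : SqIntegrable P Z)
    (h' : SqIntegrable P Z') (hY : SqIntegrable P Y') :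
    crossMoment P Z (fun ω => Z' ω + Y' ω) = crossMoment P Z Z' + crossMoment P Z Y' := by
  rw [← crossMoment_transpose, crossMoment_add_left h' hY h, transpose_add, crossMoment_transpose,
    crossMoment_transpose]

theorem crossMoment_sub_right {Z : Ω → Vec n} {Z' Y' : Ω → Vec m} (h : SqIntegrable P Z)
    (h' : SqIntegrable P Z') (hY : SqIntegrable P Y') :
    crossMoment P Z (fun ω => Z' ω - Y' ω) = crossMoment P Z Z' - crossMoment P Z Y' := by
  rw [← crossMoment_transpose, crossMoment_sub_left h' hY h, transpose_sub, crossMoment_transpose,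
    crossMoment_transpose]

theorem crossMoment_mulVec_right {Z : Ω → Vec n} {Z' : Ω → Vec m} (h : SqIntegrable P Z)
    (h' : SqIntegrable P Z') (A : Matrix (Fin l) (Fin m) ℝ) :
    crossMoment P Z (fun ω => A *ᵥ Z' ω) = crossMoment P Z Z' * Aᵀ := by
  rw [← crossMoment_transpose, crossMoment_mulVec_left h' h, transpose_mul, crossMoment_transpose]

theorem dotProduct_crossMoment_mulVec {Z : Ω → Vec n} (h : SqIntegrable P Z) (x : Vec n) :
    x ⬝ᵥ (crossMoment P Z Z *ᵥ x) = ∫ ω, (x ⬝ᵥ Z ω) ^ 2 ∂P := by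
  have e : (fun ω => (x ⬝ᵥ Z ω) ^ 2) = fun ω => ∑ i, ∑ j, x i * x j * (Z ω i * Z ω j) := by
    ext ω
    rw [sq, dotProduct, Finset.sum_mul_sum]
    exact Finset.sum_congr rfl fun i _ => Finset.sum_congr rfl fun j _ => by ring
  rw [e, integral_finsetSum _ fun i _ => integrable_finsetSum _ fun j _ =>
    (h.integrable_mul h i j).const_mul _]
  simp only [dotProduct, Matrix.mulVec, Finset.mul_sum]
  refine Finset.sum_congr rfl fun i _ => ?_
  rw [integral_finsetSum _ fun j _ => (h.integrable_mul h i j).const_mul _]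
  refine Finset.sum_congr rfl fun j _ => ?_
  rw [integral_const_mul]
  simp only [crossMoment, of_apply]
  ring

theorem posSemidef_crossMoment {Z : Ω → Vec n} (h : SqIntegrable P Z) :
    (crossMoment P Z Z).PosSemidef := by
  refine PosSemidef.of_dotProduct_mulVec_nonneg ?_ fun x => ?_
  · rw [IsHermitian, conjTranspose_eq_transpose_of_trivial, crossMoment_transpose]
  · rw [star_trivial, dotProduct_crossMoment_mulVec h]
    exact integral_nonneg fun ω => sq_nonneg _

theorem dotProduct_mulVec_eq_sum (M : Matrix (Fin n) (Fin n) ℝ) (x : Vec n) :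
    x ⬝ᵥ (M *ᵥ x) = ∑ i, ∑ j, M i j * (x i * x j) := by
  simp only [dotProduct, Matrix.mulVec, Finset.mul_sum]
  exact Finset.sum_congr rfl fun i _ => Finset.sum_congr rfl fun j _ => by ring

theorem SqIntegrable.integrable_dotProduct_mulVec {Z : Ω → Vec n} (h : SqIntegrable P Z)
    (M : Matrix (Fin n) (Fin n) ℝ) : Integrable (fun ω => Z ω ⬝ᵥ (M *ᵥ Z ω)) P := by
  simp only [dotProduct_mulVec_eq_sum]
  exact integrable_finsetSum _ fun i _ => integrable_finsetSum _ fun j _ =>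
    (h.integrable_mul h i j).const_mul _

theorem integral_dotProduct_mulVec {Z : Ω → Vec n} (h : SqIntegrable P Z)
    (M : Matrix (Fin n) (Fin n) ℝ) :
    ∫ ω, Z ω ⬝ᵥ (M *ᵥ Z ω) ∂P = (M * crossMoment P Z Z).trace := by
  have h1 : ∀ i j, Integrable (fun ω => M i j * (Z ω i * Z ω j)) P := fun i j =>
    (h.integrable_mul h i j).const_mul _
  have h2 : ∀ i, Integrable (fun ω => ∑ j, M i j * (Z ω i * Z ω j)) P := fun i =>
    integrable_finsetSum _ fun j _ => h1 i j
  simp only [dotProduct_mulVec_eq_sum]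
  rw [integral_finsetSum _ fun i _ => h2 i, Matrix.trace]
  refine Finset.sum_congr rfl fun i _ => ?_
  rw [integral_finsetSum _ fun j _ => h1 i j, Matrix.diag_apply, Matrix.mul_apply]
  refine Finset.sum_congr rfl fun j _ => ?_
  rw [integral_const_mul]
  simp only [crossMoment, of_apply]
  congr 1
  exact integral_congr_ae (.of_forall fun ω => mul_comm _ _)

theorem integral_inv_dotProduct_mulVec {Z : Ω → Vec n} (h : SqIntegrable P Z)
    {K : Matrix (Fin n) (Fin n) ℝ} (hK : K.PosDef) (hZ : crossMoment P Z Z = K) :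
    ∫ ω, Z ω ⬝ᵥ (K⁻¹ *ᵥ Z ω) ∂P = n := by
  rw [integral_dotProduct_mulVec h, hZ,
    nonsing_inv_mul _ ((isUnit_iff_isUnit_det _).mp hK.isUnit)]
  simp

end SecondOrder

/-! ### The density of a nondegenerate centred Gaussian vector. -/

section GaussianDensity

open Matrix

variable {Ω : Type*} [MeasurableSpace Ω] {P : Measure Ω} {n : ℕ}

theorem _root_.ProbabilityTheory.HasGaussianLaw.sqIntegrable {Z : Ω → Vec n}
    (h : HasGaussianLaw Z P) : SqIntegrable P Z := fun i =>
  (h.map (ContinuousLinearMap.proj i : Vec n →L[ℝ] ℝ)).memLp_two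

/-- The density of the centred Gaussian law with covariance `K`. -/
noncomputable def gaussDensity (K : Matrix (Fin n) (Fin n) ℝ) (x : Vec n) : ℝ :=
  (√(2 * Real.pi))⁻¹ ^ n * (√K.det)⁻¹ * Real.exp (-(x ⬝ᵥ (K⁻¹ *ᵥ x)) / 2)

theorem gaussDensity_pos {K : Matrix (Fin n) (Fin n) ℝ} (hK : K.PosDef) (x : Vec n) :
    0 < gaussDensity K x := by
  have := hK.det_pos
  unfold gaussDensity
  positivity

theorem continuous_gaussDensity (K : Matrix (Fin n) (Fin n) ℝ) : Continuous (gaussDensity K) := by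
  unfold gaussDensity
  fun_prop

theorem log_gaussDensity {K : Matrix (Fin n) (Fin n) ℝ} (hK : K.PosDef) (x : Vec n) :
    Real.log (gaussDensity K x) = n * Real.log (√(2 * Real.pi))⁻¹ - Real.log K.det / 2 -
      x ⬝ᵥ (K⁻¹ *ᵥ x) / 2 := by
  have := hK.det_pos
  unfold gaussDensity
  rw [Real.log_mul (by positivity) (by positivity), Real.log_mul (by positivity) (by positivity),
    Real.log_exp, Real.log_pow, Real.log_inv √K.det, Real.log_sqrt this.le]
  ring

theorem pi_gaussianReal_eq_withDensity :
    Measure.pi (fun _ : Fin n => gaussianReal 0 1) =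
      volume.withDensity fun x : Vec n => ENNReal.ofReal (∏ i, gaussianPDFReal 0 1 (x i)) := by
  refine Measure.pi_eq fun s hs => ?_
  have hnn : ∀ x : Vec n, 0 ≤ ∏ i, gaussianPDFReal 0 1 (x i) := fun x =>
    Finset.prod_nonneg fun i _ => gaussianPDFReal_nonneg _ _ _
  have hint : ∀ i, Integrable ((s i).indicator (gaussianPDFReal 0 1)) := fun i =>
    (integrable_gaussianPDFReal 0 1).indicator (hs i)
  have e : ∀ x : Vec n, (Set.pi Set.univ s).indicator (fun x => ∏ i, gaussianPDFReal 0 1 (x i)) x =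
      ∏ i, (s i).indicator (gaussianPDFReal 0 1) (x i) := by
    intro x
    by_cases hx : x ∈ Set.pi Set.univ s
    · rw [Set.indicator_of_mem hx]
      exact Finset.prod_congr rfl fun i _ => (Set.indicator_of_mem (hx i (Set.mem_univ i)) _).symm
    · rw [Set.indicator_of_notMem hx]
      simp only [Set.mem_pi, Set.mem_univ, true_imp_iff, not_forall] at hx
      obtain ⟨i, hi⟩ := hx
      exact (Finset.prod_eq_zero (Finset.mem_univ i) (Set.indicator_of_notMem hi _)).symm
  rw [withDensity_apply _ (MeasurableSet.univ_pi hs), ← lintegral_indicator (MeasurableSet.univ_pi hs)]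
  have e2 : ∀ x : Vec n, (Set.pi Set.univ s).indicator
      (fun x : Vec n => ENNReal.ofReal (∏ i, gaussianPDFReal 0 1 (x i))) x =
      ENNReal.ofReal (∏ i, (s i).indicator (gaussianPDFReal 0 1) (x i)) := by
    intro x
    rw [← e]
    by_cases hx : x ∈ Set.pi Set.univ s
    · rw [Set.indicator_of_mem hx, Set.indicator_of_mem hx]
    · rw [Set.indicator_of_notMem hx, Set.indicator_of_notMem hx, ENNReal.ofReal_zero]
  simp only [e2]
  have hint2 := Integrable.fintype_prod (μ := fun _ : Fin n => (volume : Measure ℝ)) hint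
  rw [← volume_pi] at hint2
  rw [← ofReal_integral_eq_lintegral_ofReal hint2
    (.of_forall fun x => Finset.prod_nonneg fun i _ =>
      Set.indicator_nonneg (fun y _ => gaussianPDFReal_nonneg _ _ _) _),
    integral_fintype_prod_volume_eq_prod (fun i => (s i).indicator (gaussianPDFReal 0 1)),
    ENNReal.ofReal_prod_of_nonneg fun i _ => integral_nonneg fun y =>
      Set.indicator_nonneg (fun y _ => gaussianPDFReal_nonneg _ _ _) _]
  refine Finset.prod_congr rfl fun i _ => ?_
  rw [gaussianReal_apply_eq_integral _ one_ne_zero, integral_indicator (hs i)]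

theorem prod_gaussianPDFReal (x : Vec n) :
    ∏ i, gaussianPDFReal 0 1 (x i) = (√(2 * Real.pi))⁻¹ ^ n * Real.exp (-(x ⬝ᵥ x) / 2) := by
  simp only [gaussianPDFReal, NNReal.coe_one, mul_one, sub_zero]
  rw [Finset.prod_mul_distrib, ← Real.exp_sum]
  simp only [Finset.prod_const, Finset.card_univ, Fintype.card_fin, dotProduct]
  congr 2
  rw [← Finset.sum_div, Finset.sum_neg_distrib]
  simp [sq]

/-- Whitening: with `HᵀH = K`, the vector `(Hᵀ)⁻¹ Z` has identity covariance, so its coordinates are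
independent standard Gaussians. The product density is carried back by a linear change of variables,
with Jacobian `√(det K)`. -/
theorem map_eq_withDensity_gaussDensity {Z : Ω → Vec n} (hZ : HasGaussianLaw Z P)
    (h0 : ∀ i, ∫ ω, Z ω i ∂P = 0) {K : Matrix (Fin n) (Fin n) ℝ} (hK : K.PosDef)
    (hc : crossMoment P Z Z = K) :
    P.map Z = volume.withDensity fun x => ENNReal.ofReal (gaussDensity K x) := by
  have := hZ.isProbabilityMeasure
  obtain ⟨H, hH⟩ := exists_transpose_mul_self_eq hK.posSemidef
  have hdet : Hᵀ.det * Hᵀ.det = K.det := by rw [← hH, det_mul, det_transpose]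
  have hd0 : Hᵀ.det ≠ 0 := by
    intro h; have := hK.det_pos; rw [← hdet, h] at this; simp at this
  have hu : IsUnit Hᵀ.det := isUnit_iff_ne_zero.mpr hd0
  have hu' : IsUnit H.det := by rwa [det_transpose] at hu
  set T := Hᵀ⁻¹ with hT
  have hTH : Hᵀ * T = 1 := mul_nonsing_inv _ hu
  set z : Ω → Vec n := fun ω => T *ᵥ Z ω with hz
  have hzG : HasGaussianLaw z P := hZ.map (Matrix.toLin' T).toContinuousLinearMap
  have hzc : crossMoment P z z = 1 := by
    rw [hz, crossMoment_mulVec_left hZ.sqIntegrable (hZ.sqIntegrable.mulVec T),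
      crossMoment_mulVec_right hZ.sqIntegrable hZ.sqIntegrable, hc, ← hH]
    calc T * (Hᵀ * H * Tᵀ) = (T * Hᵀ) * (T * Hᵀ)ᵀ := by
          rw [transpose_mul, transpose_transpose]; simp only [Matrix.mul_assoc]
      _ = 1 := by rw [nonsing_inv_mul _ hu]; simp
  have hz0 : ∀ i, ∫ ω, z ω i ∂P = 0 := by
    intro i
    simp only [hz, Matrix.mulVec, dotProduct]
    rw [integral_finsetSum _ fun j _ =>
      ((hZ.sqIntegrable j).integrable (by norm_num)).const_mul _]
    simp [integral_const_mul, h0]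
  have hzi : ∀ i, HasGaussianLaw (fun ω => z ω i) P := fun i =>
    hzG.map (ContinuousLinearMap.proj i : Vec n →L[ℝ] ℝ)
  have hcov : ∀ i j, cov[fun ω => z ω i, fun ω => z ω j; P] = (1 : Matrix (Fin n) (Fin n) ℝ) i j := by
    intro i j
    rw [covariance, ← hzc]
    simp [hz0, crossMoment]
  have hind : iIndepFun (fun i ω => z ω i) P :=
    HasGaussianLaw.iIndepFun_of_covariance_eq_zero hzG fun i j hij => by rw [hcov, one_apply_ne hij]
  have hlaw : P.map z = Measure.pi (fun _ : Fin n => gaussianReal 0 1) := by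
    have h1 := (iIndepFun_iff_map_fun_eq_pi_map fun i => (hzi i).aemeasurable).mp hind
    rw [show z = fun ω i => z ω i from rfl, h1]
    congr 1
    ext1 i
    rw [(hzi i).map_eq_gaussianReal, hz0, ← covariance_self (hzi i).aemeasurable, hcov]
    simp
  have hZz : Z = fun ω => Matrix.toLin' Hᵀ (z ω) := by
    ext1 ω
    simp [hz, hTH]
  have hmeas : Measurable (Matrix.toLin' Hᵀ : Vec n → Vec n) :=
    (Matrix.toLin' Hᵀ).toContinuousLinearMap.continuous.measurable
  have hmapZ : P.map Z = (P.map z).map (Matrix.toLin' Hᵀ) := by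
    conv_lhs => rw [hZz]
    rw [AEMeasurable.map_map_of_aemeasurable hmeas.aemeasurable hzG.aemeasurable]
    rfl
  have hvol : (volume : Measure (Vec n)) =
      ENNReal.ofReal |Hᵀ.det| • (volume : Measure (Vec n)).map (Matrix.toLin' Hᵀ) := by
    rw [Real.map_matrix_volume_pi_eq_smul_volume_pi hd0, smul_smul,
      ← ENNReal.ofReal_mul (abs_nonneg _), ← abs_mul, mul_inv_cancel₀ hd0]
    simp
  have hsq : √K.det = |Hᵀ.det| := by rw [← hdet, Real.sqrt_mul_self_eq_abs]
  refine Measure.ext_of_lintegral _ fun f hf => ?_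
  have hg : Measurable fun x : Vec n => ENNReal.ofReal (gaussDensity K x) :=
    (continuous_gaussDensity K).measurable.ennreal_ofReal
  have hg2 : Measurable fun x : Vec n => ENNReal.ofReal (∏ i, gaussianPDFReal 0 1 (x i)) := by
    simp only [prod_gaussianPDFReal]
    fun_prop
  have hf' : Measurable fun x => f (Matrix.toLin' Hᵀ x) := hf.comp hmeas
  rw [hmapZ, hlaw, pi_gaussianReal_eq_withDensity, lintegral_map hf hmeas,
    lintegral_withDensity_eq_lintegral_mul _ hg2 hf',
    lintegral_withDensity_eq_lintegral_mul _ hg hf]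
  conv_rhs => rw [hvol]
  have hgf : Measurable fun x : Vec n =>
      ((fun x => ENNReal.ofReal (gaussDensity K x)) * f) (Matrix.toLin' Hᵀ x) :=
    (hg.mul hf).comp hmeas
  rw [lintegral_smul_measure, lintegral_map (hg.mul hf) hmeas, smul_eq_mul,
    ← lintegral_const_mul _ hgf]
  refine lintegral_congr fun x => ?_
  simp only [Pi.mul_apply]
  rw [← mul_assoc, ← ENNReal.ofReal_mul (abs_nonneg _)]
  congr 2
  rw [prod_gaussianPDFReal, gaussDensity, hsq]
  have hq : (Matrix.toLin' Hᵀ x) ⬝ᵥ (K⁻¹ *ᵥ (Matrix.toLin' Hᵀ x)) = x ⬝ᵥ x := by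
    rw [Matrix.toLin'_apply, Matrix.mulVec_mulVec, ← hH, Matrix.mul_inv_rev, Matrix.mul_assoc,
      nonsing_inv_mul _ hu, Matrix.mul_one, dotProduct_mulVec, vecMul_mulVec]
    rw [transpose_transpose, mul_nonsing_inv _ hu', vecMul_one]
  rw [hq]
  have : |Hᵀ.det| ≠ 0 := abs_ne_zero.mpr hd0
  field_simp

end GaussianDensity

/-! ### Extending independence to further variables. -/

section Independence

variable {Ω α β γ δ ε : Type*} [MeasurableSpace Ω] [MeasurableSpace α] [MeasurableSpace β]
  [MeasurableSpace γ] [MeasurableSpace δ] [MeasurableSpace ε]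

theorem indepFun_prod_right_of_prod_left {P : Measure Ω} [IsProbabilityMeasure P] {A : Ω → α}
    {B : Ω → β} {C : Ω → γ} (hA : Measurable A) (hB : Measurable B) (hC : Measurable C)
    (hAB : IndepFun A B P) (hABC : IndepFun (fun ω => (A ω, B ω)) C P) :
    IndepFun A (fun ω => (B ω, C ω)) P := by
  have hBC : IndepFun B C P := hABC.comp measurable_snd measurable_id
  rw [indepFun_iff_map_prod_eq_prod_map_map (by fun_prop) (by fun_prop)] at hAB hBC hABC ⊢
  have e : (P.map fun ω => (A ω, B ω, C ω)) =
      (P.map fun ω => ((A ω, B ω), C ω)).map MeasurableEquiv.prodAssoc := by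
    rw [Measure.map_map (MeasurableEquiv.measurable _) (by fun_prop)]; rfl
  have := Measure.isProbabilityMeasure_map (μ := P) hA.aemeasurable
  have := Measure.isProbabilityMeasure_map (μ := P) hB.aemeasurable
  have := Measure.isProbabilityMeasure_map (μ := P) hC.aemeasurable
  rw [e, hABC, hAB, Measure.prodAssoc_prod, hBC]

/-- Independence of functions of `(B, C)` extends along a Markov chain `A ↔ B ↔ C`. -/
theorem IsMarkovChain.indepFun_prod [StandardBorelSpace Ω] [StandardBorelSpace α] [Nonempty α]
    [StandardBorelSpace γ] [Nonempty γ] {P : Measure Ω} [IsProbabilityMeasure P] {A : Ω → α} {B : Ω → β} {C : Ω → γ}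
    (h : IsMarkovChain P A B C) (hA : Measurable A) (hC : Measurable C) {n : β × γ → δ}
    {t : β × γ → ε} {b : ε → β} (hn : Measurable n) (ht : Measurable t) (hb : Measurable b)
    (hbt : ∀ z, b (t z) = z.1)
    (hind : IndepFun (fun ω => n (B ω, C ω)) (fun ω => t (B ω, C ω)) P) :
    IndepFun (fun ω => n (B ω, C ω)) (fun ω => (t (B ω, C ω), A ω)) P := by
  have hB : Measurable B := h.1
  have hlaw := h.map_eq_compProd hA hC
  set κ := condDistrib A B P
  have := Measure.isProbabilityMeasure_map (μ := P) (f := fun ω => (B ω, C ω)) (by fun_prop)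
  have := Measure.isProbabilityMeasure_map (μ := P) (f := fun ω => n (B ω, C ω)) (by fun_prop)
  have := Measure.isProbabilityMeasure_map (μ := P) (f := fun ω => t (B ω, C ω)) (by fun_prop)
  have key : ∀ F : ε × α → ℝ≥0∞, Measurable F → Measurable fun x => ∫⁻ a, F (x, a) ∂κ (b x) := by
    intro F hF
    exact Measurable.lintegral_kernel_prod_right' (κ := κ.comap b hb) hF
  -- As `t` determines `B` through `b`, the law of `A` given `t(B, C)` is still `κ` at `B`. Hence
  -- `A` is drawn from `t` without any regard to `n`.
  have hT : (P.map fun ω => (t (B ω, C ω), A ω)) =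
      (P.map fun ω => t (B ω, C ω)) ⊗ₘ κ.comap b hb := by
    have e : (P.map fun ω => (t (B ω, C ω), A ω)) =
        (P.map fun ω => ((B ω, C ω), A ω)).map (Prod.map t id) := by
      rw [Measure.map_map (by fun_prop) (by fun_prop)]; rfl
    rw [e, hlaw]
    refine Measure.ext_of_lintegral _ fun F hF => ?_
    rw [lintegral_map hF (by fun_prop), Measure.lintegral_compProd (by fun_prop),
      Measure.lintegral_compProd hF, lintegral_map (Measurable.lintegral_kernel_prod_right'
        (κ := κ.prodMkRight γ) (f := fun z => F (Prod.map t id z)) (by fun_prop)) (by fun_prop),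
      lintegral_map (f := fun x => ∫⁻ a, F (x, a) ∂κ.comap b hb x) (key F hF) (by fun_prop)]
    simp [hbt]
  rw [indepFun_iff_map_prod_eq_prod_map_map (by fun_prop) (by fun_prop)] at hind ⊢
  have e : (P.map fun ω => (n (B ω, C ω), t (B ω, C ω), A ω)) =
      (P.map fun ω => ((B ω, C ω), A ω)).map (fun z => (n z.1, t z.1, z.2)) := by
    rw [Measure.map_map (by fun_prop) (by fun_prop)]; rfl
  rw [e, hlaw, hT]
  refine Measure.ext_of_lintegral _ fun F hF => ?_
  have hk2 : Measurable fun x : δ × ε => ∫⁻ a, F (x.1, x.2, a) ∂κ (b x.2) :=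
    Measurable.lintegral_kernel_prod_right' (κ := κ.comap (fun x : δ × ε => b x.2) (by fun_prop))
      (f := fun z => F (z.1.1, z.1.2, z.2)) (by fun_prop)
  rw [lintegral_map hF (by fun_prop), Measure.lintegral_compProd (by fun_prop),
    lintegral_prod _ hF.aemeasurable,
    lintegral_map (Measurable.lintegral_kernel_prod_right' (κ := κ.prodMkRight γ)
      (f := fun z => F (n z.1, t z.1, z.2)) (by fun_prop)) (by fun_prop)]
  have e2 : ∫⁻ ω, ∫⁻ a, F (n (B ω, C ω), t (B ω, C ω), a) ∂κ (b (t (B ω, C ω))) ∂P =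
      ∫⁻ x, ∫⁻ a, F (x.1, x.2, a) ∂κ (b x.2) ∂P.map fun ω => (n (B ω, C ω), t (B ω, C ω)) := by
    rw [lintegral_map hk2 (by fun_prop)]
  simp only [hbt] at e2
  simp only [Kernel.prodMkRight_apply]
  rw [e2, hind, lintegral_prod _ hk2.aemeasurable]
  refine lintegral_congr fun x => ?_
  rw [Measure.lintegral_compProd (by fun_prop)]
  rfl

end Independence

/-! ### Conditional means and the minimality of the conditional covariance. -/

section CondCov

open Matrix

variable {Ω γ δ : Type*} [mΩ : MeasurableSpace Ω] [MeasurableSpace γ] [MeasurableSpace δ] {P : Measure Ω}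
  {n m : ℕ}

/-- The random vector `E[X|Z]`. -/
noncomputable def condMean (P : Measure Ω) (X : Ω → Vec n) (Z : Ω → γ) : Ω → Vec n := fun ω i =>
  (P[fun ω' => X ω' i | MeasurableSpace.comap Z inferInstance]) ω

theorem condCov_eq_crossMoment (X : Ω → Vec n) (Z : Ω → γ) :
    condCov P X Z =
      crossMoment P (fun ω => X ω - condMean P X Z ω) (fun ω => X ω - condMean P X Z ω) := rfl

theorem SqIntegrable.condMean {X : Ω → Vec n} (hX : SqIntegrable P X) (Z : Ω → γ) :
    SqIntegrable P (condMean P X Z) := fun i => (hX i).condExp one_le_two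

theorem exists_measurable_condMean_eq (X : Ω → Vec n) (Z : Ω → γ) :
    ∃ φ : γ → Vec n, Measurable φ ∧ condMean P X Z = fun ω => φ (Z ω) := by
  have h : ∀ i, ∃ φ : γ → ℝ, StronglyMeasurable φ ∧
      P[fun ω' => X ω' i | MeasurableSpace.comap Z inferInstance] = φ ∘ Z := fun i =>
    StronglyMeasurable.exists_eq_measurable_comp stronglyMeasurable_condExp
  choose φ hφ he using h
  refine ⟨fun z i => φ i z, measurable_pi_lambda _ fun i => (hφ i).measurable, ?_⟩
  ext ω i
  exact congrFun (he i) ω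

theorem posSemidef_condCov {X : Ω → Vec n} (hX : SqIntegrable P X) (Z : Ω → γ) :
    (condCov P X Z).PosSemidef :=
  posSemidef_crossMoment (hX.sub (hX.condMean Z))

variable [IsProbabilityMeasure P]

theorem crossMoment_sub_condMean_eq_zero {X : Ω → Vec n} (hX : SqIntegrable P X) {Z : Ω → γ}
    (hZ : Measurable Z) {φ : γ → Vec m} (hφ : Measurable φ)
    (hφ2 : SqIntegrable P fun ω => φ (Z ω)) :
    crossMoment P (fun ω => X ω - condMean P X Z ω) (fun ω => φ (Z ω)) = 0 := by
  rw [crossMoment_sub_left hX (hX.condMean Z) hφ2, sub_eq_zero]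
  ext i j
  have hint := hX.integrable_mul hφ2 i j
  have hm : StronglyMeasurable[MeasurableSpace.comap Z inferInstance] fun ω => φ (Z ω) j := by
    refine Measurable.stronglyMeasurable ?_
    exact (measurable_pi_apply j).comp (hφ.comp (comap_measurable Z))
  have h := condExp_mul_of_stronglyMeasurable_right hm hint ((hX i).integrable one_le_two)
  have h2 := integral_condExp (μ := P) hZ.comap_le (f := (fun ω => X ω i) * fun ω => φ (Z ω) j)
  rw [integral_congr_ae h] at h2
  exact h2.symm

/-- The conditional mean minimises the error covariance. -/
theorem condCov_loewnerLE_crossMoment {X : Ω → Vec n} (hX : SqIntegrable P X) {Z : Ω → γ}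
    (hZ : Measurable Z) {φ : γ → Vec n} (hφ : Measurable φ)
    (hφ2 : SqIntegrable P fun ω => φ (Z ω)) :
    LoewnerLE (condCov P X Z)
      (crossMoment P (fun ω => X ω - φ (Z ω)) (fun ω => X ω - φ (Z ω))) := by
  obtain ⟨ψ, hψ, hψe⟩ := exists_measurable_condMean_eq (P := P) X Z
  have hm := hX.condMean Z
  have he := hX.sub hm
  have hd : SqIntegrable P fun ω => condMean P X Z ω - φ (Z ω) := hm.sub hφ2
  -- Orthogonality principle: the error is uncorrelated with every function of `Z`, so the cross
  -- terms in the expansion of the covariance vanish.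
  have h0 : crossMoment P (fun ω => X ω - condMean P X Z ω)
      (fun ω => condMean P X Z ω - φ (Z ω)) = 0 := by
    rw [hψe] at hd ⊢
    have := crossMoment_sub_condMean_eq_zero hX hZ (φ := fun z => ψ z - φ z) (by fun_prop) hd
    rwa [hψe] at this
  have h0' : crossMoment P (fun ω => condMean P X Z ω - φ (Z ω))
      (fun ω => X ω - condMean P X Z ω) = 0 := by
    rw [← crossMoment_transpose, h0, transpose_zero]
  have e : (fun ω => X ω - φ (Z ω)) =
      fun ω => (X ω - condMean P X Z ω) + (condMean P X Z ω - φ (Z ω)) := by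
    ext ω; simp
  rw [LoewnerLE, e, crossMoment_add_left he hd (he.add hd), crossMoment_add_right he he hd,
    crossMoment_add_right hd he hd, h0, h0', condCov_eq_crossMoment, add_zero, zero_add,
    add_sub_cancel_left]
  exact posSemidef_crossMoment hd

/-- Conditioning on more reduces the error covariance. -/
theorem condCov_comp_loewnerLE {X : Ω → Vec n} (hX : SqIntegrable P X) {Z : Ω → γ}
    (hZ : Measurable Z) {ρ : γ → δ} (hρ : Measurable ρ) :
    LoewnerLE (condCov P X Z) (condCov P X fun ω => ρ (Z ω)) := by
  obtain ⟨ψ, hψ, hψe⟩ := exists_measurable_condMean_eq (P := P) X (fun ω => ρ (Z ω))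
  rw [condCov_eq_crossMoment X fun ω => ρ (Z ω), hψe]
  refine condCov_loewnerLE_crossMoment hX hZ (φ := fun z => ψ (ρ z)) (by fun_prop) ?_
  have := hX.condMean (fun ω => ρ (Z ω))
  rwa [hψe] at this

/-- For permuting and regrouping the observed variables: each of the two observations is a function
of the other. -/
theorem condCov_comp_eq {X : Ω → Vec n} (hX : SqIntegrable P X) {Z : Ω → γ} (hZ : Measurable Z)
    {ρ : γ → δ} (hρ : Measurable ρ) {σ : δ → γ} (hσ : Measurable σ) (h : ∀ z, σ (ρ z) = z) :
    condCov P X (fun ω => ρ (Z ω)) = condCov P X Z := by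
  refine eq_of_loewnerLE_of_loewnerLE ?_ (condCov_comp_loewnerLE hX hZ hρ)
  have := condCov_comp_loewnerLE hX (hρ.comp hZ) hσ
  simpa [Function.comp_def, h] using this

/-- Almost everywhere equal observations may generate different σ-algebras, so the comparison passes
through minimality of the error in both directions. -/
theorem condCov_congr {X : Ω → Vec n} (hX : SqIntegrable P X) {Z : Ω → γ} (hZ : Measurable Z)
    {Z' : Ω → γ} (hZ' : Measurable Z') (h : Z =ᵐ[P] Z') : condCov P X Z = condCov P X Z' := by
  have key : ∀ {Z Z' : Ω → γ}, Measurable Z → Measurable Z' → Z =ᵐ[P] Z' →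
      LoewnerLE (condCov P X Z) (condCov P X Z') := by
    intro Z Z' hZ hZ' h
    obtain ⟨ψ, hψ, hψe⟩ := exists_measurable_condMean_eq (P := P) X Z'
    have hs := hX.condMean (P := P) Z'
    have h2 : (fun ω => ψ (Z' ω)) =ᵐ[P] fun ω => ψ (Z ω) := by
      filter_upwards [h] with ω hω; rw [hω]
    rw [hψe] at hs
    have h3 : (fun ω => X ω - ψ (Z' ω)) =ᵐ[P] fun ω => X ω - ψ (Z ω) := by
      filter_upwards [h2] with ω hω; rw [hω]
    rw [condCov_eq_crossMoment X Z', hψe, crossMoment_congr h3 h3]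
    exact condCov_loewnerLE_crossMoment hX hZ hψ (hs.congr h2)
  exact eq_of_loewnerLE_of_loewnerLE (key hZ hZ' h) (key hZ' hZ h.symm)

end CondCov

/-! ### Gaussian regression with an independent residual. -/

section Residual

open Matrix

variable {Ω Ω' γ δ : Type*} [MeasurableSpace Ω] [MeasurableSpace Ω'] [MeasurableSpace γ]
  [MeasurableSpace δ] {P : Measure Ω} {n m l : ℕ}

/-- `X - M(C)` is a centred Gaussian vector with covariance `K` independent of `C`. -/
structure GaussianResidual (P : Measure Ω) (X : Ω → Vec n) (C : Ω → γ) (M : γ → Vec n)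
    (K : Matrix (Fin n) (Fin n) ℝ) : Prop where
  measurable : Measurable M
  hasGaussianLaw : HasGaussianLaw (fun ω => X ω - M (C ω)) P
  mean : ∀ i, ∫ ω, (X ω - M (C ω)) i ∂P = 0
  cov : crossMoment P (fun ω => X ω - M (C ω)) (fun ω => X ω - M (C ω)) = K
  indep : IndepFun (fun ω => X ω - M (C ω)) C P

theorem _root_.ProbabilityTheory.IndepFun.of_map {α β : Type*} [MeasurableSpace α]
    [MeasurableSpace β] [IsProbabilityMeasure P] {φ : Ω → Ω'} (hφ : Measurable φ) {A : Ω' → α}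
    {B : Ω' → β} (hA : Measurable A) (hB : Measurable B) (h : IndepFun A B (P.map φ)) :
    IndepFun (fun ω => A (φ ω)) (fun ω => B (φ ω)) P := by
  have := Measure.isProbabilityMeasure_map (μ := P) hφ.aemeasurable
  rw [indepFun_iff_map_prod_eq_prod_map_map (by fun_prop) (by fun_prop)] at h ⊢
  rwa [Measure.map_map (by fun_prop) hφ, Measure.map_map (by fun_prop) hφ,
    Measure.map_map (by fun_prop) hφ] at h

theorem _root_.ProbabilityTheory.HasGaussianLaw.of_map {E : Type*} [NormedAddCommGroup E]
    [NormedSpace ℝ E] [MeasurableSpace E] [BorelSpace E] {φ : Ω → Ω'} (hφ : Measurable φ)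
    {A : Ω' → E} (hA : Measurable A) (h : HasGaussianLaw A (P.map φ)) :
    HasGaussianLaw (fun ω => A (φ ω)) P := by
  refine ⟨?_⟩
  have := h.isGaussian_map
  rwa [Measure.map_map hA hφ] at this

theorem crossMoment_map {φ : Ω → Ω'} (hφ : Measurable φ) {A : Ω' → Vec n} {B : Ω' → Vec m}
    (hA : Measurable A) (hB : Measurable B) :
    crossMoment (P.map φ) A B = crossMoment P (fun ω => A (φ ω)) (fun ω => B (φ ω)) := by
  ext i j
  simp only [crossMoment, of_apply]
  rw [integral_map hφ.aemeasurable]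
  have h1 : Measurable fun ω => A ω i := (measurable_pi_apply i).comp hA
  have h2 : Measurable fun ω => B ω j := (measurable_pi_apply j).comp hB
  exact (h1.mul h2).aestronglyMeasurable

theorem GaussianResidual.of_map [IsProbabilityMeasure P] {φ : Ω → Ω'} (hφ : Measurable φ)
    {X : Ω' → Vec n} {C : Ω' → γ} (hX : Measurable X) (hC : Measurable C) {M : γ → Vec n}
    {K : Matrix (Fin n) (Fin n) ℝ} (h : GaussianResidual (P.map φ) X C M K) :
    GaussianResidual P (fun ω => X (φ ω)) (fun ω => C (φ ω)) M K := by
  have hM := h.measurable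
  have hm : Measurable fun ω => X ω - M (C ω) := by fun_prop
  refine ⟨hM, .of_map hφ hm h.hasGaussianLaw, fun i => ?_, ?_, h.indep.of_map hφ hm hC⟩
  · have h0 := h.mean i
    have hmi : Measurable fun ω => (X ω - M (C ω)) i := (measurable_pi_apply i).comp hm
    rwa [integral_map hφ.aemeasurable hmi.aestronglyMeasurable] at h0
  · rw [← h.cov, crossMoment_map hφ hm hm]

variable [IsProbabilityMeasure P]

theorem GaussianResidual.condMean_eq {X : Ω → Vec n} {C : Ω → γ} {M : γ → Vec n}
    {K : Matrix (Fin n) (Fin n) ℝ} (h : GaussianResidual P X C M K) (hXm : Measurable X)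
    (hX : SqIntegrable P X) (hC : Measurable C) : condMean P X C =ᵐ[P] fun ω => M (C ω) := by
  have hM := h.measurable
  have he := h.hasGaussianLaw.sqIntegrable
  have key : ∀ i, P[fun ω => X ω i | MeasurableSpace.comap C inferInstance] =ᵐ[P]
      fun ω => M (C ω) i := by
    intro i
    have hMi : Integrable (fun ω => M (C ω) i) P := by
      have := ((hX.sub he) i).integrable one_le_two
      simpa using this
    have e1 : (fun ω => X ω i) = (fun ω => (X ω - M (C ω)) i) + fun ω => M (C ω) i := by
      ext ω; simp
    have hme : Measurable fun ω => X ω - M (C ω) := by fun_prop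
    have hmi : Measurable fun ω => (X ω - M (C ω)) i := (measurable_pi_apply i).comp hme
    have h1 := condExp_indep_eq (m₁ := MeasurableSpace.comap (fun ω => (X ω - M (C ω)) i) inferInstance)
      (μ := P) hmi.comap_le hC.comap_le
      (comap_measurable _).stronglyMeasurable (h.indep.comp (measurable_pi_apply i) measurable_id)
    have h2 : P[fun ω => M (C ω) i | MeasurableSpace.comap C inferInstance] = fun ω => M (C ω) i :=
      condExp_of_stronglyMeasurable hC.comap_le
        (Measurable.stronglyMeasurable ((measurable_pi_apply i).comp (hM.comp (comap_measurable C))))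
        hMi
    rw [e1]
    refine (condExp_add ((he i).integrable one_le_two) hMi _).trans ?_
    filter_upwards [h1] with ω hω
    rw [Pi.add_apply, hω, h2, h.mean i, zero_add]
  filter_upwards [ae_all_iff.mpr key] with ω hω
  ext i
  exact hω i

theorem GaussianResidual.condCov_eq {X : Ω → Vec n} {C : Ω → γ} {M : γ → Vec n}
    {K : Matrix (Fin n) (Fin n) ℝ} (h : GaussianResidual P X C M K) (hXm : Measurable X)
    (hX : SqIntegrable P X) (hC : Measurable C) : condCov P X C = K := by
  have h1 : (fun ω => X ω - condMean P X C ω) =ᵐ[P] fun ω => X ω - M (C ω) := by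
    filter_upwards [h.condMean_eq hXm hX hC] with ω hω
    rw [hω]
  rw [condCov_eq_crossMoment, crossMoment_congr h1 h1, h.cov]

theorem indepFun_of_crossMoment_eq_zero {A : Ω → Vec n} {B : Ω → Vec m}
    (h : HasGaussianLaw (fun ω => (A ω, B ω)) P) (hA : ∀ i, ∫ ω, A ω i ∂P = 0)
    (h0 : crossMoment P A B = 0) : IndepFun A B P := by
  have := HasGaussianLaw.indepFun_of_covariance_eval (X := fun i ω => A ω i) (Y := fun i ω => B ω i)
    (P := P) h fun i j => by
      rw [covariance_eq_sub (h.fst.sqIntegrable i) (h.snd.sqIntegrable j), hA i, zero_mul, sub_zero]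
      exact congrFun (congrFun h0 i) j
  exact this

theorem crossMoment_eq_zero_of_indepFun {P : Measure Ω} {A : Ω → Vec n} {B : Ω → Vec m} (hA : Measurable A)
    (hB : Measurable B) (h : IndepFun A B P) (h0 : ∀ i, ∫ ω, A ω i ∂P = 0) :
    crossMoment P A B = 0 := by
  ext i j
  have hA' : Measurable fun ω => A ω i := (measurable_pi_apply i).comp hA
  have hB' : Measurable fun ω => B ω j := (measurable_pi_apply j).comp hB
  have := (h.comp (measurable_pi_apply i) (measurable_pi_apply j)).integral_fun_mul_eq_mul_integral
    hA'.aestronglyMeasurable hB'.aestronglyMeasurable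
  simp only [Function.comp_apply] at this
  simp only [crossMoment, of_apply, Matrix.zero_apply]
  rw [this, h0 i, zero_mul]

/-- Matrix-vector multiplication as a continuous linear map. -/
noncomputable def mulVecCLM (A : Matrix (Fin m) (Fin n) ℝ) : Vec n →L[ℝ] Vec m :=
  LinearMap.toContinuousLinearMap (Matrix.mulVecLin A)

@[simp]
theorem mulVecCLM_apply (A : Matrix (Fin m) (Fin n) ℝ) (x : Vec n) : mulVecCLM A x = A *ᵥ x := rfl

theorem integral_mulVec_eq_zero {P : Measure Ω} {Z : Ω → Vec n} (hZ : ∀ i, Integrable (fun ω => Z ω i) P)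
    (h0 : ∀ i, ∫ ω, Z ω i ∂P = 0) (A : Matrix (Fin m) (Fin n) ℝ) (i : Fin m) :
    ∫ ω, (A *ᵥ Z ω) i ∂P = 0 := by
  simp only [Matrix.mulVec, dotProduct]
  rw [integral_finsetSum _ fun j _ => (hZ j).const_mul _]
  simp [integral_const_mul, h0]

theorem _root_.LinearMap.exists_comp_eq_of_ker_le {E F G : Type*} [AddCommGroup E] [Module ℝ E]
    [AddCommGroup F] [Module ℝ F] [AddCommGroup G] [Module ℝ G] (f : E →ₗ[ℝ] F) (g : E →ₗ[ℝ] G)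
    (h : LinearMap.ker f ≤ LinearMap.ker g) : ∃ φ : F →ₗ[ℝ] G, φ ∘ₗ f = g := by
  obtain ⟨φ, hφ⟩ := LinearMap.exists_extend
    (((LinearMap.ker f).liftQ g h) ∘ₗ (f.quotKerEquivRange.symm : LinearMap.range f →ₗ[ℝ] _))
  refine ⟨φ, ?_⟩
  ext x
  have := LinearMap.congr_fun hφ ⟨f x, LinearMap.mem_range_self f x⟩
  simp only [LinearMap.comp_apply, Submodule.subtype_apply, LinearEquiv.coe_coe] at this
  rw [LinearMap.comp_apply, this]
  have e : f.quotKerEquivRange.symm ⟨f x, LinearMap.mem_range_self f x⟩ =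
      (LinearMap.ker f).mkQ x := by
    rw [LinearEquiv.symm_apply_eq]; rfl
  rw [e]; simp

/-- The normal equations are solvable even if the covariance of `C` is singular: a kernel vector `v`
satisfies `v ⬝ C = 0` almost surely, hence also `E[X (v ⬝ C)] = 0`, so a linear map factors through.
-/
theorem exists_mul_crossMoment_eq {P : Measure Ω} {X : Ω → Vec n} {C : Ω → Vec m} (hX : SqIntegrable P X)
    (hC : SqIntegrable P C) :
    ∃ L : Matrix (Fin n) (Fin m) ℝ, L * crossMoment P C C = crossMoment P X C := by
  obtain ⟨φ, hφ⟩ := LinearMap.exists_comp_eq_of_ker_le (Matrix.mulVecLin (crossMoment P C C))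
    (Matrix.mulVecLin (crossMoment P X C)) (by
      intro v hv
      simp only [LinearMap.mem_ker, Matrix.mulVecLin_apply] at hv ⊢
      have h0 : ∫ ω, (v ⬝ᵥ C ω) ^ 2 ∂P = 0 := by
        have := dotProduct_crossMoment_mulVec hC v
        rw [hv, dotProduct_zero] at this
        rw [this]
      have hL2 : MemLp (fun ω => v ⬝ᵥ C ω) 2 P := by
        simp only [dotProduct]
        exact memLp_finsetSum _ fun j _ => (hC j).const_mul _
      rw [integral_eq_zero_iff_of_nonneg (fun ω => sq_nonneg _) hL2.integrable_sq] at h0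
      ext i
      have e : (crossMoment P X C *ᵥ v) i = ∫ ω, X ω i * (v ⬝ᵥ C ω) ∂P := by
        simp only [Matrix.mulVec, dotProduct, crossMoment, of_apply, Finset.mul_sum]
        rw [integral_finsetSum]
        · refine Finset.sum_congr rfl fun j _ => ?_
          rw [← integral_mul_const]
          congr 1; ext ω; ring
        · intro j _
          have := (hX.integrable_mul hC i j).mul_const (v j)
          refine this.congr (.of_forall fun ω => ?_)
          simp only; ring
      rw [e]
      refine integral_eq_zero_of_ae ?_
      filter_upwards [h0] with ω hω
      have : v ⬝ᵥ C ω = 0 := by simpa using hω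
      simp [this])
  refine ⟨LinearMap.toMatrix' φ, ?_⟩
  apply_fun Matrix.toLin' using (Matrix.toLin' (R := ℝ)).injective
  rw [Matrix.toLin'_mul, Matrix.toLin'_toMatrix']
  exact hφ

/-- Linear regression for jointly Gaussian vectors. -/
theorem exists_gaussianResidual {X : Ω → Vec n} {C : Ω → Vec m} (hXm : Measurable X)
    (hCm : Measurable C) (h : HasGaussianLaw (fun ω => (X ω, C ω)) P)
    (hX0 : ∀ i, ∫ ω, X ω i ∂P = 0) (hC0 : ∀ i, ∫ ω, C ω i ∂P = 0) :
    ∃ L : Matrix (Fin n) (Fin m) ℝ,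
      GaussianResidual P X C (fun c => L *ᵥ c) (condCov P X C) := by
  have hX := h.fst.sqIntegrable
  have hC := h.snd.sqIntegrable
  obtain ⟨L, hL⟩ := exists_mul_crossMoment_eq hX hC
  have hpair : HasGaussianLaw (fun ω => (X ω - L *ᵥ C ω, C ω)) P :=
    h.map (((ContinuousLinearMap.fst ℝ (Vec n) (Vec m)) -
      (mulVecCLM L).comp (ContinuousLinearMap.snd ℝ _ _)).prod (ContinuousLinearMap.snd ℝ _ _))
  have hmean : ∀ i, ∫ ω, (X ω - L *ᵥ C ω) i ∂P = 0 := by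
    intro i
    simp only [Pi.sub_apply]
    rw [integral_sub ((hX i).integrable one_le_two) ((hC.mulVec L i).integrable one_le_two), hX0,
      integral_mulVec_eq_zero (fun j => (hC j).integrable one_le_two) hC0, sub_zero]
  -- The normal equations make the residual uncorrelated with `C`; under joint Gaussianity this is
  -- independence.
  have hind : IndepFun (fun ω => X ω - L *ᵥ C ω) C P := by
    refine indepFun_of_crossMoment_eq_zero hpair hmean ?_
    rw [crossMoment_sub_left hX (hC.mulVec L) hC, crossMoment_mulVec_left hC hC, hL, sub_self]
  have hr : GaussianResidual P X C (fun c => L *ᵥ c)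
      (crossMoment P (fun ω => X ω - L *ᵥ C ω) (fun ω => X ω - L *ᵥ C ω)) :=
    ⟨(mulVecCLM L).continuous.measurable, hpair.fst, hmean, rfl, hind⟩
  refine ⟨L, ?_⟩
  rwa [hr.condCov_eq hXm hX hCm]

end Residual

/-! ### Observations in independent standard Gaussian noise. -/

section Noise

open Matrix

variable {Ω γ δ : Type*} [MeasurableSpace Ω] [MeasurableSpace γ] [MeasurableSpace δ]
  {P : Measure Ω} {n m l : ℕ}

/-- The standard Gaussian measure on `Vec n`. -/
noncomputable def stdGauss (n : ℕ) : Measure (Vec n) := Measure.pi fun _ => gaussianReal 0 1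

instance (n : ℕ) : IsProbabilityMeasure (stdGauss n) := by
  unfold stdGauss; infer_instance

instance isGaussian_stdGauss (n : ℕ) : IsGaussian (stdGauss n) := by
  have h := iIndepFun.hasGaussianLaw (P := Measure.pi fun _ : Fin n => gaussianReal 0 1)
    (X := fun i ω => ω i) (fun i => by
      refine ⟨?_⟩
      rw [show (fun ω : Fin n → ℝ => ω i) = Function.eval i from rfl,
        (measurePreserving_eval (fun _ : Fin n => gaussianReal 0 1) i).map_eq]
      infer_instance)
    (iIndepFun_pi (X := fun _ x => x) fun i => aemeasurable_id)
  have := h.isGaussian_map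
  rwa [show (fun (ω : Fin n → ℝ) (x : Fin n) => ω x) = id from rfl, Measure.map_id] at this

theorem integral_stdGauss (i : Fin n) : ∫ x, x i ∂stdGauss n = 0 := by
  rw [stdGauss, integral_comp_eval (μ := fun _ : Fin n => gaussianReal 0 1) (f := fun x => x)
    (by fun_prop)]
  exact integral_id_gaussianReal

theorem crossMoment_stdGauss : crossMoment (stdGauss n) id id = 1 := by
  ext i j
  have hm : ∀ i, AEMeasurable (fun x : Vec n => x i) (stdGauss n) := fun i =>
    (measurable_pi_apply i).aemeasurable
  have hsq : ∀ i, MemLp (fun x : Vec n => x i) 2 (stdGauss n) :=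
    (IsGaussian.hasGaussianLaw_id (μ := stdGauss n)).sqIntegrable
  have hcov : cov[fun x : Vec n => x i, fun x => x j; stdGauss n] =
      crossMoment (stdGauss n) id id i j := by
    rw [covariance_eq_sub (hsq i) (hsq j), integral_stdGauss, zero_mul, sub_zero]
    rfl
  rw [← hcov]
  by_cases h : i = j
  · subst h
    rw [covariance_self (hm i), one_apply_eq]
    have e := variance_map (X := id) (Y := fun x : Vec n => x i) (μ := stdGauss n)
      aemeasurable_id (hm i)
    have hmap : (stdGauss n).map (fun x : Vec n => x i) = gaussianReal 0 1 :=
      (measurePreserving_eval (fun _ : Fin n => gaussianReal 0 1) i).map_eq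
    rw [hmap, variance_id_gaussianReal] at e
    simpa [Function.comp_def] using e.symm
  · rw [one_apply_ne h]
    have hind := iIndepFun_pi (μ := fun _ : Fin n => gaussianReal 0 1) (X := fun _ x => x)
      fun i => aemeasurable_id
    exact (hind.indepFun h).covariance_eq_zero (hsq i) (hsq j)

/-- `N` is standard Gaussian and independent of `C`. -/
structure IsStdNoise (P : Measure Ω) (N : Ω → Vec l) (C : Ω → γ) : Prop where
  measurable : Measurable N
  law : P.map N = stdGauss l
  indep : IndepFun N C P

theorem IsStdNoise.comp {N : Ω → Vec l} {C : Ω → γ} (h : IsStdNoise P N C) {f : γ → δ}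
    (hf : Measurable f) : IsStdNoise P N (fun ω => f (C ω)) :=
  ⟨h.measurable, h.law, h.indep.comp measurable_id hf⟩

theorem IsStdNoise.hasGaussianLaw {N : Ω → Vec l} {C : Ω → γ} (h : IsStdNoise P N C) :
    HasGaussianLaw N P := ⟨by rw [h.law]; infer_instance⟩

theorem IsStdNoise.mean {N : Ω → Vec l} {C : Ω → γ} (h : IsStdNoise P N C) (i : Fin l) :
    ∫ ω, N ω i ∂P = 0 := by
  rw [← integral_stdGauss i, ← h.law, integral_map h.measurable.aemeasurable
    (measurable_pi_apply i).aestronglyMeasurable]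

theorem IsStdNoise.crossMoment_eq {N : Ω → Vec l} {C : Ω → γ} (h : IsStdNoise P N C) :
    crossMoment P N N = 1 := by
  rw [← crossMoment_stdGauss, ← h.law, crossMoment_map h.measurable measurable_id measurable_id]
  rfl

variable [IsProbabilityMeasure P]

/-- The noise is independent of `(X, C)` and the residual is independent of `C`, so residual, noise
and `C` are mutually independent. `C` itself need not be Gaussian. -/
theorem GaussianResidual.indepFun_prod_noise {X : Ω → Vec n} {C : Ω → γ} {M : γ → Vec n}
    {K : Matrix (Fin n) (Fin n) ℝ} (h : GaussianResidual P X C M K) (hX : Measurable X)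
    (hC : Measurable C) {N : Ω → Vec l} (hN : IsStdNoise P N (fun ω => (X ω, C ω))) :
    HasGaussianLaw (fun ω => (X ω - M (C ω), N ω)) P ∧
      crossMoment P (fun ω => X ω - M (C ω)) N = 0 ∧
      IndepFun (fun ω => (X ω - M (C ω), N ω)) C P := by
  have hM := h.measurable
  have hNm := hN.measurable
  have h1 : IndepFun N (fun ω => (C ω, X ω - M (C ω))) P :=
    hN.indep.comp (φ := id) (ψ := fun z : Vec n × γ => (z.2, z.1 - M z.2)) measurable_id
      (by fun_prop)
  have h2 : IndepFun (fun ω => X ω - M (C ω)) N P := (h1.comp measurable_id measurable_snd).symm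
  refine ⟨h2.hasGaussianLaw h.hasGaussianLaw hN.hasGaussianLaw,
    crossMoment_eq_zero_of_indepFun (by fun_prop) hNm h2 h.mean, ?_⟩
  exact (indepFun_prod_right_of_prod_left hC (by fun_prop) hNm h.indep.symm h1.symm).symm

/-- The observation `HX + N` given `C`. -/
theorem GaussianResidual.observation {X : Ω → Vec n} {C : Ω → γ} {M : γ → Vec n}
    {K : Matrix (Fin n) (Fin n) ℝ} (h : GaussianResidual P X C M K) (hX : Measurable X)
    (hC : Measurable C) {N : Ω → Vec l} (hN : IsStdNoise P N (fun ω => (X ω, C ω)))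
    (H : Matrix (Fin l) (Fin n) ℝ) :
    GaussianResidual P (fun ω => H *ᵥ X ω + N ω) C (fun c => H *ᵥ M c) (1 + H * K * Hᵀ) := by
  obtain ⟨hG, h0, hind⟩ := h.indepFun_prod_noise hX hC hN
  have he := h.hasGaussianLaw.sqIntegrable
  have hNs := hN.hasGaussianLaw.sqIntegrable
  have e : (fun ω => H *ᵥ X ω + N ω - H *ᵥ M (C ω)) =
      fun ω => H *ᵥ (X ω - M (C ω)) + N ω := by
    ext1 ω; rw [mulVec_sub]; abel
  let L : (Vec n × Vec l) →L[ℝ] Vec l :=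
    (mulVecCLM H).comp (ContinuousLinearMap.fst ℝ _ _) + ContinuousLinearMap.snd ℝ _ _
  have h0' : crossMoment P N (fun ω => X ω - M (C ω)) = 0 := by
    rw [← crossMoment_transpose, h0, transpose_zero]
  refine ⟨(mulVecCLM H).continuous.measurable.comp h.measurable, ?_, fun i => ?_, ?_, ?_⟩
  · rw [e]
    exact hG.map L
  · have e' := congrFun e
    simp only [e', Pi.add_apply]
    rw [integral_add (((he.mulVec H) i).integrable one_le_two) ((hNs i).integrable one_le_two),
      hN.mean i, integral_mulVec_eq_zero (fun j => (he j).integrable one_le_two) h.mean, add_zero]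
  · rw [e, crossMoment_add_left (he.mulVec H) hNs ((he.mulVec H).add hNs),
      crossMoment_add_right (he.mulVec H) (he.mulVec H) hNs,
      crossMoment_add_right hNs (he.mulVec H) hNs, crossMoment_mulVec_left he (he.mulVec H),
      crossMoment_mulVec_right he he, crossMoment_mulVec_left he hNs, h0,
      crossMoment_mulVec_right hNs he, h0', h.cov, hN.crossMoment_eq]
    simp [Matrix.mul_assoc, add_comm]
  · rw [e]
    exact hind.comp L.continuous.measurable measurable_id

/-- Conditioning additionally on the observation `HX + N`. -/
theorem GaussianResidual.observe {X : Ω → Vec n} {C : Ω → γ} {M : γ → Vec n}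
    {K : Matrix (Fin n) (Fin n) ℝ} (h : GaussianResidual P X C M K) (hX : Measurable X)
    (hC : Measurable C) {N : Ω → Vec l} (hN : IsStdNoise P N (fun ω => (X ω, C ω)))
    (H : Matrix (Fin l) (Fin n) ℝ) :
    ∃ M' : Vec l × γ → Vec n,
      GaussianResidual P X (fun ω => (H *ᵥ X ω + N ω, C ω)) M' (posteriorCov K H) := by
  obtain ⟨hG, h0, hind⟩ := h.indepFun_prod_noise hX hC hN
  have hM := h.measurable
  have hNm := hN.measurable
  have he := h.hasGaussianLaw.sqIntegrable
  have hNs := hN.hasGaussianLaw.sqIntegrable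
  have hV := h.observation hX hC hN H
  have hK : K.PosSemidef := by rw [← h.cov]; exact posSemidef_crossMoment he
  set S := 1 + H * K * Hᵀ with hS
  have hSpd : S.PosDef := posDef_one_add_mul_mul_transpose hK H
  set G := K * Hᵀ * S⁻¹ with hGdef
  have hH : Measurable fun x : Vec n => H *ᵥ x := (mulVecCLM H).continuous.measurable
  have hGm : Measurable fun x : Vec l => G *ᵥ x := (mulVecCLM G).continuous.measurable
  set e : Ω → Vec n := fun ω => X ω - M (C ω) with he_def
  -- Innovation form: the new estimate is `M(C) + Gν`. The gain makes its error `e - Gν`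
  -- uncorrelated with `ν`, hence independent of `(ν, C)`.
  set ν : Ω → Vec l := fun ω => H *ᵥ X ω + N ω - H *ᵥ M (C ω) with hν_def
  have hν : ν = fun ω => H *ᵥ e ω + N ω := by
    ext1 ω; simp only [hν_def, he_def, mulVec_sub]; abel
  have hνs : SqIntegrable P ν := by rw [hν]; exact (he.mulVec H).add hNs
  have hem : Measurable e := by fun_prop
  have hνm : Measurable ν := by
    rw [hν]
    exact (hH.comp hem).add hNm
  let L₁ : (Vec n × Vec l) →L[ℝ] Vec l :=
    (mulVecCLM H).comp (ContinuousLinearMap.fst ℝ _ _) + ContinuousLinearMap.snd ℝ _ _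
  let L : (Vec n × Vec l) →L[ℝ] (Vec n × Vec l) :=
    (ContinuousLinearMap.fst ℝ _ _ - (mulVecCLM G).comp L₁).prod L₁
  have hL : (fun ω => (e ω - G *ᵥ ν ω, ν ω)) = L ∘ fun ω => (e ω, N ω) := by
    rw [hν]; rfl
  have hpair : HasGaussianLaw (fun ω => (e ω - G *ᵥ ν ω, ν ω)) P := by
    rw [hL]; exact hG.map L
  have hpairC : IndepFun (fun ω => (e ω - G *ᵥ ν ω, ν ω)) C P := by
    rw [hL]; exact hind.comp L.continuous.measurable measurable_id
  have heν : crossMoment P e ν = K * Hᵀ := by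
    rw [hν, crossMoment_add_right he (he.mulVec H) hNs, crossMoment_mulVec_right he he, h0, h.cov,
      add_zero]
  have hνν : crossMoment P ν ν = S := hV.cov
  have horth : crossMoment P (fun ω => e ω - G *ᵥ ν ω) ν = 0 := by
    rw [crossMoment_sub_left he (hνs.mulVec G) hνs, crossMoment_mulVec_left hνs hνs, heν, hνν,
      hGdef, Matrix.mul_assoc, nonsing_inv_mul _ ((isUnit_iff_isUnit_det _).mp hSpd.isUnit),
      Matrix.mul_one, sub_self]
  have hmean : ∀ i, ∫ ω, (e ω - G *ᵥ ν ω) i ∂P = 0 := by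
    intro i
    simp only [Pi.sub_apply]
    rw [integral_sub ((he i).integrable one_le_two) ((hνs.mulVec G i).integrable one_le_two),
      h.mean i, integral_mulVec_eq_zero (fun j => (hνs j).integrable one_le_two) hV.mean, sub_zero]
  have hi1 : IndepFun (fun ω => e ω - G *ᵥ ν ω) ν P :=
    indepFun_of_crossMoment_eq_zero hpair hmean horth
  have hi2 : IndepFun (fun ω => e ω - G *ᵥ ν ω) (fun ω => (ν ω, C ω)) P :=
    indepFun_prod_right_of_prod_left (hem.sub (hGm.comp hνm)) hνm hC hi1 hpairC
  have hM' : Measurable fun z : Vec l × γ => M z.2 + G *ᵥ (z.1 - H *ᵥ M z.2) :=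
    (hM.comp measurable_snd).add
      (hGm.comp (measurable_fst.sub (hH.comp (hM.comp measurable_snd))))
  have hres : (fun ω => X ω - (M (C ω) + G *ᵥ (H *ᵥ X ω + N ω - H *ᵥ M (C ω)))) =
      fun ω => e ω - G *ᵥ ν ω := by
    ext1 ω; simp only [he_def, hν_def]; abel
  refine ⟨fun z => M z.2 + G *ᵥ (z.1 - H *ᵥ M z.2), hM', ?_, ?_, ?_, ?_⟩
  · simp only [hres]; exact hpair.fst
  · have hres' := congrFun hres
    simp only [hres']; exact hmean
  · simp only [hres]
    rw [crossMoment_sub_right hpair.fst.sqIntegrable he (hνs.mulVec G),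
      crossMoment_mulVec_right hpair.fst.sqIntegrable hνs, horth,
      crossMoment_sub_left he (hνs.mulVec G) he, crossMoment_mulVec_left hνs he, h.cov,
      ← crossMoment_transpose e ν, heν, transpose_mul, transpose_transpose]
    have hKt : Kᵀ = K := by simpa using hK.isHermitian.eq
    rw [hKt, posteriorCov]
    simp [hGdef, Matrix.mul_assoc, hS]
  · simp only [hres]
    -- The new observation is `ν + H M(C)`, so it is a function of `(ν, C)`.
    have := hi2.comp (φ := id) (ψ := fun z : Vec l × γ => (z.1 + H *ᵥ M z.2, z.2)) measurable_id
      ((measurable_fst.add (hH.comp (hM.comp measurable_snd))).prodMk measurable_snd)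
    simpa [Function.comp_def, hν_def] using this

end Noise

/-! ### Gaussian kernels as conditional laws, and mean log-densities. -/

section GaussKernel

open Matrix

variable {Ω γ δ : Type*} [MeasurableSpace Ω] [MeasurableSpace γ] [MeasurableSpace δ]
  {P : Measure Ω} {n m l : ℕ}

theorem exists_hasGaussianLaw_crossMoment_eq {K : Matrix (Fin n) (Fin n) ℝ} (hK : K.PosSemidef) :
    ∃ Z : Vec n → Vec n, HasGaussianLaw Z (stdGauss n) ∧ (∀ i, ∫ ω, Z ω i ∂stdGauss n = 0) ∧
      crossMoment (stdGauss n) Z Z = K := by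
  obtain ⟨H, hH⟩ := exists_transpose_mul_self_eq hK
  have hid : HasGaussianLaw id (stdGauss n) := IsGaussian.hasGaussianLaw_id
  have hs := hid.sqIntegrable
  refine ⟨fun x => Hᵀ *ᵥ id x, hid.map (mulVecCLM Hᵀ), fun i => ?_, ?_⟩
  · exact integral_mulVec_eq_zero (fun j => (hs j).integrable one_le_two) integral_stdGauss _ i
  · rw [crossMoment_mulVec_left hs (hs.mulVec _), crossMoment_mulVec_right hs hs,
      crossMoment_stdGauss, Matrix.one_mul, transpose_transpose, hH]

theorem lintegral_gaussDensity {K : Matrix (Fin n) (Fin n) ℝ} (hK : K.PosDef) (a : Vec n) :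
    ∫⁻ x, ENNReal.ofReal (gaussDensity K (x - a)) = 1 := by
  obtain ⟨Z, hZ, h0, hc⟩ := exists_hasGaussianLaw_crossMoment_eq hK.posSemidef
  have h := map_eq_withDensity_gaussDensity hZ h0 hK hc
  have hp : IsProbabilityMeasure ((stdGauss n).map Z) :=
    Measure.isProbabilityMeasure_map hZ.aemeasurable
  have h1 := hp.measure_univ
  rw [h, withDensity_apply _ MeasurableSet.univ, Measure.restrict_univ] at h1
  rw [lintegral_sub_right_eq_self (fun x => ENNReal.ofReal (gaussDensity K x)) a, h1]

/-- The kernel `c ↦ N(M c, K)`. -/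
noncomputable def gaussKernel (M : γ → Vec n) (K : Matrix (Fin n) (Fin n) ℝ) : Kernel γ (Vec n) :=
  (Kernel.const γ volume).withDensity fun c x => ENNReal.ofReal (gaussDensity K (x - M c))

theorem measurable_gaussDensity_sub {M : γ → Vec n} (hM : Measurable M)
    (K : Matrix (Fin n) (Fin n) ℝ) :
    Measurable fun z : γ × Vec n => ENNReal.ofReal (gaussDensity K (z.2 - M z.1)) :=
  ((continuous_gaussDensity K).measurable.comp
    (measurable_snd.sub (hM.comp measurable_fst))).ennreal_ofReal

theorem lintegral_gaussKernel {M : γ → Vec n} (hM : Measurable M) (K : Matrix (Fin n) (Fin n) ℝ)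
    (c : γ) {F : Vec n → ℝ≥0∞} (hF : Measurable F) :
    ∫⁻ x, F x ∂gaussKernel M K c = ∫⁻ x, ENNReal.ofReal (gaussDensity K (x - M c)) * F x := by
  rw [gaussKernel, Kernel.lintegral_withDensity _ (measurable_gaussDensity_sub hM K) _ hF]
  rfl

theorem isMarkovKernel_gaussKernel {M : γ → Vec n} (hM : Measurable M)
    {K : Matrix (Fin n) (Fin n) ℝ} (hK : K.PosDef) : IsMarkovKernel (gaussKernel M K) := by
  refine ⟨fun c => ⟨?_⟩⟩
  rw [← lintegral_one, lintegral_gaussKernel hM K c measurable_const]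
  simpa using lintegral_gaussDensity hK (M c)

variable [IsProbabilityMeasure P]

theorem GaussianResidual.map_eq_compProd {X : Ω → Vec n} {C : Ω → γ} {M : γ → Vec n}
    {K : Matrix (Fin n) (Fin n) ℝ} (h : GaussianResidual P X C M K) (hK : K.PosDef)
    (hX : Measurable X) (hC : Measurable C) :
    P.map (fun ω => (C ω, X ω)) = P.map C ⊗ₘ gaussKernel M K := by
  have hM := h.measurable
  have := isMarkovKernel_gaussKernel hM hK
  have := Measure.isProbabilityMeasure_map (μ := P) hC.aemeasurable
  have hlaw := map_eq_withDensity_gaussDensity h.hasGaussianLaw h.mean hK h.cov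
  have hind := (indepFun_iff_map_prod_eq_prod_map_map (by fun_prop) (by fun_prop)).mp h.indep.symm
  have e : (P.map fun ω => (C ω, X ω)) =
      (P.map fun ω => (C ω, X ω - M (C ω))).map (fun z => (z.1, M z.1 + z.2)) := by
    rw [Measure.map_map (by fun_prop) (by fun_prop)]
    congr 1
    ext1 ω
    simp
  have hg : Measurable fun x : Vec n => ENNReal.ofReal (gaussDensity K x) :=
    (continuous_gaussDensity K).measurable.ennreal_ofReal
  have : SFinite (volume.withDensity fun x : Vec n => ENNReal.ofReal (gaussDensity K x)) := by
    infer_instance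
  rw [e, hind, hlaw]
  refine Measure.ext_of_lintegral _ fun F hF => ?_
  rw [lintegral_map hF (by fun_prop), lintegral_prod _ (by fun_prop), Measure.lintegral_compProd hF]
  refine lintegral_congr fun c => ?_
  rw [lintegral_gaussKernel hM K c (by fun_prop),
    lintegral_withDensity_eq_lintegral_mul _ hg (by fun_prop)]
  rw [← lintegral_add_left_eq_self (μ := volume)
    (fun x => ENNReal.ofReal (gaussDensity K (x - M c)) * F (c, x)) (M c)]
  simp

theorem GaussianResidual.condDistrib_eq {X : Ω → Vec n} {C : Ω → γ} {M : γ → Vec n}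
    {K : Matrix (Fin n) (Fin n) ℝ} (h : GaussianResidual P X C M K) (hK : K.PosDef)
    (hX : Measurable X) (hC : Measurable C) :
    condDistrib X C P =ᵐ[P.map C] gaussKernel M K := by
  have := isMarkovKernel_gaussKernel h.measurable hK
  exact condDistrib_ae_eq_of_measure_eq_compProd _ hX.aemeasurable (h.map_eq_compProd hK hX hC)

theorem integrable_log_gaussDensity {Z : Ω → Vec n} (hZ : SqIntegrable P Z)
    {K : Matrix (Fin n) (Fin n) ℝ} (hK : K.PosDef) :
    Integrable (fun ω => Real.log (gaussDensity K (Z ω))) P := by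
  simp only [log_gaussDensity hK]
  exact (integrable_const _).sub ((hZ.integrable_dotProduct_mulVec _).div_const 2)

/-- Only the covariance of `Z` enters. `Z` need not be Gaussian, so the formula applies to the
estimation errors of arbitrary auxiliaries. -/
theorem integral_log_gaussDensity {Z : Ω → Vec n} (hZ : SqIntegrable P Z)
    {K : Matrix (Fin n) (Fin n) ℝ} (hK : K.PosDef) (hc : crossMoment P Z Z = K) :
    ∫ ω, Real.log (gaussDensity K (Z ω)) ∂P =
      n * Real.log (√(2 * Real.pi))⁻¹ - Real.log K.det / 2 - n / 2 := by
  simp only [log_gaussDensity hK]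
  rw [integral_sub (integrable_const _) ((hZ.integrable_dotProduct_mulVec _).div_const 2),
    integral_const, integral_div, integral_inv_dotProduct_mulVec hZ hK hc]
  simp

end GaussKernel

/-! ### Data processing, and the information carried by a Gaussian observation. -/

section UpperBound

open Matrix InformationTheory

variable {Ω γ δ : Type*} [MeasurableSpace Ω] [MeasurableSpace γ] [MeasurableSpace δ]
  {P : Measure Ω} {n m l : ℕ}

theorem klDiv_eq_ofReal_of_withDensity_exp {α : Type*} [MeasurableSpace α] {p r : Measure α}
    [IsProbabilityMeasure p] [IsProbabilityMeasure r] {φ : α → ℝ} (hφ : Measurable φ)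
    (hint : Integrable φ p) (h : p = r.withDensity fun x => ENNReal.ofReal (Real.exp (φ x))) :
    klDiv p r = ENNReal.ofReal (∫ x, φ x ∂p) := by
  have hac : p ≪ r := by rw [h]; exact withDensity_absolutelyContinuous _ _
  have hd : p.rnDeriv r =ᵐ[r] fun x => ENNReal.ofReal (Real.exp (φ x)) := by
    conv_lhs => rw [h]
    exact Measure.rnDeriv_withDensity r (by fun_prop)
  have hl : llr p r =ᵐ[p] φ := by
    filter_upwards [hac.ae_eq hd] with x hx
    rw [llr, hx, ENNReal.toReal_ofReal (Real.exp_pos _).le, Real.log_exp]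
  have hne : klDiv p r ≠ ∞ := klDiv_ne_top_iff.mpr ⟨hac, hint.congr hl.symm⟩
  rw [← ENNReal.ofReal_toReal hne, toReal_klDiv_of_measure_eq hac (by simp), integral_congr_ae hl]

/-- Both laws in the divergence are pushed forward by the same map `id × f`. It is needed for
pairing `W` with an empty vector. -/
theorem condMutualInfo_comp_le {α β β' : Type*} [MeasurableSpace α] [MeasurableSpace β]
    [MeasurableSpace β'] [StandardBorelSpace α] [Nonempty α] [StandardBorelSpace β] [Nonempty β]
    [StandardBorelSpace β'] [Nonempty β'] [IsProbabilityMeasure P] {A : Ω → α} {B : Ω → β}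
    {C : Ω → γ} (hA : Measurable A) (hB : Measurable B) (hC : Measurable C) {f : β → β'}
    (hf : Measurable f) :
    condMutualInfo P A (fun ω => f (B ω)) C ≤ condMutualInfo P A B C := by
  have := Measure.isProbabilityMeasure_map (μ := P) hC.aemeasurable
  have := Measure.isProbabilityMeasure_map (μ := P) (f := fun ω => (C ω, A ω)) (by fun_prop)
  have := Measure.isProbabilityMeasure_map (μ := P) (f := fun ω => ((C ω, A ω), B ω)) (by fun_prop)
  rw [condMutualInfo_eq_klDiv_compProd P hA (B := fun ω => f (B ω)) (by fun_prop) hC,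
    condMutualInfo_eq_klDiv_compProd P hA hB hC]
  have e1 : (P.map fun ω => ((C ω, A ω), f (B ω))) =
      (P.map fun ω => ((C ω, A ω), B ω)).map (Prod.map id f) := by
    rw [Measure.map_map (by fun_prop) (by fun_prop)]; rfl
  have e2 : (P.map fun ω => (C ω, A ω)) ⊗ₘ
      (condDistrib (fun ω => f (B ω)) C P).prodMkRight α =
      ((P.map fun ω => (C ω, A ω)) ⊗ₘ (condDistrib B C P).prodMkRight α).map (Prod.map id f) := by
    have h : condDistrib (f ∘ B) C P =ᵐ[P.map C] (condDistrib B C P).map f :=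
      condDistrib_comp C hB.aemeasurable hf
    have h2 : (P.map fun ω => (C ω, A ω)) ⊗ₘ
        (condDistrib (fun ω => f (B ω)) C P).prodMkRight α =
        (P.map fun ω => (C ω, A ω)) ⊗ₘ (((condDistrib B C P).map f).prodMkRight α) := by
      refine Measure.compProd_congr ?_
      have h3 : ∀ᵐ z ∂P.map fun ω => (C ω, A ω),
          condDistrib (f ∘ B) C P z.1 = (condDistrib B C P).map f z.1 := by
        have : P.map C = (P.map fun ω => (C ω, A ω)).map Prod.fst := by
          rw [Measure.map_map (by fun_prop) (by fun_prop)]; rfl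
        rw [this] at h
        exact ae_of_ae_map (by fun_prop) h
      filter_upwards [h3] with z hz
      exact hz
    rw [h2]
    refine Measure.ext_of_lintegral _ fun F hF => ?_
    rw [lintegral_map hF (by fun_prop), Measure.lintegral_compProd hF,
      Measure.lintegral_compProd (by fun_prop)]
    refine lintegral_congr fun z => ?_
    rw [Kernel.prodMkRight_apply, Kernel.lintegral_map _ hf _ (by fun_prop)]
    rfl
  rw [e1, e2]
  exact klDiv_map_le _ _ (by fun_prop)

/-- The information in the observation `HX + N` of a conditionally Gaussian vector. -/
theorem GaussianResidual.condMutualInfo_observation [IsProbabilityMeasure P] {X : Ω → Vec n}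
    {C : Ω → γ} {M : γ → Vec n} {K : Matrix (Fin n) (Fin n) ℝ} (h : GaussianResidual P X C M K)
    (hX : Measurable X) (hC : Measurable C) {N : Ω → Vec l}
    (hN : IsStdNoise P N (fun ω => (X ω, C ω))) (H : Matrix (Fin l) (Fin n) ℝ) :
    condMutualInfo P X (fun ω => H *ᵥ X ω + N ω) C =
      ENNReal.ofReal (Real.log (1 + H * K * Hᵀ).det / 2) := by
  have hM := h.measurable
  have hNm := hN.measurable
  have hNs := hN.hasGaussianLaw.sqIntegrable
  have hK : K.PosSemidef := by
    rw [← h.cov]; exact posSemidef_crossMoment h.hasGaussianLaw.sqIntegrable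
  have hS : (1 + H * K * Hᵀ).PosDef := posDef_one_add_mul_mul_transpose hK H
  set S := 1 + H * K * Hᵀ
  have hH : Measurable fun x : Vec n => H *ᵥ x := (mulVecCLM H).continuous.measurable
  set V : Ω → Vec l := fun ω => H *ᵥ X ω + N ω with hVdef
  have hV : Measurable V := (hH.comp hX).add hNm
  have hVN : (fun ω => V ω - H *ᵥ X ω) = N := by ext1 ω; simp [hVdef]
  have hr1 : GaussianResidual P V (fun ω => (C ω, X ω)) (fun z => H *ᵥ z.2) 1 := by
    have hVN' := congrFun hVN
    refine ⟨hH.comp measurable_snd, ?_, ?_, ?_, ?_⟩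
    · simp only [hVN]; exact hN.hasGaussianLaw
    · simp only [hVN']; exact hN.mean
    · simp only [hVN]; exact hN.crossMoment_eq
    · simp only [hVN]
      exact hN.indep.comp (φ := id) (ψ := Prod.swap) measurable_id measurable_swap
  have hr2 : GaussianResidual P V C (fun c => H *ᵥ M c) S := h.observation hX hC hN H
  have hHM : Measurable fun c => H *ᵥ M c := hH.comp hM
  have hp1 := Measure.isProbabilityMeasure_map (μ := P) (f := fun ω => (C ω, X ω)) (by fun_prop)
  have hp2 := Measure.isProbabilityMeasure_map (μ := P) (f := fun ω => ((C ω, X ω), V ω))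
    (by fun_prop)
  have hH2 : Measurable fun z : γ × Vec n => H *ᵥ z.2 := hH.comp measurable_snd
  have hk1 := isMarkovKernel_gaussKernel hH2
    (PosDef.one : (1 : Matrix (Fin l) (Fin l) ℝ).PosDef)
  have hk2 := isMarkovKernel_gaussKernel hHM hS
  rw [condMutualInfo_eq_klDiv_compProd P hX hV hC]
  -- Given `(C, X)` the observation is `N(HX, 1)` and given `C` it is `N(H M(C), S)`. In the mean of
  -- this log ratio the two quadratic terms cancel, leaving `½ log det S`.
  set φ : (γ × Vec n) × Vec l → ℝ := fun z =>
    Real.log (gaussDensity 1 (z.2 - H *ᵥ z.1.2)) - Real.log (gaussDensity S (z.2 - H *ᵥ M z.1.1))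
    with hφdef
  have hφ : Measurable φ := by
    refine Measurable.sub ?_ ?_
    · exact ((continuous_gaussDensity 1).measurable.comp (measurable_snd.sub
        (hH.comp (measurable_snd.comp measurable_fst)))).log
    · exact ((continuous_gaussDensity S).measurable.comp (measurable_snd.sub
        (hHM.comp (measurable_fst.comp measurable_fst)))).log
  have hi1 : Integrable (fun ω => Real.log (gaussDensity 1 (V ω - H *ᵥ X ω))) P := by
    have := integrable_log_gaussDensity hNs PosDef.one
    rwa [← hVN] at this
  have hi2 : Integrable (fun ω => Real.log (gaussDensity S (V ω - H *ᵥ M (C ω)))) P :=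
    integrable_log_gaussDensity hr2.hasGaussianLaw.sqIntegrable hS
  have hφi : Integrable φ (P.map fun ω => ((C ω, X ω), V ω)) := by
    rw [integrable_map_measure hφ.aestronglyMeasurable (by fun_prop)]
    exact hi1.sub hi2
  rw [klDiv_eq_ofReal_of_withDensity_exp hφ hφi]
  · rw [integral_map (by fun_prop) hφ.aestronglyMeasurable]
    simp only [hφdef]
    rw [integral_sub hi1 hi2, integral_log_gaussDensity hr2.hasGaussianLaw.sqIntegrable hS hr2.cov,
      integral_log_gaussDensity hr1.hasGaussianLaw.sqIntegrable PosDef.one hr1.cov]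
    simp
  · rw [hr1.map_eq_compProd PosDef.one hV (by fun_prop)]
    have hae : ((condDistrib V C P).prodMkRight (Vec n)) =ᵐ[P.map fun ω => (C ω, X ω)]
        (gaussKernel (fun c => H *ᵥ M c) S).prodMkRight (Vec n) := by
      have h := hr2.condDistrib_eq hS hV hC
      have e : P.map C = (P.map fun ω => (C ω, X ω)).map Prod.fst := by
        rw [Measure.map_map (by fun_prop) (by fun_prop)]; rfl
      rw [e] at h
      filter_upwards [ae_of_ae_map (by fun_prop) h] with z hz
      simpa using hz
    rw [Measure.compProd_congr hae]
    refine Measure.ext_of_lintegral _ fun F hF => ?_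
    have hexp : Measurable fun z => ENNReal.ofReal (Real.exp (φ z)) := by fun_prop
    rw [lintegral_withDensity_eq_lintegral_mul _ hexp hF, Measure.lintegral_compProd hF,
      Measure.lintegral_compProd (hexp.mul hF)]
    refine lintegral_congr fun z => ?_
    have hEF : Measurable fun v => ((fun z => ENNReal.ofReal (Real.exp (φ z))) * F) (z, v) :=
      (hexp.mul hF).comp measurable_prodMk_left
    rw [Kernel.prodMkRight_apply,
      lintegral_gaussKernel hH2 _ _ (by fun_prop),
      lintegral_gaussKernel hHM _ _ hEF]
    refine lintegral_congr fun v => ?_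
    rw [Pi.mul_apply, ← mul_assoc, ← ENNReal.ofReal_mul (gaussDensity_pos hS _).le]
    congr 2
    have h1 := gaussDensity_pos (PosDef.one : (1 : Matrix (Fin l) (Fin l) ℝ).PosDef) (v - H *ᵥ z.2)
    have h2 := gaussDensity_pos hS (v - H *ᵥ M z.1)
    simp only [hφdef]
    rw [Real.exp_sub, Real.exp_log h1, Real.exp_log h2]
    field_simp

end UpperBound

/-! ### Concatenation, so that `(Y₁, Y₂)` becomes a single real vector. -/

section Append

variable {n m : ℕ}

/-- Concatenation of vectors. -/
noncomputable def appendCLM (n m : ℕ) : (Vec n × Vec m) →L[ℝ] Vec (n + m) :=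
  LinearMap.toContinuousLinearMap
    { toFun := fun z => Fin.append z.1 z.2
      map_add' := fun a b => by
        ext i
        refine Fin.addCases (fun j => ?_) (fun j => ?_) i <;> simp
      map_smul' := fun c a => by
        ext i
        refine Fin.addCases (fun j => ?_) (fun j => ?_) i <;> simp }

/-- The first `n` coordinates. -/
noncomputable def headCLM (n m : ℕ) : Vec (n + m) →L[ℝ] Vec n :=
  ContinuousLinearMap.pi fun i => ContinuousLinearMap.proj (Fin.castAdd m i)

/-- The last `m` coordinates. -/
noncomputable def tailCLM (n m : ℕ) : Vec (n + m) →L[ℝ] Vec m :=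
  ContinuousLinearMap.pi fun i => ContinuousLinearMap.proj (Fin.natAdd n i)

theorem appendCLM_apply (z : Vec n × Vec m) : appendCLM n m z = Fin.append z.1 z.2 := rfl

@[simp]
theorem headCLM_appendCLM (z : Vec n × Vec m) : headCLM n m (appendCLM n m z) = z.1 := by
  ext i; simp [headCLM, appendCLM_apply]

@[simp]
theorem tailCLM_appendCLM (z : Vec n × Vec m) : tailCLM n m (appendCLM n m z) = z.2 := by
  ext i; simp [tailCLM, appendCLM_apply]

end Append

/-! ### Fusing an arbitrary estimate with Gaussian side information. -/

section Fusion

open Matrix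

variable {Ω γ δ : Type*} [MeasurableSpace Ω] [MeasurableSpace γ] [MeasurableSpace δ]
  {P : Measure Ω} {n m k₁ : ℕ}

theorem _root_.ProbabilityTheory.HasGaussianLaw.congr_ae {E : Type*} [NormedAddCommGroup E]
    [NormedSpace ℝ E] [MeasurableSpace E] [BorelSpace E] {A B : Ω → E} (h : HasGaussianLaw A P)
    (hAB : A =ᵐ[P] B) : HasGaussianLaw B P := by
  refine ⟨?_⟩
  rw [← Measure.map_congr hAB]
  exact h.isGaussian_map

theorem indepFun_prod_of_crossMoment_eq_zero [IsProbabilityMeasure P] {l : ℕ} {A : Ω → Vec n}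
    {B : Ω → Vec m} {C : Ω → Vec l} (h : HasGaussianLaw (fun ω => (A ω, B ω, C ω)) P)
    (hA : ∀ i, ∫ ω, A ω i ∂P = 0) (hB : crossMoment P A B = 0) (hC : crossMoment P A C = 0) :
    IndepFun A (fun ω => (B ω, C ω)) P := by
  have h1 : HasGaussianLaw (fun ω => (A ω, appendCLM m l (B ω, C ω))) P :=
    h.map ((ContinuousLinearMap.fst ℝ (Vec n) (Vec m × Vec l)).prod
      ((appendCLM m l).comp (ContinuousLinearMap.snd ℝ (Vec n) (Vec m × Vec l))))
  have h2 : IndepFun A (fun ω => appendCLM m l (B ω, C ω)) P := by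
    refine indepFun_of_crossMoment_eq_zero h1 hA ?_
    ext i j
    refine Fin.addCases (fun j => ?_) (fun j => ?_) j
    · simpa [crossMoment, appendCLM_apply] using congrFun (congrFun hB i) j
    · simpa [crossMoment, appendCLM_apply] using congrFun (congrFun hC i) j
  have h3 := h2.comp (φ := id) (ψ := fun z => (headCLM m l z, tailCLM m l z)) measurable_id
    ((headCLM m l).continuous.measurable.prodMk (tailCLM m l).continuous.measurable)
  simpa [Function.comp_def] using h3

theorem posDef_inv_add_inv_sub_inv {KY K₁ K₁' : Matrix (Fin n) (Fin n) ℝ} (hKY : KY.PosDef)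
    (hK₁ : K₁.PosDef) (h : LoewnerLE K₁ K₁') : (K₁⁻¹ + (KY⁻¹ - K₁'⁻¹)).PosDef := by
  have h1 : (K₁⁻¹ - K₁'⁻¹).PosSemidef := LoewnerLE.inv hK₁ h
  rw [show K₁⁻¹ + (KY⁻¹ - K₁'⁻¹) = KY⁻¹ + (K₁⁻¹ - K₁'⁻¹) by abel]
  exact hKY.inv.add_posSemidef h1

/-- A Gaussian source `X` with Gaussian side information `Y`, of which `Y₁` is a linear function,
and a further observation `A` with `A ↔ X ↔ Y`. -/
structure SideInformation [StandardBorelSpace Ω] (P : Measure Ω) [IsFiniteMeasure P]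
    (X : Ω → Vec n) (Y : Ω → Vec m) (Y₁ : Ω → Vec k₁) (g : Vec m →L[ℝ] Vec k₁) (A : Ω → γ) :
    Prop where
  measurable_X : Measurable X
  measurable_Y : Measurable Y
  measurable_Y₁ : Measurable Y₁
  measurable_A : Measurable A
  hasGaussianLaw : HasGaussianLaw (fun ω => (X ω, Y ω)) P
  mean_X : ∀ i, ∫ ω, X ω i ∂P = 0
  mean_Y : ∀ i, ∫ ω, Y ω i ∂P = 0
  mean_Y₁ : ∀ i, ∫ ω, Y₁ ω i ∂P = 0
  eq_comp : Y₁ =ᵐ[P] fun ω => g (Y ω)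
  markov : IsMarkovChain P A X Y

theorem GaussianResidual.crossMoment_left [IsProbabilityMeasure P] {X : Ω → Vec n} {C : Ω → γ}
    {M : γ → Vec n} {K : Matrix (Fin n) (Fin n) ℝ} (h : GaussianResidual P X C M K)
    (hXm : Measurable X) (hX : SqIntegrable P X) (hC : Measurable C) :
    crossMoment P (fun ω => X ω - M (C ω)) X = K := by
  have hM := h.measurable
  have he := h.hasGaussianLaw.sqIntegrable
  have h0 : crossMoment P (fun ω => X ω - M (C ω)) (fun ω => M (C ω)) = 0 :=
    crossMoment_eq_zero_of_indepFun (by fun_prop) (by fun_prop)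
      (h.indep.comp measurable_id hM) h.mean
  have hMs : SqIntegrable P fun ω => M (C ω) := by simpa using hX.sub he
  have h1 := h.cov
  rwa [crossMoment_sub_right he hX hMs, h0, sub_zero] at h1

variable [StandardBorelSpace Ω] [IsProbabilityMeasure P]

theorem SideInformation.posDef_fusion {X : Ω → Vec n} {Y : Ω → Vec m} {Y₁ : Ω → Vec k₁}
    {g : Vec m →L[ℝ] Vec k₁} {A : Ω → γ} (h : SideInformation P X Y Y₁ g A)
    (hKY : (condCov P X Y).PosDef) (hK₁ : (condCov P X fun ω => (A ω, Y₁ ω)).PosDef) :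
    ((condCov P X fun ω => (A ω, Y₁ ω))⁻¹ +
      ((condCov P X Y)⁻¹ - (condCov P X Y₁)⁻¹)).PosDef := by
  have hX := h.hasGaussianLaw.fst.sqIntegrable
  have hle : LoewnerLE (condCov P X fun ω => (A ω, Y₁ ω)) (condCov P X Y₁) :=
    condCov_comp_loewnerLE (Z := fun ω => (A ω, Y₁ ω)) hX
      (h.measurable_A.prodMk h.measurable_Y₁) (ρ := Prod.snd) measurable_snd
  exact posDef_inv_add_inv_sub_inv hKY hK₁ hle

theorem SideInformation.exists_regression {X : Ω → Vec n} {Y : Ω → Vec m} {Y₁ : Ω → Vec k₁}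
    {g : Vec m →L[ℝ] Vec k₁} {A : Ω → γ} (h : SideInformation P X Y Y₁ g A)
    {KY K₁' : Matrix (Fin n) (Fin n) ℝ} (hKYe : condCov P X Y = KY)
    (hK₁'e : condCov P X Y₁ = K₁') :
    ∃ (L : Matrix (Fin n) (Fin m) ℝ) (L₁ : Matrix (Fin n) (Fin k₁) ℝ),
      GaussianResidual P X Y (fun y => L *ᵥ y) KY ∧
      GaussianResidual P X Y₁ (fun y => L₁ *ᵥ y) K₁' := by
  obtain ⟨L, hL⟩ := exists_gaussianResidual h.measurable_X h.measurable_Y h.hasGaussianLaw h.mean_X h.mean_Y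
  have hXY₁ : HasGaussianLaw (fun ω => (X ω, Y₁ ω)) P := by
    have h1 : HasGaussianLaw (fun ω => (X ω, g (Y ω))) P :=
      h.hasGaussianLaw.map ((ContinuousLinearMap.fst ℝ (Vec n) (Vec m)).prod
        (g.comp (ContinuousLinearMap.snd ℝ _ _)))
    refine h1.congr_ae ?_
    filter_upwards [h.eq_comp] with ω hω
    rw [hω]
  obtain ⟨L₁, hL₁⟩ := exists_gaussianResidual h.measurable_X h.measurable_Y₁ hXY₁ h.mean_X h.mean_Y₁
  rw [hKYe] at hL
  rw [hK₁'e] at hL₁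
  exact ⟨L, L₁, hL, hL₁⟩

variable [StandardBorelSpace γ] [Nonempty γ]

/-- The discrepancy of the regressions on `Y₁` and `Y` is independent of `(X, Y₁, A)`. -/
theorem SideInformation.discrepancy {X : Ω → Vec n} {Y : Ω → Vec m} {Y₁ : Ω → Vec k₁}
    {g : Vec m →L[ℝ] Vec k₁} {A : Ω → γ} (h : SideInformation P X Y Y₁ g A)
    {KY K₁' : Matrix (Fin n) (Fin n) ℝ} (hKY : KY.PosDef) (hK₁' : K₁'.PosDef)
    {L : Matrix (Fin n) (Fin m) ℝ} {L₁ : Matrix (Fin n) (Fin k₁) ℝ}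
    (hL : GaussianResidual P X Y (fun y => L *ᵥ y) KY)
    (hL₁ : GaussianResidual P X Y₁ (fun y => L₁ *ᵥ y) K₁') {N : Ω → Vec n}
    (hN : N = fun ω => K₁'⁻¹ *ᵥ (X ω - L₁ *ᵥ g (Y ω)) - KY⁻¹ *ᵥ (X ω - L *ᵥ Y ω)) :
    Measurable N ∧ SqIntegrable P N ∧ (∀ i, ∫ ω, N ω i ∂P = 0) ∧
      IndepFun N (fun ω => ((X ω, g (Y ω)), A ω)) P ∧
      crossMoment P N N = KY⁻¹ - K₁'⁻¹ := by
  have hXm := h.measurable_X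
  have hYm := h.measurable_Y
  have hY₁m := h.measurable_Y₁
  have hAm := h.measurable_A
  have hgm : Measurable g := g.continuous.measurable
  have hX := h.hasGaussianLaw.fst.sqIntegrable
  set eY : Ω → Vec n := fun ω => X ω - L *ᵥ Y ω with heY
  set e₁ : Ω → Vec n := fun ω => X ω - L₁ *ᵥ g (Y ω) with he₁
  have he₁ae : (fun ω => X ω - L₁ *ᵥ Y₁ ω) =ᵐ[P] e₁ := by
    filter_upwards [h.eq_comp] with ω hω
    rw [he₁, hω]
  have hLm : Measurable fun y : Vec m => L *ᵥ y := (mulVecCLM L).continuous.measurable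
  have hL₁m : Measurable fun y : Vec k₁ => L₁ *ᵥ y := (mulVecCLM L₁).continuous.measurable
  have heYm : Measurable eY := hXm.sub (hLm.comp hYm)
  have he₁m : Measurable e₁ := hXm.sub (hL₁m.comp (hgm.comp hYm))
  have heYs : SqIntegrable P eY := hL.hasGaussianLaw.sqIntegrable
  have he₁s : SqIntegrable P e₁ := hL₁.hasGaussianLaw.sqIntegrable.congr he₁ae
  have hgY : HasGaussianLaw (fun ω => g (Y ω)) P := h.hasGaussianLaw.snd.map g
  have hgYs := hgY.sqIntegrable
  have heYX : crossMoment P eY X = KY := hL.crossMoment_left hXm hX hYm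
  have he₁X : crossMoment P e₁ X = K₁' := by
    rw [← hL₁.crossMoment_left hXm hX hY₁m]
    exact crossMoment_congr he₁ae.symm .rfl
  have heYg : crossMoment P eY (fun ω => g (Y ω)) = 0 :=
    crossMoment_eq_zero_of_indepFun heYm (hgm.comp hYm) (hL.indep.comp measurable_id hgm) hL.mean
  have he₁g : crossMoment P e₁ (fun ω => g (Y ω)) = 0 := by
    rw [← crossMoment_eq_zero_of_indepFun (hXm.sub (hL₁m.comp hY₁m)) hY₁m hL₁.indep hL₁.mean]
    exact crossMoment_congr he₁ae.symm h.eq_comp.symm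
  -- the discrepancy of the two regressions
  let T : (Vec n × Vec m) →L[ℝ] Vec n :=
    (mulVecCLM K₁'⁻¹).comp (ContinuousLinearMap.fst ℝ _ _ -
      (mulVecCLM L₁).comp (g.comp (ContinuousLinearMap.snd ℝ _ _))) -
    (mulVecCLM KY⁻¹).comp (ContinuousLinearMap.fst ℝ _ _ -
      (mulVecCLM L).comp (ContinuousLinearMap.snd ℝ _ _))
  have hNT : N = fun ω => T (X ω, Y ω) := hN
  have hNs : SqIntegrable P N := by rw [hN]; exact (he₁s.mulVec _).sub (heYs.mulVec _)
  have hNm : Measurable N := by rw [hNT]; exact T.continuous.measurable.comp (hXm.prodMk hYm)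
  have hN0 : ∀ i, ∫ ω, N ω i ∂P = 0 := by
    intro i
    have h1 : ∀ i, ∫ ω, e₁ ω i ∂P = 0 := by
      intro i
      rw [← hL₁.mean i]
      refine integral_congr_ae ?_
      filter_upwards [he₁ae] with ω hω
      rw [hω]
    simp only [hN, Pi.sub_apply]
    rw [integral_sub ((he₁s.mulVec _ i).integrable one_le_two)
      ((heYs.mulVec _ i).integrable one_le_two),
      integral_mulVec_eq_zero (fun j => (he₁s j).integrable one_le_two) h1,
      integral_mulVec_eq_zero (fun j => (heYs j).integrable one_le_two) hL.mean, sub_zero]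
  have hKYu : KY⁻¹ * KY = 1 := nonsing_inv_mul _ ((isUnit_iff_isUnit_det _).mp hKY.isUnit)
  have hK₁'u : K₁'⁻¹ * K₁' = 1 := nonsing_inv_mul _ ((isUnit_iff_isUnit_det _).mp hK₁'.isUnit)
  -- Each regression error has its own covariance as cross moment with `X`; weighted by the inverse
  -- covariances, the two contributions are both the identity and cancel.
  have hNX : crossMoment P N X = 0 := by
    rw [hN, crossMoment_sub_left (he₁s.mulVec _) (heYs.mulVec _) hX,
      crossMoment_mulVec_left he₁s hX, crossMoment_mulVec_left heYs hX, heYX, he₁X, hKYu, hK₁'u,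
      sub_self]
  have hNg : crossMoment P N (fun ω => g (Y ω)) = 0 := by
    rw [hN, crossMoment_sub_left (he₁s.mulVec _) (heYs.mulVec _) hgYs,
      crossMoment_mulVec_left he₁s hgYs, crossMoment_mulVec_left heYs hgYs, heYg, he₁g]
    simp
  have hNind : IndepFun N (fun ω => (X ω, g (Y ω))) P := by
    refine indepFun_prod_of_crossMoment_eq_zero ?_ hN0 hNX hNg
    rw [hNT]
    exact h.hasGaussianLaw.map (T.prod ((ContinuousLinearMap.fst ℝ _ _).prod
      (g.comp (ContinuousLinearMap.snd ℝ _ _))))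
  -- `N` is a linear function of `(X, Y)` independent of `(X, g(Y))`, and `A` depends on `(X, Y)`
  -- only through `X`.
  have hNA : IndepFun N (fun ω => ((X ω, g (Y ω)), A ω)) P := by
    rw [hNT] at hNind ⊢
    exact h.markov.indepFun_prod hAm hYm (n := fun z => T z) (t := fun z => (z.1, g z.2))
      (b := Prod.fst) T.continuous.measurable (by fun_prop) measurable_fst (fun _ => rfl) hNind
  have hNe₁ : crossMoment P N e₁ = 0 := by
    refine crossMoment_eq_zero_of_indepFun hNm he₁m ?_ hN0
    exact hNA.comp (φ := id) (ψ := fun z : (Vec n × Vec k₁) × γ => z.1.1 - L₁ *ᵥ z.1.2)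
      measurable_id ((measurable_fst.comp measurable_fst).sub
        (hL₁m.comp (measurable_snd.comp measurable_fst)))
  have heYe₁ : crossMoment P eY e₁ = KY := by
    rw [he₁, crossMoment_sub_right heYs hX (hgYs.mulVec _), heYX,
      crossMoment_mulVec_right heYs hgYs, heYg, Matrix.zero_mul, sub_zero]
  have hKYt : KYᵀ = KY := by simpa using hKY.isHermitian.eq
  have hKYit : (KY⁻¹)ᵀ = KY⁻¹ := by rw [transpose_nonsing_inv, hKYt]
  have hNeY : crossMoment P N eY = K₁'⁻¹ * KY - 1 := by
    rw [hN, crossMoment_sub_left (he₁s.mulVec _) (heYs.mulVec _) heYs,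
      crossMoment_mulVec_left he₁s heYs, crossMoment_mulVec_left heYs heYs, hL.cov, hKYu,
      ← crossMoment_transpose eY e₁, heYe₁, hKYt]
  have hNN : crossMoment P N N = KY⁻¹ - K₁'⁻¹ := by
    have e : crossMoment P N N =
        crossMoment P N (fun ω => K₁'⁻¹ *ᵥ e₁ ω - KY⁻¹ *ᵥ eY ω) := congrArg _ hN
    rw [e, crossMoment_sub_right hNs (he₁s.mulVec _) (heYs.mulVec _),
      crossMoment_mulVec_right hNs he₁s, crossMoment_mulVec_right hNs heYs, hNe₁, hNeY, hKYit,
      Matrix.sub_mul, Matrix.mul_assoc,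
      mul_nonsing_inv _ ((isUnit_iff_isUnit_det _).mp hKY.isUnit)]
    simp
  exact ⟨hNm, hNs, hN0, hNA, hNN⟩

/-- Fusion of the estimate of `X` from `(A, Y₁)` with the estimate from `Y`. -/
theorem SideInformation.exists_fusion {X : Ω → Vec n} {Y : Ω → Vec m} {Y₁ : Ω → Vec k₁}
    {g : Vec m →L[ℝ] Vec k₁} {A : Ω → γ} (h : SideInformation P X Y Y₁ g A)
    {KY K₁' K₁ KG : Matrix (Fin n) (Fin n) ℝ} (hKYe : condCov P X Y = KY)
    (hK₁'e : condCov P X Y₁ = K₁') (hK₁e : (condCov P X fun ω => (A ω, Y₁ ω)) = K₁)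
    (hKGe : (K₁⁻¹ + (KY⁻¹ - K₁'⁻¹))⁻¹ = KG)
    (hKY : KY.PosDef) (hK₁' : K₁'.PosDef) (hK₁ : K₁.PosDef) :
    ∃ (M : Vec m → Vec n) (M₁ : Vec k₁ → Vec n) (φ : γ × Vec k₁ → Vec n),
      GaussianResidual P X Y M KY ∧ GaussianResidual P X Y₁ M₁ K₁' ∧ Measurable φ ∧
      SqIntegrable P (fun ω => X ω - φ (A ω, g (Y ω))) ∧
      crossMoment P (fun ω => X ω - φ (A ω, g (Y ω))) (fun ω => X ω - φ (A ω, g (Y ω))) = K₁ ∧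
      SqIntegrable P (fun ω => X ω - KG *ᵥ (K₁⁻¹ *ᵥ φ (A ω, g (Y ω)) + KY⁻¹ *ᵥ M (Y ω) -
        K₁'⁻¹ *ᵥ M₁ (g (Y ω)))) ∧
      crossMoment P
        (fun ω => X ω - KG *ᵥ (K₁⁻¹ *ᵥ φ (A ω, g (Y ω)) + KY⁻¹ *ᵥ M (Y ω) -
          K₁'⁻¹ *ᵥ M₁ (g (Y ω))))
        (fun ω => X ω - KG *ᵥ (K₁⁻¹ *ᵥ φ (A ω, g (Y ω)) + KY⁻¹ *ᵥ M (Y ω) -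
          K₁'⁻¹ *ᵥ M₁ (g (Y ω)))) = KG := by
  have hJ : (K₁⁻¹ + (KY⁻¹ - K₁'⁻¹)).PosDef := by
    rw [← hK₁e, ← hKYe, ← hK₁'e]
    exact h.posDef_fusion (hKYe ▸ hKY) (hK₁e ▸ hK₁)
  set J := K₁⁻¹ + (KY⁻¹ - K₁'⁻¹) with hJdef
  have hXm := h.measurable_X
  have hYm := h.measurable_Y
  have hY₁m := h.measurable_Y₁
  have hAm := h.measurable_A
  have hgm : Measurable g := g.continuous.measurable
  have hX := h.hasGaussianLaw.fst.sqIntegrable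
  obtain ⟨L, L₁, hL, hL₁⟩ := h.exists_regression hKYe hK₁'e
  -- the estimate from `(A, Y₁)`
  obtain ⟨φ, hφ, hφe⟩ := exists_measurable_condMean_eq (P := P) X (fun ω => (A ω, Y₁ ω))
  have hφae : (fun ω => X ω - φ (A ω, Y₁ ω)) =ᵐ[P] fun ω => X ω - φ (A ω, g (Y ω)) := by
    filter_upwards [h.eq_comp] with ω hω
    rw [hω]
  have hes : SqIntegrable P fun ω => X ω - φ (A ω, g (Y ω)) := by
    have := hX.sub (hX.condMean (P := P) fun ω => (A ω, Y₁ ω))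
    rw [hφe] at this
    exact this.congr hφae
  have hec : crossMoment P (fun ω => X ω - φ (A ω, g (Y ω))) (fun ω => X ω - φ (A ω, g (Y ω))) =
      K₁ := by
    rw [← crossMoment_congr hφae hφae, ← hK₁e, condCov_eq_crossMoment, hφe]
  refine ⟨fun y => L *ᵥ y, fun y => L₁ *ᵥ y, φ, hL, hL₁, hφ, hes, hec, ?_⟩
  set N : Ω → Vec n := fun ω => K₁'⁻¹ *ᵥ (X ω - L₁ *ᵥ g (Y ω)) - KY⁻¹ *ᵥ (X ω - L *ᵥ Y ω)
    with hN
  obtain ⟨hNm, hNs, hN0, hNA, hNN⟩ := h.discrepancy hKY hK₁' hL hL₁ hN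
  have hK₁u : K₁⁻¹ * K₁ = 1 := nonsing_inv_mul _ ((isUnit_iff_isUnit_det _).mp hK₁.isUnit)
  set e : Ω → Vec n := fun ω => X ω - φ (A ω, g (Y ω)) with he
  have hem : Measurable e := by fun_prop
  have hNe : crossMoment P N e = 0 := by
    refine crossMoment_eq_zero_of_indepFun hNm hem ?_ hN0
    exact hNA.comp (φ := id) (ψ := fun z : (Vec n × Vec k₁) × γ => z.1.1 - φ (z.2, z.1.2))
      measurable_id (by fun_prop)
  have heN : crossMoment P e N = 0 := by rw [← crossMoment_transpose, hNe, transpose_zero]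
  have hK₁t : (K₁⁻¹)ᵀ = K₁⁻¹ := by
    rw [transpose_nonsing_inv]; congr 1; simpa using hK₁.isHermitian.eq
  -- `N` is independent of `(X, g(Y), A)`, hence uncorrelated with `e`, so the covariances `K₁⁻¹`
  -- and `KY⁻¹ - K₁'⁻¹` simply add.
  have hd : crossMoment P (fun ω => K₁⁻¹ *ᵥ e ω - N ω) (fun ω => K₁⁻¹ *ᵥ e ω - N ω) = J := by
    have hs := hes.mulVec K₁⁻¹
    rw [crossMoment_sub_left hs hNs (hs.sub hNs), crossMoment_sub_right hs hs hNs,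
      crossMoment_sub_right hNs hs hNs, crossMoment_mulVec_left hes hs,
      crossMoment_mulVec_right hes hes, crossMoment_mulVec_left hes hNs, heN,
      crossMoment_mulVec_right hNs hes, hNe, hNN, hec, hK₁t, ← Matrix.mul_assoc, hK₁u, hJdef]
    simp only [Matrix.one_mul, Matrix.mul_zero, Matrix.zero_mul, sub_zero, zero_sub, sub_neg_eq_add]
  have hGJ : KG * J = 1 := by
    rw [← hKGe, nonsing_inv_mul _ ((isUnit_iff_isUnit_det _).mp hJ.isUnit)]
  have hGt : KGᵀ = KG := by
    rw [← hKGe, transpose_nonsing_inv]; congr 1; simpa using hJ.isHermitian.eq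
  -- Writing `X = KG J X` exhibits the fused error as `KG (K₁⁻¹ e - N)`, with covariance `KG J KG =
  -- KG`.
  have hrepr : (fun ω => X ω - KG *ᵥ (K₁⁻¹ *ᵥ φ (A ω, g (Y ω)) + KY⁻¹ *ᵥ (L *ᵥ Y ω) -
      K₁'⁻¹ *ᵥ (L₁ *ᵥ g (Y ω)))) = fun ω => KG *ᵥ (K₁⁻¹ *ᵥ e ω - N ω) := by
    ext1 ω
    have h1 : X ω = KG *ᵥ (J *ᵥ X ω) := by rw [mulVec_mulVec, hGJ, one_mulVec]
    conv_lhs => rw [h1]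
    rw [← mulVec_sub]
    congr 1
    simp only [he, hN, hJdef, mulVec_sub, add_mulVec, sub_mulVec]
    abel
  have hds : SqIntegrable P fun ω => K₁⁻¹ *ᵥ e ω - N ω := (hes.mulVec _).sub hNs
  simp only [hrepr]
  refine ⟨hds.mulVec _, ?_⟩
  rw [crossMoment_mulVec_left hds (hds.mulVec _), crossMoment_mulVec_right hds hds, hd,
    ← Matrix.mul_assoc, hGJ, Matrix.one_mul, hGt]

/-- The fused estimate is a function of `(A, Y)` whose error covariance is exactly the right side,
and the conditional mean does at least as well. -/
theorem SideInformation.condCov_loewnerLE_fusion {X : Ω → Vec n} {Y : Ω → Vec m}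
    {Y₁ : Ω → Vec k₁} {g : Vec m →L[ℝ] Vec k₁} {A : Ω → γ} (h : SideInformation P X Y Y₁ g A)
    (hKY : (condCov P X Y).PosDef) (hK₁' : (condCov P X Y₁).PosDef)
    (hK₁ : (condCov P X fun ω => (A ω, Y₁ ω)).PosDef) :
    LoewnerLE (condCov P X fun ω => (A ω, Y ω))
      ((condCov P X fun ω => (A ω, Y₁ ω))⁻¹ + ((condCov P X Y)⁻¹ - (condCov P X Y₁)⁻¹))⁻¹ := by
  obtain ⟨M, M₁, φ, hM, hM₁, hφ, -, -, hs, hc⟩ := h.exists_fusion rfl rfl rfl rfl hKY hK₁' hK₁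
  have hX := h.hasGaussianLaw.fst.sqIntegrable
  have hgm : Measurable g := g.continuous.measurable
  have hMm := hM.measurable
  have hM₁m := hM₁.measurable
  have hmv : ∀ B : Matrix (Fin n) (Fin n) ℝ, Measurable fun x : Vec n => B *ᵥ x := fun B =>
    (mulVecCLM B).continuous.measurable
  set KG := ((condCov P X fun ω => (A ω, Y₁ ω))⁻¹ + ((condCov P X Y)⁻¹ - (condCov P X Y₁)⁻¹))⁻¹
  have key := condCov_loewnerLE_crossMoment hX (h.measurable_A.prodMk h.measurable_Y)
    (φ := fun z => KG *ᵥ ((condCov P X fun ω => (A ω, Y₁ ω))⁻¹ *ᵥ φ (z.1, g z.2) +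
      (condCov P X Y)⁻¹ *ᵥ M z.2 - (condCov P X Y₁)⁻¹ *ᵥ M₁ (g z.2)))
    ((hmv _).comp ((((hmv _).comp (hφ.comp (by fun_prop))).add
      ((hmv _).comp (hMm.comp measurable_snd))).sub
      ((hmv _).comp (hM₁m.comp (hgm.comp measurable_snd)))))
    (by simpa using hX.sub hs)
  rwa [hc] at key

end Fusion

/-! ### The Gaussian lower bound on the rate. -/

section LowerBound

open Matrix

variable {Ω γ δ ε : Type*} [MeasurableSpace Ω] [MeasurableSpace γ] [MeasurableSpace δ]
  [MeasurableSpace ε] {P : Measure Ω} {n m k₁ : ℕ}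

theorem dotProduct_mulVec_sub_sub {A : Matrix (Fin n) (Fin n) ℝ} (hA : Aᵀ = A) (x a : Vec n) :
    (x - a) ⬝ᵥ (A *ᵥ (x - a)) = x ⬝ᵥ (A *ᵥ x) - 2 * x ⬝ᵥ (A *ᵥ a) + (0 - a) ⬝ᵥ (A *ᵥ (0 - a)) := by
  have h : a ⬝ᵥ (A *ᵥ x) = x ⬝ᵥ (A *ᵥ a) := by
    rw [dotProduct_mulVec, ← mulVec_transpose, hA, dotProduct_comm]
  simp only [zero_sub, mulVec_sub, sub_dotProduct, dotProduct_sub, mulVec_neg, neg_dotProduct,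
    dotProduct_neg, h]
  ring

/-- `KG` and `d` are the precision and the precision-weighted mean for which the quadratic and
linear terms in `x` cancel. The ratio of densities is thus constant in `x` and may be read off at `x
= 0`. -/
theorem log_gaussDensity_fusion {KY K₁ K₁' KG : Matrix (Fin n) (Fin n) ℝ} (hKY : KY.PosDef)
    (hK₁ : K₁.PosDef) (hK₁' : K₁'.PosDef) (hKG : KG.PosDef)
    (hJ : KG⁻¹ = K₁⁻¹ + (KY⁻¹ - K₁'⁻¹)) (a b c x : Vec n) {d : Vec n}
    (hd : d = KG *ᵥ (K₁⁻¹ *ᵥ a + KY⁻¹ *ᵥ b - K₁'⁻¹ *ᵥ c)) :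
    Real.log (gaussDensity K₁ (x - a)) + Real.log (gaussDensity KY (x - b)) -
        Real.log (gaussDensity K₁' (x - c)) - Real.log (gaussDensity KG (x - d)) =
      Real.log (gaussDensity K₁ (0 - a)) + Real.log (gaussDensity KY (0 - b)) -
        Real.log (gaussDensity K₁' (0 - c)) - Real.log (gaussDensity KG (0 - d)) := by
  have ht : ∀ {K : Matrix (Fin n) (Fin n) ℝ}, K.PosDef → (K⁻¹)ᵀ = K⁻¹ := by
    intro K hK
    rw [transpose_nonsing_inv]; congr 1; simpa using hK.isHermitian.eq
  have h1 : x ⬝ᵥ (KG⁻¹ *ᵥ d) =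
      x ⬝ᵥ (K₁⁻¹ *ᵥ a) + x ⬝ᵥ (KY⁻¹ *ᵥ b) - x ⬝ᵥ (K₁'⁻¹ *ᵥ c) := by
    rw [hd, mulVec_mulVec, nonsing_inv_mul _ ((isUnit_iff_isUnit_det _).mp hKG.isUnit), one_mulVec,
      dotProduct_sub, dotProduct_add]
  have h2 : x ⬝ᵥ (KG⁻¹ *ᵥ x) =
      x ⬝ᵥ (K₁⁻¹ *ᵥ x) + x ⬝ᵥ (KY⁻¹ *ᵥ x) - x ⬝ᵥ (K₁'⁻¹ *ᵥ x) := by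
    rw [hJ, add_mulVec, sub_mulVec, dotProduct_add, dotProduct_sub]
    ring
  rw [log_gaussDensity hK₁, log_gaussDensity hKY, log_gaussDensity hK₁', log_gaussDensity hKG,
    log_gaussDensity hK₁, log_gaussDensity hKY, log_gaussDensity hK₁', log_gaussDensity hKG,
    dotProduct_mulVec_sub_sub (ht hK₁) x, dotProduct_mulVec_sub_sub (ht hKY) x,
    dotProduct_mulVec_sub_sub (ht hK₁') x, dotProduct_mulVec_sub_sub (ht hKG) x, h1, h2]
  ring

theorem ofReal_exp_log_gaussDensity_mul {K : Matrix (Fin n) (Fin n) ℝ} (hK : K.PosDef)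
    (x : Vec n) (t : ℝ) :
    ENNReal.ofReal (gaussDensity K x) * ENNReal.ofReal (Real.exp t) =
      ENNReal.ofReal (Real.exp (Real.log (gaussDensity K x) + t)) := by
  rw [Real.exp_add, Real.exp_log (gaussDensity_pos hK x),
    ENNReal.ofReal_mul (gaussDensity_pos hK x).le]

/-- The Gaussian density ratio of the fusion estimate integrates to one. -/
theorem lintegral_fusion_eq_one [IsProbabilityMeasure P] {X : Ω → Vec n} {Y : Ω → Vec m}
    {Y₁ : Ω → Vec k₁} {g : Vec m → Vec k₁} (hX : Measurable X) (hY : Measurable Y)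
    (hY₁ : Measurable Y₁) (hg : Measurable g) (hgY : Y₁ =ᵐ[P] fun ω => g (Y ω))
    {KY K₁ K₁' KG : Matrix (Fin n) (Fin n) ℝ} (hKY : KY.PosDef) (hK₁ : K₁.PosDef)
    (hK₁' : K₁'.PosDef) (hKG : KG.PosDef) (hJ : KG⁻¹ = K₁⁻¹ + (KY⁻¹ - K₁'⁻¹))
    {M : Vec m → Vec n} {M₁ : Vec k₁ → Vec n} (hM : GaussianResidual P X Y M KY)
    (hM₁ : GaussianResidual P X Y₁ M₁ K₁') {φ : γ × Vec k₁ → Vec n} (hφ : Measurable φ)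
    {d : Vec m × γ → Vec n}
    (hd : ∀ z, d z = KG *ᵥ (K₁⁻¹ *ᵥ φ (z.2, g z.1) + KY⁻¹ *ᵥ M z.1 - K₁'⁻¹ *ᵥ M₁ (g z.1)))
    (κ : Kernel (Vec k₁) γ) [IsMarkovKernel κ] :
    ∫⁻ y, ∫⁻ a, ENNReal.ofReal (Real.exp (Real.log (gaussDensity K₁ (0 - φ (a, g y))) +
      Real.log (gaussDensity KY (0 - M y)) - Real.log (gaussDensity K₁' (0 - M₁ (g y))) -
      Real.log (gaussDensity KG (0 - d (y, a))))) ∂κ (g y) ∂P.map Y = 1 := by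
  have hMm := hM.measurable
  have hM₁m := hM₁.measurable
  have hmg : ∀ K : Matrix (Fin n) (Fin n) ℝ, Measurable (gaussDensity K) := fun K =>
    (continuous_gaussDensity K).measurable
  have hmK : ∀ K : Matrix (Fin n) (Fin n) ℝ,
      Measurable fun x => Real.log (gaussDensity K x) := fun K => (hmg K).log
  have hkY := isMarkovKernel_gaussKernel hMm hKY
  have hk₁ := isMarkovKernel_gaussKernel hM₁m hK₁'
  have := Measure.isProbabilityMeasure_map (μ := P) hY.aemeasurable
  have := Measure.isProbabilityMeasure_map (μ := P) hY₁.aemeasurable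
  set R : (Vec k₁ × Vec n) × γ → ℝ≥0∞ := fun z => ENNReal.ofReal (Real.exp
    (Real.log (gaussDensity K₁ (z.1.2 - φ (z.2, z.1.1))) -
      Real.log (gaussDensity K₁' (z.1.2 - M₁ z.1.1)))) with hR
  have hRm : Measurable R := by
    refine Measurable.ennreal_ofReal (Real.measurable_exp.comp (Measurable.sub ?_ ?_))
    · exact (hmK K₁).comp (by fun_prop)
    · exact (hmK K₁').comp (by fun_prop)
  set G : Vec k₁ × Vec n → ℝ≥0∞ := fun z => ∫⁻ a, R (z, a) ∂κ z.1 with hG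
  have hGm : Measurable G :=
    Measurable.lintegral_kernel_prod_right' (κ := κ.prodMkRight (Vec n)) hRm
  have step1 : ∀ y, ∫⁻ a, ENNReal.ofReal (Real.exp (Real.log (gaussDensity K₁ (0 - φ (a, g y))) +
      Real.log (gaussDensity KY (0 - M y)) - Real.log (gaussDensity K₁' (0 - M₁ (g y))) -
      Real.log (gaussDensity KG (0 - d (y, a))))) ∂κ (g y) =
      ∫⁻ x, G (g y, x) ∂gaussKernel M KY y := by
    intro y
    have e : ∀ a, ENNReal.ofReal (Real.exp (Real.log (gaussDensity K₁ (0 - φ (a, g y))) +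
        Real.log (gaussDensity KY (0 - M y)) - Real.log (gaussDensity K₁' (0 - M₁ (g y))) -
        Real.log (gaussDensity KG (0 - d (y, a))))) =
        ∫⁻ x, ENNReal.ofReal (gaussDensity KY (x - M y)) * R ((g y, x), a) := by
      intro a
      -- The factor is free of `x`, so it equals its integral against the density of `N(d, KG)`.
      -- That density cancels the one in the denominator and leaves the law of `X` given `Y` times
      -- `R`.
      rw [← one_mul (ENNReal.ofReal _), ← lintegral_gaussDensity hKG (d (y, a)),
        ← lintegral_mul_const _ (by
          exact ((hmg KG).comp (measurable_id.sub measurable_const)).ennreal_ofReal)]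
      refine lintegral_congr fun x => ?_
      rw [ofReal_exp_log_gaussDensity_mul hKG, ofReal_exp_log_gaussDensity_mul hKY,
        ← log_gaussDensity_fusion hKY hK₁ hK₁' hKG hJ _ _ _ x (hd (y, a))]
      congr 2
      ring
    simp only [e]
    rw [lintegral_gaussKernel hMm _ _ (by fun_prop), lintegral_lintegral_swap]
    · refine lintegral_congr fun x => ?_
      rw [lintegral_const_mul _ (by fun_prop)]
    · refine Measurable.aemeasurable (Measurable.mul ?_ (hRm.comp (by fun_prop)))
      exact ((hmg KY).comp (by fun_prop)).ennreal_ofReal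
  simp only [step1]
  have hGg : Measurable fun z : Vec m × Vec n => G (g z.1, z.2) := by fun_prop
  rw [← Measure.lintegral_compProd (f := fun z : Vec m × Vec n => G (g z.1, z.2)) hGg,
    ← hM.map_eq_compProd hKY hX hY, lintegral_map hGg (by fun_prop)]
  -- `G` sees `Y` only through `g(Y)`, so `(Y, X)` may be replaced by `(Y₁, X)`. The law of `X`
  -- given `Y₁` has the `K₁'` density, which cancels the denominator of `R`; a normalised `K₁`
  -- density remains.
  have step2 : ∫⁻ ω, G (g (Y ω), X ω) ∂P = ∫⁻ z, G z ∂P.map fun ω => (Y₁ ω, X ω) := by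
    rw [lintegral_map hGm (by fun_prop)]
    refine lintegral_congr_ae ?_
    filter_upwards [hgY] with ω hω
    rw [hω]
  rw [step2, hM₁.map_eq_compProd hK₁' hX hY₁, Measure.lintegral_compProd hGm]
  have step3 : ∀ y, ∫⁻ x, G (y, x) ∂gaussKernel M₁ K₁' y = 1 := by
    intro y
    rw [lintegral_gaussKernel hM₁m _ _ (by fun_prop)]
    have e : ∀ x, ENNReal.ofReal (gaussDensity K₁' (x - M₁ y)) * G (y, x) =
        ∫⁻ a, ENNReal.ofReal (gaussDensity K₁ (x - φ (a, y))) ∂κ y := by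
      intro x
      simp only [hG]
      rw [← lintegral_const_mul _ (by fun_prop)]
      refine lintegral_congr fun a => ?_
      simp only [hR]
      rw [ofReal_exp_log_gaussDensity_mul hK₁', add_sub_cancel,
        Real.exp_log (gaussDensity_pos hK₁ _)]
    simp only [e]
    rw [lintegral_lintegral_swap]
    · simp only [lintegral_gaussDensity hK₁]
      simp
    · exact (((hmg K₁).comp (by fun_prop)).ennreal_ofReal).aemeasurable
  simp only [step3]
  simp

variable [StandardBorelSpace Ω] [StandardBorelSpace γ] [Nonempty γ] [StandardBorelSpace δ]
  [Nonempty δ] [StandardBorelSpace ε] [Nonempty ε] [IsProbabilityMeasure P]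

/-- The Gaussian lower bound for `I(X; W, U | Y₁) + I(X; V | W, U, Y)`. -/
theorem SideInformation.le_condMutualInfo_add {X : Ω → Vec n} {Y : Ω → Vec m} {Y₁ : Ω → Vec k₁}
    {g : Vec m →L[ℝ] Vec k₁} {W : Ω → γ} {U : Ω → δ} {V : Ω → ε}
    (h : SideInformation P X Y Y₁ g (fun ω => (W ω, U ω))) (hW : Measurable W) (hU : Measurable U)
    (hV : Measurable V) {KY K₁' K₁ KG Kc : Matrix (Fin n) (Fin n) ℝ} (hKYe : condCov P X Y = KY)
    (hK₁'e : condCov P X Y₁ = K₁') (hK₁e : (condCov P X fun ω => ((W ω, U ω), Y₁ ω)) = K₁)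
    (hKGe : (K₁⁻¹ + (KY⁻¹ - K₁'⁻¹))⁻¹ = KG)
    (hKce : (condCov P X fun ω => ((W ω, U ω, Y ω), V ω)) = Kc)
    (hKY : KY.PosDef) (hK₁' : K₁'.PosDef) (hK₁ : K₁.PosDef) (hKc : Kc.PosDef) :
    ENNReal.ofReal
        ((Real.log K₁'.det + Real.log KG.det - Real.log Kc.det - Real.log K₁.det) / 2) ≤
      condMutualInfo P X (fun ω => (W ω, U ω)) Y₁ +
        condMutualInfo P X V (fun ω => (W ω, U ω, Y ω)) := by
  have hXm := h.measurable_X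
  have hYm := h.measurable_Y
  have hgm : Measurable g := g.continuous.measurable
  have hX := h.hasGaussianLaw.fst.sqIntegrable
  have hJpd : (K₁⁻¹ + (KY⁻¹ - K₁'⁻¹)).PosDef := by
    have := h.posDef_fusion (hKYe ▸ hKY) (hK₁e ▸ hK₁)
    rwa [hKYe, hK₁e, hK₁'e] at this
  have hKG : KG.PosDef := hKGe ▸ hJpd.inv
  have hJ : KG⁻¹ = K₁⁻¹ + (KY⁻¹ - K₁'⁻¹) := by
    rw [← hKGe, nonsing_inv_nonsing_inv _ ((isUnit_iff_isUnit_det _).mp hJpd.isUnit)]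
  obtain ⟨M, M₁, φ, hM, hM₁, hφ, hes, hec, hGs, hGc⟩ :=
    h.exists_fusion hKYe hK₁'e hK₁e hKGe hKY hK₁' hK₁
  obtain ⟨φc, hφc, hφce⟩ := exists_measurable_condMean_eq (P := P) X
    (fun ω => ((W ω, U ω, Y ω), V ω))
  have hcs : SqIntegrable P fun ω => X ω - φc ((W ω, U ω, Y ω), V ω) := by
    have := hX.sub (hX.condMean (P := P) fun ω => ((W ω, U ω, Y ω), V ω))
    rwa [hφce] at this
  have hcc : crossMoment P (fun ω => X ω - φc ((W ω, U ω, Y ω), V ω))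
      (fun ω => X ω - φc ((W ω, U ω, Y ω), V ω)) = Kc := by
    rw [← hKce, condCov_eq_crossMoment, hφce]
  have hMm := hM.measurable
  have hM₁m := hM₁.measurable
  have h1ae : (fun ω => X ω - M₁ (Y₁ ω)) =ᵐ[P] fun ω => X ω - M₁ (g (Y ω)) := by
    filter_upwards [h.eq_comp] with ω hω
    rw [hω]
  have h1s : SqIntegrable P fun ω => X ω - M₁ (g (Y ω)) :=
    hM₁.hasGaussianLaw.sqIntegrable.congr h1ae
  have h1c : crossMoment P (fun ω => X ω - M₁ (g (Y ω))) (fun ω => X ω - M₁ (g (Y ω))) = K₁' := by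
    rw [← crossMoment_congr h1ae h1ae, hM₁.cov]
  have hmv : ∀ B : Matrix (Fin n) (Fin n) ℝ, Measurable fun x : Vec n => B *ᵥ x := fun B =>
    (mulVecCLM B).continuous.measurable
  have hmK : ∀ K : Matrix (Fin n) (Fin n) ℝ,
      Measurable fun x => Real.log (gaussDensity K x) := fun K =>
    (continuous_gaussDensity K).measurable.log
  set d : Vec m × (γ × δ) → Vec n := fun z =>
    KG *ᵥ (K₁⁻¹ *ᵥ φ (z.2, g z.1) + KY⁻¹ *ᵥ M z.1 - K₁'⁻¹ *ᵥ M₁ (g z.1)) with hd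
  have hdm : Measurable d :=
    (hmv _).comp ((((hmv _).comp (hφ.comp (by fun_prop))).add
      ((hmv _).comp (hMm.comp measurable_fst))).sub
      ((hmv _).comp (hM₁m.comp (hgm.comp measurable_fst))))
  -- The sum of the two log-likelihood ratios as they would be for Gaussian auxiliaries with these
  -- covariances: `K₁` against `K₁'` for the first information and `Kc` against `KG` for the second.
  set f : (γ × δ × Vec m) × Vec n × ε → ℝ := fun z =>
    Real.log (gaussDensity Kc (z.2.1 - φc (z.1, z.2.2))) +
      Real.log (gaussDensity K₁ (z.2.1 - φ ((z.1.1, z.1.2.1), g z.1.2.2))) -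
      Real.log (gaussDensity K₁' (z.2.1 - M₁ (g z.1.2.2))) -
      Real.log (gaussDensity KG (z.2.1 - d (z.1.2.2, (z.1.1, z.1.2.1)))) with hf
  have hfm : Measurable f := by
    refine Measurable.sub (Measurable.sub (Measurable.add ?_ ?_) ?_) ?_
    · exact (hmK Kc).comp (by fun_prop)
    · exact (hmK K₁).comp (by fun_prop)
    · exact (hmK K₁').comp (by fun_prop)
    · exact (hmK KG).comp (by fun_prop)
  have ic := integrable_log_gaussDensity hcs hKc
  have i1 := integrable_log_gaussDensity hes hK₁
  have i1' := integrable_log_gaussDensity h1s hK₁'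
  have iG := integrable_log_gaussDensity hGs hKG
  have hfi : Integrable (fun ω => f ((W ω, U ω, Y ω), X ω, V ω)) P :=
    ((ic.add i1).sub i1').sub iG
  -- The four errors have covariances `Kc`, `K₁`, `K₁'` and `KG`, so each mean is explicit and the
  -- dimensional constants cancel.
  have hfe : ∫ ω, f ((W ω, U ω, Y ω), X ω, V ω) ∂P =
      (Real.log K₁'.det + Real.log KG.det - Real.log Kc.det - Real.log K₁.det) / 2 := by
    have e1 : ∫ ω, f ((W ω, U ω, Y ω), X ω, V ω) ∂P = _ := integral_sub ((ic.add i1).sub i1') iG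
    have e2 := integral_sub (ic.add i1) i1'
    have e3 := integral_add ic i1
    simp only [Pi.add_apply] at e1 e2 e3
    rw [e1, e2, e3, integral_log_gaussDensity hcs hKc hcc, integral_log_gaussDensity hes hK₁ hec,
      integral_log_gaussDensity h1s hK₁' h1c, integral_log_gaussDensity hGs hKG hGc]
    ring
  rw [← hfe]
  refine integral_le_condMutualInfo_add hXm hYm h.measurable_Y₁ hW hU hV hgm h.eq_comp h.markov
    hfm hfi (E := fun z => ENNReal.ofReal (Real.exp
      (Real.log (gaussDensity K₁ (0 - φ (z.2, g z.1))) + Real.log (gaussDensity KY (0 - M z.1)) -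
        Real.log (gaussDensity K₁' (0 - M₁ (g z.1))) - Real.log (gaussDensity KG (0 - d z))))) ?_ ?_
  · filter_upwards [hM.condDistrib_eq hKY hXm hYm] with y hy w u v
    have hfx : Measurable fun x => f ((w, u, y), x, v) := by fun_prop
    rw [hy, lintegral_gaussKernel hMm _ _ (by fun_prop)]
    refine le_of_eq ?_
    -- The density of `X` given `Y` times `exp f` is a normalised `Kc` density times a factor free
    -- of `x`; this factor is `E`.
    have e : ∀ x, ENNReal.ofReal (gaussDensity KY (x - M y)) *
        ENNReal.ofReal (Real.exp (f ((w, u, y), x, v))) =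
        ENNReal.ofReal (gaussDensity Kc (x - φc ((w, u, y), v))) *
          ENNReal.ofReal (Real.exp (Real.log (gaussDensity K₁ (0 - φ ((w, u), g y))) +
            Real.log (gaussDensity KY (0 - M y)) - Real.log (gaussDensity K₁' (0 - M₁ (g y))) -
            Real.log (gaussDensity KG (0 - d (y, (w, u)))))) := by
      intro x
      rw [ofReal_exp_log_gaussDensity_mul hKY, ofReal_exp_log_gaussDensity_mul hKc,
        ← log_gaussDensity_fusion hKY hK₁ hK₁' hKG hJ _ _ _ x (d := d (y, (w, u))) rfl]
      congr 2
      simp only [hf]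
      ring
    simp only [e]
    rw [lintegral_mul_const _ (by
      exact ((continuous_gaussDensity Kc).measurable.comp
        (measurable_id.sub measurable_const)).ennreal_ofReal), lintegral_gaussDensity hKc, one_mul]
  · exact (lintegral_fusion_eq_one hXm hYm h.measurable_Y₁ hgm h.eq_comp hKY hK₁ hK₁' hKG hJ hM hM₁
      hφ (fun z => rfl) _).le

end LowerBound

/-! ### A singular error covariance forces an infinite rate. -/

section Singular

open Matrix

variable {Ω γ δ ε : Type*} [MeasurableSpace Ω] [MeasurableSpace γ] [MeasurableSpace δ]
  [MeasurableSpace ε] {P : Measure Ω} {n m k₁ : ℕ}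

theorem volume_dotProduct_eq {a : Vec n} (ha : a ≠ 0) (t : ℝ) :
    volume {x : Vec n | a ⬝ᵥ x = t} = 0 := by
  by_cases hne : ∃ x₀ : Vec n, a ⬝ᵥ x₀ = t
  · obtain ⟨x₀, hx₀⟩ := hne
    let V : Submodule ℝ (Vec n) :=
      { carrier := {x | a ⬝ᵥ x = 0}
        add_mem' := fun {x y} hx hy => by
          simp only [Set.mem_ofPred_eq] at hx hy ⊢
          rw [dotProduct_add, hx, hy, add_zero]
        zero_mem' := by simp
        smul_mem' := fun c x hx => by
          simp only [Set.mem_ofPred_eq] at hx ⊢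
          rw [dotProduct_smul, hx, smul_zero] }
    have hs : {x : Vec n | a ⬝ᵥ x = t} = (AffineSubspace.mk' x₀ V : Set (Vec n)) := by
      ext x
      rw [SetLike.mem_coe, AffineSubspace.mem_mk']
      change a ⬝ᵥ x = t ↔ a ⬝ᵥ (x - x₀) = 0
      rw [dotProduct_sub, hx₀, sub_eq_zero]
    rw [hs]
    refine Measure.addHaar_affineSubspace _ _ fun htop => ha ?_
    have h1 : x₀ + a ∈ AffineSubspace.mk' x₀ V := by rw [htop]; trivial
    rw [AffineSubspace.mem_mk'] at h1
    have h2 : a ⬝ᵥ (x₀ + a - x₀) = 0 := h1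
    rwa [add_sub_cancel_left, dotProduct_self_eq_zero] at h2
  · convert measure_empty (μ := (volume : Measure (Vec n)))
    ext x
    simp only [Set.mem_ofPred_eq, Set.mem_empty_iff_false, iff_false]
    exact fun hx => hne ⟨x, hx⟩

theorem exists_dotProduct_mulVec_eq_zero {K : Matrix (Fin n) (Fin n) ℝ} (hK : K.PosSemidef)
    (h : ¬ K.PosDef) : ∃ a : Vec n, a ≠ 0 ∧ a ⬝ᵥ (K *ᵥ a) = 0 := by
  by_contra! hne
  refine h (Matrix.PosDef.of_dotProduct_mulVec_pos hK.isHermitian fun x hx => ?_)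
  have h1 := hK.dotProduct_mulVec_nonneg x
  simp only [star_trivial] at h1 ⊢
  exact lt_of_le_of_ne h1 (hne x hx).symm

variable [StandardBorelSpace Ω] [StandardBorelSpace γ] [Nonempty γ] [StandardBorelSpace δ]
  [Nonempty δ] [StandardBorelSpace ε] [Nonempty ε] [IsProbabilityMeasure P]

/-- A singular error covariance costs infinite rate. -/
theorem SideInformation.condMutualInfo_add_eq_top {X : Ω → Vec n} {Y : Ω → Vec m}
    {Y₁ : Ω → Vec k₁} {g : Vec m →L[ℝ] Vec k₁} {W : Ω → γ} {U : Ω → δ} {V : Ω → ε}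
    (h : SideInformation P X Y Y₁ g (fun ω => (W ω, U ω))) (hW : Measurable W) (hU : Measurable U)
    (hV : Measurable V) (hKY : (condCov P X Y).PosDef)
    (hKc : ¬ (condCov P X fun ω => ((W ω, U ω, Y ω), V ω)).PosDef) :
    condMutualInfo P X (fun ω => (W ω, U ω)) Y₁ +
      condMutualInfo P X V (fun ω => (W ω, U ω, Y ω)) = ∞ := by
  have hXm := h.measurable_X
  have hYm := h.measurable_Y
  have hX := h.hasGaussianLaw.fst.sqIntegrable
  obtain ⟨a, ha, ha0⟩ := exists_dotProduct_mulVec_eq_zero (posSemidef_condCov hX _) hKc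
  obtain ⟨φ, hφ, hφe⟩ := exists_measurable_condMean_eq (P := P) X
    (fun ω => ((W ω, U ω, Y ω), V ω))
  have hs : SqIntegrable P fun ω => X ω - φ ((W ω, U ω, Y ω), V ω) := by
    have := hX.sub (hX.condMean (P := P) fun ω => ((W ω, U ω, Y ω), V ω))
    rwa [hφe] at this
  rw [condCov_eq_crossMoment, hφe, dotProduct_crossMoment_mulVec hs] at ha0
  have hL2 : MemLp (fun ω => a ⬝ᵥ (X ω - φ ((W ω, U ω, Y ω), V ω))) 2 P := by
    simp only [dotProduct]
    exact memLp_finsetSum _ fun j _ => (hs j).const_mul _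
  rw [integral_eq_zero_iff_of_nonneg (fun ω => sq_nonneg _) hL2.integrable_sq] at ha0
  obtain ⟨L, hL⟩ := exists_gaussianResidual hXm hYm h.hasGaussianLaw h.mean_X h.mean_Y
  have hdot : Measurable fun x : Vec n => a ⬝ᵥ x := by
    simp only [dotProduct]
    fun_prop
  set B : Set ((γ × δ × Vec m) × Vec n × ε) := {z | a ⬝ᵥ z.2.1 = a ⬝ᵥ φ (z.1, z.2.2)} with hB
  have hBm : MeasurableSet B :=
    measurableSet_eq_fun (hdot.comp (by fun_prop)) (hdot.comp (by fun_prop))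
  refine ENNReal.eq_top_of_forall_nnreal_le fun r => ?_
  -- Under `P` the vector `X` lies on the hyperplane almost surely, so `f = r`. Given `Y` alone, `X`
  -- has a density and the hyperplane is null, so `exp f` integrates to one. The rate thus exceeds
  -- every `r`.
  set f : (γ × δ × Vec m) × Vec n × ε → ℝ := B.indicator fun _ => (r : ℝ) with hf
  have hfm : Measurable f := measurable_const.indicator hBm
  have hfae : (fun ω => f ((W ω, U ω, Y ω), X ω, V ω)) =ᵐ[P] fun _ => (r : ℝ) := by
    filter_upwards [ha0] with ω hω
    rw [hf, Set.indicator_of_mem]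
    have h1 : a ⬝ᵥ (X ω - φ ((W ω, U ω, Y ω), V ω)) = 0 := by simpa using hω
    rw [dotProduct_sub, sub_eq_zero] at h1
    exact h1
  have hfi : Integrable (fun ω => f ((W ω, U ω, Y ω), X ω, V ω)) P :=
    (integrable_const _).congr hfae.symm
  have key := integral_le_condMutualInfo_add hXm hYm h.measurable_Y₁ hW hU hV
    g.continuous.measurable h.eq_comp h.markov hfm hfi (E := fun _ => 1) ?_ ?_
  · rwa [integral_congr_ae hfae, integral_const, probReal_univ, one_smul,
      ENNReal.ofReal_coe_nnreal] at key
  · filter_upwards [hL.condDistrib_eq hKY hXm hYm] with y hy w u v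
    have hfx : Measurable fun x => f ((w, u, y), x, v) := by fun_prop
    rw [hy, lintegral_gaussKernel hL.measurable _ _ (by fun_prop),
      ← lintegral_gaussDensity hKY (L *ᵥ y)]
    refine le_of_eq (lintegral_congr_ae ?_)
    have h0 : ∀ᵐ x : Vec n, a ⬝ᵥ x ≠ a ⬝ᵥ φ ((w, u, y), v) := by
      rw [ae_iff]
      simpa using volume_dotProduct_eq ha (a ⬝ᵥ φ ((w, u, y), v))
    filter_upwards [h0] with x hx
    have : f ((w, u, y), x, v) = 0 := Set.indicator_of_notMem (by simpa [hB] using hx) _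
    rw [this]
    simp
  · have := Measure.isProbabilityMeasure_map (μ := P) hYm.aemeasurable
    simp

end Singular

/-! ### Stability of centred Gaussian laws under linear maps and products. -/

section CenteredGaussian

variable {E F : Type*} [NormedAddCommGroup E] [NormedSpace ℝ E] [MeasurableSpace E] [BorelSpace E]
  [CompleteSpace E] [SecondCountableTopology E] [NormedAddCommGroup F] [NormedSpace ℝ F]
  [MeasurableSpace F] [BorelSpace F] [CompleteSpace F] [SecondCountableTopology F]

theorem IsCenteredGaussian.integral_clm {F : Type*} [NormedAddCommGroup F] [NormedSpace ℝ F]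
    [CompleteSpace F] {P : Measure E} (h : IsCenteredGaussian P) (L : E →L[ℝ] F) :
    ∫ x, L x ∂P = 0 := by
  have := h.1
  have hi : Integrable (fun x => x) P := IsGaussian.integrable_id
  rw [L.integral_comp_comm hi, h.2, map_zero]

theorem IsCenteredGaussian.map {P : Measure E} (h : IsCenteredGaussian P) (L : E →L[ℝ] F) :
    IsCenteredGaussian (P.map L) := by
  have := h.1
  refine ⟨isGaussian_map L, ?_⟩
  rw [integral_map (f := fun y => y) L.continuous.measurable.aemeasurable
    measurable_id.aestronglyMeasurable, h.integral_clm]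

theorem IsCenteredGaussian.hasGaussianLaw {P : Measure E} (h : IsCenteredGaussian P)
    (L : E →L[ℝ] F) : HasGaussianLaw (fun x => L x) P := ⟨(h.map L).1⟩

theorem IsCenteredGaussian.mean {P : Measure E} (h : IsCenteredGaussian P) {n : ℕ}
    (L : E →L[ℝ] Vec n) (i : Fin n) : ∫ x, L x i ∂P = 0 :=
  h.integral_clm ((ContinuousLinearMap.proj i).comp L)

theorem IsCenteredGaussian.prod {P : Measure E} {ν : Measure F} (hP : IsCenteredGaussian P)
    (hν : IsCenteredGaussian ν) : IsCenteredGaussian (P.prod ν) := by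
  have := hP.1
  have := hν.1
  have hi : Integrable (fun x : E × F => x) (P.prod ν) := IsGaussian.integrable_id
  refine ⟨inferInstance, Prod.ext ?_ ?_⟩
  · have h := (ContinuousLinearMap.fst ℝ E F).integral_comp_comm hi
    simp only [ContinuousLinearMap.coe_fst'] at h
    rw [← h, integral_fun_fst (μ := P) (ν := ν) (fun x => x), hP.2]
    simp
  · have h := (ContinuousLinearMap.snd ℝ E F).integral_comp_comm hi
    simp only [ContinuousLinearMap.coe_snd'] at h
    rw [← h, integral_fun_snd (μ := P) (ν := ν) (fun x => x), hν.2]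
    simp

theorem isCenteredGaussian_stdGauss (n : ℕ) : IsCenteredGaussian (stdGauss n) := by
  refine ⟨inferInstance, ?_⟩
  ext i
  have hi : Integrable (fun x => x) (stdGauss n) := IsGaussian.integrable_id
  have h := (ContinuousLinearMap.proj (R := ℝ) (φ := fun _ : Fin n => ℝ) i).integral_comp_comm hi
  simp only [ContinuousLinearMap.proj_apply] at h
  rw [← h, integral_stdGauss]
  rfl

end CenteredGaussian

/-! ### Independence on product spaces, and Markov chains built from noise. -/

section ProductIndependence

variable {Ω Ω' α β γ : Type*} [MeasurableSpace Ω] [MeasurableSpace Ω'] [MeasurableSpace α]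
  [MeasurableSpace β] [MeasurableSpace γ]

theorem indepFun_fst_snd (P : Measure α) [IsProbabilityMeasure P] (ν : Measure β)
    [IsProbabilityMeasure ν] : IndepFun Prod.fst Prod.snd (P.prod ν) := by
  rw [indepFun_iff_map_prod_eq_prod_map_map (by fun_prop) (by fun_prop),
    measurePreserving_fst.map_eq, measurePreserving_snd.map_eq]
  exact Measure.map_id

theorem indepFun_prod_prod (P : Measure α) [IsProbabilityMeasure P] (ν : Measure β)
    [IsProbabilityMeasure ν] (ν' : Measure γ) [IsProbabilityMeasure ν'] :
    IndepFun (fun z : α × β × γ => z.2.1) (fun z => (z.2.2, z.1)) (P.prod (ν.prod ν')) ∧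
      IndepFun (fun z : α × β × γ => z.2.2) (fun z => (z.2.1, z.1)) (P.prod (ν.prod ν')) := by
  have h1 : IndepFun (fun z : α × β × γ => z.2.1) (fun z => z.2.2) (P.prod (ν.prod ν')) := by
    refine IndepFun.of_map (φ := Prod.snd) measurable_snd measurable_fst measurable_snd ?_
    rw [measurePreserving_snd.map_eq]
    exact indepFun_fst_snd ν ν'
  have h2 : IndepFun (fun z : α × β × γ => (z.2.1, z.2.2)) (fun z => z.1) (P.prod (ν.prod ν')) :=
    (indepFun_fst_snd P (ν.prod ν')).symm
  refine ⟨indepFun_prod_right_of_prod_left (by fun_prop) (by fun_prop) (by fun_prop) h1 h2,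
    indepFun_prod_right_of_prod_left (by fun_prop) (by fun_prop) (by fun_prop) h1.symm ?_⟩
  exact h2.comp (φ := Prod.swap) (ψ := id) measurable_swap measurable_id

theorem IsStdNoise.of_map {P : Measure Ω} [IsProbabilityMeasure P] {φ : Ω → Ω'}
    (hφ : Measurable φ) {l : ℕ} {N : Ω' → Vec l} {C : Ω' → γ} (hC : Measurable C)
    (h : IsStdNoise (P.map φ) N C) : IsStdNoise P (fun ω => N (φ ω)) (fun ω => C (φ ω)) := by
  refine ⟨h.measurable.comp hφ, ?_, h.indep.of_map hφ h.measurable hC⟩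
  rw [← h.law, Measure.map_map h.measurable hφ]
  rfl

/-- A function of `B` and of noise independent of `(B, C)` forms a Markov chain with `B` and `C`. -/
theorem isMarkovChain_of_indepFun [StandardBorelSpace Ω] {P : Measure Ω} [IsProbabilityMeasure P]
    {ν : Type*} [MeasurableSpace ν] [StandardBorelSpace α] [Nonempty α] [StandardBorelSpace γ]
    [Nonempty γ] {A : Ω → α} {B : Ω → β} {C : Ω → γ} {N : Ω → ν} (hA : Measurable A)
    (hB : Measurable B) (hC : Measurable C) (hN : Measurable N) {Φ : β × ν → α} (hΦ : Measurable Φ)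
    (hAΦ : A =ᵐ[P] fun ω => Φ (B ω, N ω)) (hind : IndepFun (fun ω => (B ω, C ω)) N P) :
    IsMarkovChain P A B C := by
  refine ⟨hB, CondIndepFun.symm ?_⟩
  rw [condIndepFun_iff_condDistrib_prod_ae_eq_prodMkRight hA hC hB]
  have := Measure.isProbabilityMeasure_map (μ := P) hN.aemeasurable
  have := Measure.isProbabilityMeasure_map (μ := P) hB.aemeasurable
  have := Measure.isProbabilityMeasure_map (μ := P) (f := fun ω => (B ω, C ω)) (by fun_prop)
  set κ : Kernel β α := ((Kernel.id : Kernel β β) ×ₖ Kernel.const β (P.map N)).map Φ with hκ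
  have hκm : IsMarkovKernel κ := Kernel.IsMarkovKernel.map _ hΦ
  have hκi : ∀ (b : β) (F : α → ℝ≥0∞), Measurable F →
      ∫⁻ a, F a ∂κ b = ∫⁻ x, F (Φ (b, x)) ∂P.map N := by
    intro b F hF
    have hm : Measurable fun b => ∫⁻ x, F (Φ (b, x)) ∂P.map N :=
      Measurable.lintegral_prod_right' (f := fun z => F (Φ z)) (by fun_prop)
    rw [hκ, Kernel.lintegral_map _ hΦ _ hF, Kernel.lintegral_prod _ _ _ (by fun_prop),
      Kernel.id_apply]
    simp only [Kernel.const_apply]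
    rw [lintegral_dirac' _ hm]
  have h1 : P.map (fun ω => ((B ω, C ω), A ω)) =
      (P.map fun ω => (B ω, C ω)) ⊗ₘ κ.prodMkRight γ := by
    have e : P.map (fun ω => ((B ω, C ω), A ω)) =
        (P.map fun ω => ((B ω, C ω), N ω)).map (fun z => (z.1, Φ (z.1.1, z.2))) := by
      rw [Measure.map_map (by fun_prop) (by fun_prop)]
      refine Measure.map_congr ?_
      filter_upwards [hAΦ] with ω hω
      simp [hω]
    rw [e, (indepFun_iff_map_prod_eq_prod_map_map (by fun_prop) (by fun_prop)).mp hind]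
    refine Measure.ext_of_lintegral _ fun F hF => ?_
    rw [lintegral_map hF (by fun_prop), lintegral_prod _ (by fun_prop),
      Measure.lintegral_compProd hF]
    refine lintegral_congr fun z => ?_
    rw [Kernel.prodMkRight_apply, hκi _ _ (by fun_prop)]
  have h2 : P.map (fun ω => (B ω, A ω)) = P.map B ⊗ₘ κ := by
    have e : P.map (fun ω => (B ω, A ω)) =
        (P.map fun ω => ((B ω, C ω), A ω)).map (fun z => (z.1.1, z.2)) := by
      rw [Measure.map_map (by fun_prop) (by fun_prop)]; rfl
    have e2 : P.map B = (P.map fun ω => (B ω, C ω)).map Prod.fst := by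
      rw [Measure.map_map (by fun_prop) (by fun_prop)]; rfl
    rw [e, e2, h1]
    refine Measure.ext_of_lintegral _ fun F hF => ?_
    rw [lintegral_map hF (by fun_prop), Measure.lintegral_compProd (by fun_prop),
      Measure.lintegral_compProd hF,
      lintegral_map (Measurable.lintegral_kernel_prod_right' hF) (by fun_prop)]
    rfl
  have c1 := condDistrib_ae_eq_of_measure_eq_compProd _ hA.aemeasurable h1
  have c2 := condDistrib_ae_eq_of_measure_eq_compProd _ hA.aemeasurable h2
  have e2 : P.map B = (P.map fun ω => (B ω, C ω)).map Prod.fst := by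
    rw [Measure.map_map (by fun_prop) (by fun_prop)]; rfl
  rw [e2] at c2
  filter_upwards [c1, ae_of_ae_map (by fun_prop) c2] with z hz1 hz2
  rw [hz1, Kernel.prodMkRight_apply, Kernel.prodMkRight_apply, hz2]

end ProductIndependence

/-! ### Construction of the Gaussian auxiliaries. -/

section GaussianTest

open Matrix

variable {k k₁ k₂ m p q r : ℕ}

/-- `W = H₁ X + N₁`, `U = H₂ X + N₂`, `V = H₃ X + N₃` with independent standard Gaussian noise. -/
structure IsGaussianTest (P : Measure (SrcY k k₁ k₂ m)) (H₁ : Matrix (Fin p) (Fin k) ℝ)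
    (H₂ : Matrix (Fin q) (Fin k) ℝ) (H₃ : Matrix (Fin r) (Fin k) ℝ)
    (Q : Measure (Full k k₁ k₂ m p q r)) : Prop where
  map_fst : Q.map Prod.fst = P
  gaussian : IsCenteredGaussian Q
  noise_W : IsStdNoise Q (fun ω => cW ω - H₁ *ᵥ cX ω)
    (fun ω => (ω.1, cU ω - H₂ *ᵥ cX ω, cV ω - H₃ *ᵥ cX ω))
  noise_U : IsStdNoise Q (fun ω => cU ω - H₂ *ᵥ cX ω)
    (fun ω => (ω.1, cW ω - H₁ *ᵥ cX ω, cV ω - H₃ *ᵥ cX ω))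
  noise_V : IsStdNoise Q (fun ω => cV ω - H₃ *ᵥ cX ω)
    (fun ω => (ω.1, cW ω - H₁ *ᵥ cX ω, cU ω - H₂ *ᵥ cX ω))
  indep : IndepFun (fun ω => ω.1)
    (fun ω => (cW ω - H₁ *ᵥ cX ω, cU ω - H₂ *ᵥ cX ω, cV ω - H₃ *ᵥ cX ω)) Q

theorem exists_isGaussianTest (P : ProbabilityMeasure (SrcY k k₁ k₂ m))
    (hP : IsCenteredGaussian (P : Measure (SrcY k k₁ k₂ m))) (H₁ : Matrix (Fin p) (Fin k) ℝ)
    (H₂ : Matrix (Fin q) (Fin k) ℝ) (H₃ : Matrix (Fin r) (Fin k) ℝ) :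
    ∃ Q : ProbabilityMeasure (Full k k₁ k₂ m p q r),
      IsGaussianTest (P : Measure (SrcY k k₁ k₂ m)) H₁ H₂ H₃ (Q : Measure _) := by
  let R : Measure (SrcY k k₁ k₂ m × (Vec p × Vec q × Vec r)) :=
    (P : Measure (SrcY k k₁ k₂ m)).prod ((stdGauss p).prod ((stdGauss q).prod (stdGauss r)))
  have hR : IsProbabilityMeasure R := by infer_instance
  have hRG : IsCenteredGaussian R := hP.prod ((isCenteredGaussian_stdGauss p).prod
    ((isCenteredGaussian_stdGauss q).prod (isCenteredGaussian_stdGauss r)))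
  let π₁ := ContinuousLinearMap.fst ℝ (SrcY k k₁ k₂ m) (Vec p × Vec q × Vec r)
  let π₂ := ContinuousLinearMap.snd ℝ (SrcY k k₁ k₂ m) (Vec p × Vec q × Vec r)
  let X : (SrcY k k₁ k₂ m × (Vec p × Vec q × Vec r)) →L[ℝ] Vec k :=
    (ContinuousLinearMap.fst ℝ (Vec k) (Vec k₁ × Vec k₂)).comp
      ((ContinuousLinearMap.fst ℝ (Src k k₁ k₂) (Vec m)).comp π₁)
  -- `T` is a shear that adds `H₁X, H₂X, H₃X` to the three noises. Its inverse `S` recovers the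
  -- noises, so every independence statement is transported from the product law `R`.
  let T : (SrcY k k₁ k₂ m × (Vec p × Vec q × Vec r)) →L[ℝ] Full k k₁ k₂ m p q r :=
    π₁.prod (((mulVecCLM H₁).comp X + (ContinuousLinearMap.fst ℝ _ _).comp π₂).prod
      (((mulVecCLM H₂).comp X + (ContinuousLinearMap.fst ℝ _ _).comp
        ((ContinuousLinearMap.snd ℝ _ _).comp π₂)).prod
      ((mulVecCLM H₃).comp X + (ContinuousLinearMap.snd ℝ _ _).comp
        ((ContinuousLinearMap.snd ℝ _ _).comp π₂))))
  let S : Full k k₁ k₂ m p q r → SrcY k k₁ k₂ m × (Vec p × Vec q × Vec r) := fun ω =>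
    (ω.1, cW ω - H₁ *ᵥ cX ω, cU ω - H₂ *ᵥ cX ω, cV ω - H₃ *ᵥ cX ω)
  have hTm : Measurable T := T.continuous.measurable
  have hmv : ∀ {l : ℕ} (H : Matrix (Fin l) (Fin k) ℝ),
      Measurable fun ω : Full k k₁ k₂ m p q r => H *ᵥ cX ω := fun H =>
    (mulVecCLM H).continuous.measurable.comp (by unfold cX; fun_prop)
  have hSm : Measurable S := by
    refine measurable_fst.prodMk (Measurable.prodMk ?_ (Measurable.prodMk ?_ ?_))
    · exact Measurable.sub (by unfold cW; fun_prop) (hmv H₁)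
    · exact Measurable.sub (by unfold cU; fun_prop) (hmv H₂)
    · exact Measurable.sub (by unfold cV; fun_prop) (hmv H₃)
  have hST : ∀ z, S (T z) = z := by
    intro z
    refine Prod.ext rfl (Prod.ext ?_ (Prod.ext ?_ ?_))
    · exact add_sub_cancel_left _ _
    · exact add_sub_cancel_left _ _
    · exact add_sub_cancel_left _ _
  have hQ : IsProbabilityMeasure (R.map T) := Measure.isProbabilityMeasure_map hTm.aemeasurable
  have hQS : (R.map T).map S = R := by
    rw [Measure.map_map hSm hTm, show S ∘ T = id from funext hST, Measure.map_id]
  obtain ⟨iW, iUV⟩ := indepFun_prod_prod (P : Measure (SrcY k k₁ k₂ m)) (stdGauss p)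
    ((stdGauss q).prod (stdGauss r))
  have iUV' : IndepFun (fun z : SrcY k k₁ k₂ m × (Vec p × Vec q × Vec r) => z.2.2.1)
      (fun z => z.2.2.2) R := by
    refine IndepFun.of_map (φ := fun z : SrcY k k₁ k₂ m × (Vec p × Vec q × Vec r) => z.2.2)
      (by fun_prop) measurable_fst measurable_snd ?_
    have : R.map (fun z => z.2.2) = (stdGauss q).prod (stdGauss r) :=
      ((measurePreserving_snd (μ := stdGauss p)).comp (measurePreserving_snd
        (μ := (P : Measure (SrcY k k₁ k₂ m))))).map_eq
    rw [this]
    exact indepFun_fst_snd _ _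
  have iU := indepFun_prod_right_of_prod_left (by fun_prop) (by fun_prop) (by fun_prop) iUV' iUV
  have iV := indepFun_prod_right_of_prod_left (A := fun z : SrcY k k₁ k₂ m ×
    (Vec p × Vec q × Vec r) => z.2.2.2) (B := fun z => z.2.2.1) (C := fun z => (z.2.1, z.1))
    (P := R) (by fun_prop) (by fun_prop) (by fun_prop) iUV'.symm
    (iUV.comp (φ := Prod.swap) (ψ := id) measurable_swap measurable_id)
  have mW : R.map (fun z => z.2.1) = stdGauss p :=
    (measurePreserving_fst.comp (measurePreserving_snd
      (μ := (P : Measure (SrcY k k₁ k₂ m))))).map_eq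
  have mU : R.map (fun z => z.2.2.1) = stdGauss q :=
    (measurePreserving_fst.comp (measurePreserving_snd.comp (measurePreserving_snd
      (μ := (P : Measure (SrcY k k₁ k₂ m)))))).map_eq
  have mV : R.map (fun z => z.2.2.2) = stdGauss r :=
    (measurePreserving_snd.comp (measurePreserving_snd.comp (measurePreserving_snd
      (μ := (P : Measure (SrcY k k₁ k₂ m)))))).map_eq
  have nW : IsStdNoise R (fun z => z.2.1) (fun z => (z.1, z.2.2.1, z.2.2.2)) :=
    ⟨by fun_prop, mW, iW.comp (φ := id) (ψ := Prod.swap) measurable_id measurable_swap⟩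
  have nU : IsStdNoise R (fun z => z.2.2.1) (fun z => (z.1, z.2.1, z.2.2.2)) :=
    ⟨by fun_prop, mU, iU.comp (φ := id)
      (ψ := fun z : Vec r × (Vec p × SrcY k k₁ k₂ m) => (z.2.2, z.2.1, z.1)) measurable_id
      (by fun_prop)⟩
  have nV : IsStdNoise R (fun z => z.2.2.2) (fun z => (z.1, z.2.1, z.2.2.1)) :=
    ⟨by fun_prop, mV, iV.comp (φ := id)
      (ψ := fun z : Vec q × (Vec p × SrcY k k₁ k₂ m) => (z.2.2, z.2.1, z.1)) measurable_id
      (by fun_prop)⟩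
  have hind := indepFun_fst_snd (P : Measure (SrcY k k₁ k₂ m))
    ((stdGauss p).prod ((stdGauss q).prod (stdGauss r)))
  refine ⟨⟨R.map T, hQ⟩, ?_, hRG.map T, ?_, ?_, ?_, ?_⟩
  · change (R.map T).map Prod.fst = _
    rw [Measure.map_map measurable_fst hTm]
    exact measurePreserving_fst.map_eq
  · exact IsStdNoise.of_map (P := R.map T) hSm (C := fun z : SrcY k k₁ k₂ m × (Vec p × Vec q × Vec r) =>
      (z.1, z.2.2.1, z.2.2.2)) (N := fun z => z.2.1) (by fun_prop) (by rw [hQS]; exact nW)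
  · exact IsStdNoise.of_map (P := R.map T) hSm (C := fun z : SrcY k k₁ k₂ m × (Vec p × Vec q × Vec r) =>
      (z.1, z.2.1, z.2.2.2)) (N := fun z => z.2.2.1) (by fun_prop) (by rw [hQS]; exact nU)
  · exact IsStdNoise.of_map (P := R.map T) hSm (C := fun z : SrcY k k₁ k₂ m × (Vec p × Vec q × Vec r) =>
      (z.1, z.2.1, z.2.2.1)) (N := fun z => z.2.2.2) (by fun_prop) (by rw [hQS]; exact nV)
  · exact IndepFun.of_map (P := R.map T) hSm measurable_fst measurable_snd
      (by rw [hQS]; exact hind)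

end GaussianTest

/-! ### Regressions of the coordinate `X` on each of the side informations. -/

section Coordinates

open Matrix

variable {k k₁ k₂ m p q r : ℕ}

@[fun_prop]
theorem measurable_cX : Measurable (cX : Full k k₁ k₂ m p q r → _) := by unfold cX; fun_prop

@[fun_prop]
theorem measurable_cY₁ : Measurable (cY₁ : Full k k₁ k₂ m p q r → _) := by unfold cY₁; fun_prop

@[fun_prop]
theorem measurable_cY₂ : Measurable (cY₂ : Full k k₁ k₂ m p q r → _) := by unfold cY₂; fun_prop

@[fun_prop]
theorem measurable_cY : Measurable (cY : Full k k₁ k₂ m p q r → _) := by unfold cY; fun_prop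

@[fun_prop]
theorem measurable_cW : Measurable (cW : Full k k₁ k₂ m p q r → _) := by unfold cW; fun_prop

@[fun_prop]
theorem measurable_cU : Measurable (cU : Full k k₁ k₂ m p q r → _) := by unfold cU; fun_prop

@[fun_prop]
theorem measurable_cV : Measurable (cV : Full k k₁ k₂ m p q r → _) := by unfold cV; fun_prop

theorem measurable_mulVec {n l : ℕ} (H : Matrix (Fin l) (Fin n) ℝ) :
    Measurable fun x : Vec n => H *ᵥ x := (mulVecCLM H).continuous.measurable

/-- Gaussian regression for linear functions of a Gaussian vector, on an extension of its space. -/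
theorem IsCenteredGaussian.exists_gaussianResidual {Ω E : Type*} [MeasurableSpace Ω]
    {P : Measure Ω} [IsProbabilityMeasure P] [NormedAddCommGroup E] [NormedSpace ℝ E]
    [MeasurableSpace E] [BorelSpace E] [CompleteSpace E] [SecondCountableTopology E]
    {φ : Ω → E} (hφ : Measurable φ) (h : IsCenteredGaussian (P.map φ)) {n l : ℕ}
    (X : E →L[ℝ] Vec n) (C : E →L[ℝ] Vec l) :
    ∃ M, GaussianResidual P (fun ω => X (φ ω)) (fun ω => C (φ ω)) M
      (condCov (P.map φ) (fun x => X x) (fun x => C x)) := by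
  have := Measure.isProbabilityMeasure_map (μ := P) hφ.aemeasurable
  obtain ⟨L, hL⟩ := VecGaussianRD.exists_gaussianResidual (P := P.map φ) (X := fun x => X x)
    (C := fun x => C x) X.continuous.measurable C.continuous.measurable
    (h.hasGaussianLaw (X.prod C)) (h.mean X) (h.mean C)
  exact ⟨_, hL.of_map hφ X.continuous.measurable C.continuous.measurable⟩

variable {μ : ProbabilityMeasure (Src k k₁ k₂)} {P : ProbabilityMeasure (SrcY k k₁ k₂ m)}
  {Q : ProbabilityMeasure (Full k k₁ k₂ m p q r)}

/-- The coordinate `X` of `Src`. -/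
noncomputable def srcX (k k₁ k₂ : ℕ) : Src k k₁ k₂ →L[ℝ] Vec k := ContinuousLinearMap.fst ℝ _ _

/-- The coordinate `Y₁` of `Src`. -/
noncomputable def srcY₁ (k k₁ k₂ : ℕ) : Src k k₁ k₂ →L[ℝ] Vec k₁ :=
  (ContinuousLinearMap.fst ℝ _ _).comp (ContinuousLinearMap.snd ℝ _ _)

/-- The coordinate `Y₂` of `Src`. -/
noncomputable def srcY₂ (k k₁ k₂ : ℕ) : Src k k₁ k₂ →L[ℝ] Vec k₂ :=
  (ContinuousLinearMap.snd ℝ _ _).comp (ContinuousLinearMap.snd ℝ _ _)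

theorem isCenteredGaussian_of_mem_SG (hP : P ∈ SG μ m) :
    IsCenteredGaussian (μ : Measure (Src k k₁ k₂)) := by
  rw [← hP.1]
  exact hP.2.1.map (ContinuousLinearMap.fst ℝ (Src k k₁ k₂) (Vec m))

theorem map_fst_fst (hP : P ∈ SG μ m)
    (hQ : (Q : Measure (Full k k₁ k₂ m p q r)).map Prod.fst = (P : Measure (SrcY k k₁ k₂ m))) :
    (Q : Measure (Full k k₁ k₂ m p q r)).map (fun ω => ω.1.1) = (μ : Measure (Src k k₁ k₂)) := by
  rw [← hP.1, ← hQ, Measure.map_map measurable_fst measurable_fst]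
  rfl

/-- The regression is made under the marginal `μ` and pulled back to `Q`, so its covariance does not
depend on the auxiliaries. -/
theorem exists_gaussianResidual_Y₁ (hP : P ∈ SG μ m)
    (hQ : (Q : Measure (Full k k₁ k₂ m p q r)).map Prod.fst = (P : Measure (SrcY k k₁ k₂ m))) :
    ∃ M, GaussianResidual (Q : Measure (Full k k₁ k₂ m p q r)) cX cY₁ M
      (covXgivenY₁ (μ : Measure (Src k k₁ k₂))) := by
  have h := isCenteredGaussian_of_mem_SG hP
  rw [← map_fst_fst hP hQ] at h ⊢
  exact h.exists_gaussianResidual (by fun_prop) (srcX k k₁ k₂) (srcY₁ k k₁ k₂)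

theorem exists_gaussianResidual_Y₂ (hP : P ∈ SG μ m)
    (hQ : (Q : Measure (Full k k₁ k₂ m p q r)).map Prod.fst = (P : Measure (SrcY k k₁ k₂ m))) :
    ∃ M, GaussianResidual (Q : Measure (Full k k₁ k₂ m p q r)) cX cY₂ M
      (covXgivenY₂ (μ : Measure (Src k k₁ k₂))) := by
  have h := isCenteredGaussian_of_mem_SG hP
  rw [← map_fst_fst hP hQ] at h ⊢
  exact h.exists_gaussianResidual (by fun_prop) (srcX k k₁ k₂) (srcY₂ k k₁ k₂)

theorem exists_gaussianResidual_Y (hP : P ∈ SG μ m)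
    (hQ : (Q : Measure (Full k k₁ k₂ m p q r)).map Prod.fst = (P : Measure (SrcY k k₁ k₂ m))) :
    ∃ M, GaussianResidual (Q : Measure (Full k k₁ k₂ m p q r)) cX cY M
      (covXgivenY (P : Measure (SrcY k k₁ k₂ m))) := by
  have h := hP.2.1
  rw [← hQ] at h ⊢
  exact h.exists_gaussianResidual (by fun_prop)
    ((srcX k k₁ k₂).comp (ContinuousLinearMap.fst ℝ _ (Vec m))) (ContinuousLinearMap.snd ℝ _ _)

theorem sqIntegrable_cX (hP : P ∈ SG μ m)
    (hQ : (Q : Measure (Full k k₁ k₂ m p q r)).map Prod.fst = (P : Measure (SrcY k k₁ k₂ m))) :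
    SqIntegrable (Q : Measure (Full k k₁ k₂ m p q r)) cX := by
  have h := (isCenteredGaussian_of_mem_SG hP).hasGaussianLaw (srcX k k₁ k₂)
  rw [← map_fst_fst hP hQ] at h
  exact (HasGaussianLaw.of_map (by fun_prop) (srcX k k₁ k₂).continuous.measurable h).sqIntegrable

theorem GaussianResidual.observe_of_noise {Ω γ : Type*} [MeasurableSpace Ω] [MeasurableSpace γ]
    {P : Measure Ω} [IsProbabilityMeasure P] {n l : ℕ} {X : Ω → Vec n} {C : Ω → γ} {M : γ → Vec n}
    {K : Matrix (Fin n) (Fin n) ℝ} (h : GaussianResidual P X C M K) (hX : Measurable X)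
    (hC : Measurable C) {V : Ω → Vec l} {H : Matrix (Fin l) (Fin n) ℝ}
    (hN : IsStdNoise P (fun ω => V ω - H *ᵥ X ω) (fun ω => (X ω, C ω))) :
    (∃ M', GaussianResidual P X (fun ω => (V ω, C ω)) M' (posteriorCov K H)) ∧
      condMutualInfo P X V C = ENNReal.ofReal (Real.log (1 + H * K * Hᵀ).det / 2) := by
  have h1 := h.observe hX hC hN H
  have h2 := h.condMutualInfo_observation hX hC hN H
  simp only [add_sub_cancel] at h1 h2
  exact ⟨h1, h2⟩

/-- An empty observation carries no information; this covers the auxiliary of size zero in the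
Gaussian test. -/
theorem posteriorCov_of_zero_rows {n : ℕ} (K : Matrix (Fin n) (Fin n) ℝ)
    (H : Matrix (Fin 0) (Fin n) ℝ) : posteriorCov K H = K := by
  have : K * Hᵀ * (1 + H * K * Hᵀ)⁻¹ * H = 0 := by
    ext i j
    simp [Matrix.mul_apply]
  rw [posteriorCov, this, Matrix.zero_mul, sub_zero]

end Coordinates

/-! ### Error covariances and rates of the Gaussian test. -/

section TestCovariances

open Matrix

variable {k k₁ k₂ m p q r : ℕ} {μ : ProbabilityMeasure (Src k k₁ k₂)}
  {P : ProbabilityMeasure (SrcY k k₁ k₂ m)} {Q : ProbabilityMeasure (Full k k₁ k₂ m p q r)}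
  {H₁ : Matrix (Fin p) (Fin k) ℝ} {H₂ : Matrix (Fin q) (Fin k) ℝ} {H₃ : Matrix (Fin r) (Fin k) ℝ}

theorem IsGaussianTest.isAuxiliary
    (h : IsGaussianTest (P : Measure (SrcY k k₁ k₂ m)) H₁ H₂ H₃ (Q : Measure _)) :
    IsAuxiliary P Q := by
  refine ⟨h.map_fst, ?_⟩
  have h1 := measurable_mulVec H₁
  have h2 := measurable_mulVec H₂
  have h3 := measurable_mulVec H₃
  refine isMarkovChain_of_indepFun (N := fun ω => (cW ω - H₁ *ᵥ cX ω, cU ω - H₂ *ᵥ cX ω,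
      cV ω - H₃ *ᵥ cX ω)) (Φ := fun z => (H₁ *ᵥ z.1 + z.2.1, H₂ *ᵥ z.1 + z.2.2.1,
      H₃ *ᵥ z.1 + z.2.2.2)) (by fun_prop) (by fun_prop) (by fun_prop) (by fun_prop) (by fun_prop)
      (.of_forall fun ω => ?_) ?_
  · simp
  · exact h.indep.comp (φ := fun z : SrcY k k₁ k₂ m => (z.1.1, z.1.2.1, z.1.2.2, z.2)) (ψ := id)
      (by fun_prop) measurable_id

/-- `U` and `V` are functions of the source and of their own noises, all of which are independent of
the noise in `W`. -/
theorem IsGaussianTest.noise_W_of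
    (h : IsGaussianTest (P : Measure (SrcY k k₁ k₂ m)) H₁ H₂ H₃ (Q : Measure _)) {γ : Type*}
    [MeasurableSpace γ] {f : SrcY k k₁ k₂ m × Vec q × Vec r → γ} (hf : Measurable f) :
    IsStdNoise (Q : Measure (Full k k₁ k₂ m p q r)) (fun ω => cW ω - H₁ *ᵥ cX ω)
      (fun ω => (cX ω, f (ω.1, cU ω, cV ω))) := by
  have h2 := measurable_mulVec H₂
  have h3 := measurable_mulVec H₃
  have := h.noise_W.comp (f := fun z => (z.1.1.1,
    f (z.1, H₂ *ᵥ z.1.1.1 + z.2.1, H₃ *ᵥ z.1.1.1 + z.2.2))) (by fun_prop)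
  simpa [cX] using this

theorem IsGaussianTest.noise_U_of
    (h : IsGaussianTest (P : Measure (SrcY k k₁ k₂ m)) H₁ H₂ H₃ (Q : Measure _)) {γ : Type*}
    [MeasurableSpace γ] {f : SrcY k k₁ k₂ m × Vec p × Vec r → γ} (hf : Measurable f) :
    IsStdNoise (Q : Measure (Full k k₁ k₂ m p q r)) (fun ω => cU ω - H₂ *ᵥ cX ω)
      (fun ω => (cX ω, f (ω.1, cW ω, cV ω))) := by
  have h1 := measurable_mulVec H₁
  have h3 := measurable_mulVec H₃
  have := h.noise_U.comp (f := fun z => (z.1.1.1,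
    f (z.1, H₁ *ᵥ z.1.1.1 + z.2.1, H₃ *ᵥ z.1.1.1 + z.2.2))) (by fun_prop)
  simpa [cX] using this

theorem IsGaussianTest.noise_V_of
    (h : IsGaussianTest (P : Measure (SrcY k k₁ k₂ m)) H₁ H₂ H₃ (Q : Measure _)) {γ : Type*}
    [MeasurableSpace γ] {f : SrcY k k₁ k₂ m × Vec p × Vec q → γ} (hf : Measurable f) :
    IsStdNoise (Q : Measure (Full k k₁ k₂ m p q r)) (fun ω => cV ω - H₃ *ᵥ cX ω)
      (fun ω => (cX ω, f (ω.1, cW ω, cU ω))) := by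
  have h1 := measurable_mulVec H₁
  have h2 := measurable_mulVec H₂
  have := h.noise_V.comp (f := fun z => (z.1.1.1,
    f (z.1, H₁ *ᵥ z.1.1.1 + z.2.1, H₂ *ᵥ z.1.1.1 + z.2.2))) (by fun_prop)
  simpa [cX] using this

theorem IsGaussianTest.covXgivenWUY₁_eq (hP : P ∈ SG μ m)
    (h : IsGaussianTest (P : Measure (SrcY k k₁ k₂ m)) H₁ H₂ H₃ (Q : Measure _)) :
    covXgivenWUY₁ Q = posteriorCov (posteriorCov (covXgivenY₁ (μ : Measure (Src k k₁ k₂))) H₂) H₁ ∧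
      condMutualInfo (Q : Measure (Full k k₁ k₂ m p q r)) cX cW cY₁ = ENNReal.ofReal
        (Real.log (1 + H₁ * covXgivenY₁ (μ : Measure (Src k k₁ k₂)) * H₁ᵀ).det / 2) := by
  obtain ⟨M, hM⟩ := exists_gaussianResidual_Y₁ hP h.map_fst
  obtain ⟨⟨M₂, hM₂⟩, -⟩ := hM.observe_of_noise measurable_cX measurable_cY₁
    (h.noise_U_of (f := fun z => z.1.1.2.1) (by fun_prop))
  obtain ⟨⟨M₃, hM₃⟩, -⟩ := hM₂.observe_of_noise measurable_cX (by fun_prop)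
    (h.noise_W_of (f := fun z => (z.2.1, z.1.1.2.1)) (by fun_prop))
  refine ⟨hM₃.condCov_eq measurable_cX (sqIntegrable_cX hP h.map_fst) (by fun_prop), ?_⟩
  exact (hM.observe_of_noise measurable_cX measurable_cY₁
    (h.noise_W_of (f := fun z => z.1.1.2.1) (by fun_prop))).2

theorem IsGaussianTest.covXgivenWVY₂_eq (hP : P ∈ SG μ m)
    (h : IsGaussianTest (P : Measure (SrcY k k₁ k₂ m)) H₁ H₂ H₃ (Q : Measure _)) :
    covXgivenWVY₂ Q = posteriorCov (posteriorCov (covXgivenY₂ (μ : Measure (Src k k₁ k₂))) H₃) H₁ ∧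
      condMutualInfo (Q : Measure (Full k k₁ k₂ m p q r)) cX cW cY₂ = ENNReal.ofReal
        (Real.log (1 + H₁ * covXgivenY₂ (μ : Measure (Src k k₁ k₂)) * H₁ᵀ).det / 2) := by
  obtain ⟨M, hM⟩ := exists_gaussianResidual_Y₂ hP h.map_fst
  obtain ⟨⟨M₂, hM₂⟩, -⟩ := hM.observe_of_noise measurable_cX measurable_cY₂
    (h.noise_V_of (f := fun z => z.1.1.2.2) (by fun_prop))
  obtain ⟨⟨M₃, hM₃⟩, -⟩ := hM₂.observe_of_noise measurable_cX (by fun_prop)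
    (h.noise_W_of (f := fun z => (z.2.2, z.1.1.2.2)) (by fun_prop))
  refine ⟨hM₃.condCov_eq measurable_cX (sqIntegrable_cX hP h.map_fst) (by fun_prop), ?_⟩
  exact (hM.observe_of_noise measurable_cX measurable_cY₂
    (h.noise_W_of (f := fun z => z.1.1.2.2) (by fun_prop))).2

/-- Observations can be absorbed one at a time in any order. Separate chains are followed so that
for each rate the vector whose information is computed comes last. -/
theorem IsGaussianTest.covXgivenWUVY_eq (hP : P ∈ SG μ m)
    (h : IsGaussianTest (P : Measure (SrcY k k₁ k₂ m)) H₁ H₂ H₃ (Q : Measure _)) :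
    covXgivenWUVY Q = posteriorCov (posteriorCov (posteriorCov
        (covXgivenY (P : Measure (SrcY k k₁ k₂ m))) H₃) H₂) H₁ ∧
      condMutualInfo (Q : Measure (Full k k₁ k₂ m p q r)) cX cV (fun ω => (cW ω, cU ω, cY ω)) =
        ENNReal.ofReal (Real.log (1 + H₃ * posteriorCov (posteriorCov
          (covXgivenY (P : Measure (SrcY k k₁ k₂ m))) H₂) H₁ * H₃ᵀ).det / 2) ∧
      condMutualInfo (Q : Measure (Full k k₁ k₂ m p q r)) cX cU (fun ω => (cW ω, cV ω, cY ω)) =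
        ENNReal.ofReal (Real.log (1 + H₂ * posteriorCov (posteriorCov
          (covXgivenY (P : Measure (SrcY k k₁ k₂ m))) H₃) H₁ * H₂ᵀ).det / 2) := by
  obtain ⟨M, hM⟩ := exists_gaussianResidual_Y hP h.map_fst
  obtain ⟨⟨MV, hMV⟩, -⟩ := hM.observe_of_noise measurable_cX measurable_cY
    (h.noise_V_of (f := fun z => z.1.2) (by fun_prop))
  obtain ⟨⟨MU, hMU⟩, -⟩ := hM.observe_of_noise measurable_cX measurable_cY
    (h.noise_U_of (f := fun z => z.1.2) (by fun_prop))
  obtain ⟨⟨MUV, hMUV⟩, -⟩ := hMV.observe_of_noise measurable_cX (by fun_prop)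
    (h.noise_U_of (f := fun z => (z.2.2, z.1.2)) (by fun_prop))
  obtain ⟨⟨MWUV, hMWUV⟩, -⟩ := hMUV.observe_of_noise measurable_cX (by fun_prop)
    (h.noise_W_of (f := fun z => (z.2.1, z.2.2, z.1.2)) (by fun_prop))
  obtain ⟨⟨MWU, hMWU⟩, -⟩ := hMU.observe_of_noise measurable_cX (by fun_prop)
    (h.noise_W_of (f := fun z => (z.2.1, z.1.2)) (by fun_prop))
  obtain ⟨⟨MWV, hMWV⟩, -⟩ := hMV.observe_of_noise measurable_cX (by fun_prop)
    (h.noise_W_of (f := fun z => (z.2.2, z.1.2)) (by fun_prop))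
  refine ⟨hMWUV.condCov_eq measurable_cX (sqIntegrable_cX hP h.map_fst) (by fun_prop), ?_, ?_⟩
  · exact (hMWU.observe_of_noise measurable_cX (by fun_prop)
      (h.noise_V_of (f := fun z => (z.2.1, z.2.2, z.1.2)) (by fun_prop))).2
  · exact (hMWV.observe_of_noise measurable_cX (by fun_prop)
      (h.noise_U_of (f := fun z => (z.2.1, z.2.2, z.1.2)) (by fun_prop))).2

end TestCovariances

/-! ### Matrix inequalities linking constraints and rates. -/

section MatrixBounds

open Matrix

variable {n l₁ l₂ : ℕ}

theorem _root_.Matrix.PosDef.inv_inv {K : Matrix (Fin n) (Fin n) ℝ} (hK : K.PosDef) :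
    K⁻¹⁻¹ = K := nonsing_inv_nonsing_inv _ ((isUnit_iff_isUnit_det _).mp hK.isUnit)

/-- The fusion inequality solved for `L`: this is how an ordinary distortion constraint yields an
enhanced one. -/
theorem LoewnerLE.inv_sub_inv {K L E : Matrix (Fin n) (Fin n) ℝ} (hK : K.PosDef) (hL : L.PosDef)
    (hLE : (L⁻¹ + E).PosDef) (h : LoewnerLE K (L⁻¹ + E)⁻¹) :
    (K⁻¹ - E)⁻¹.PosDef ∧ LoewnerLE (K⁻¹ - E)⁻¹ L := by
  have h1 := LoewnerLE.inv hK h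
  rw [hLE.inv_inv] at h1
  have h2 : LoewnerLE L⁻¹ (K⁻¹ - E) := by
    rw [LoewnerLE, show K⁻¹ - E - L⁻¹ = K⁻¹ - (L⁻¹ + E) by abel]
    exact h1
  refine ⟨(hL.inv.of_loewnerLE h2).inv, ?_⟩
  have h3 := LoewnerLE.inv hL.inv h2
  rwa [hL.inv_inv] at h3

theorem log_det_one_add {K L : Matrix (Fin n) (Fin n) ℝ} (hK : K.PosDef) (hL : L.PosDef)
    {H : Matrix (Fin l₁) (Fin n) ℝ} (hH : Hᵀ * H = L⁻¹ - K⁻¹) :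
    Real.log (1 + H * K * Hᵀ).det = Real.log K.det - Real.log L.det := by
  rw [det_one_add_mul_mul_transpose hK, hH, add_sub_cancel, det_nonsing_inv,
    Ring.inverse_eq_inv', Real.log_mul hK.det_pos.ne' (inv_ne_zero hL.det_pos.ne'), Real.log_inv,
    sub_eq_add_neg]

theorem log_det_one_add_nonneg {K : Matrix (Fin n) (Fin n) ℝ} (hK : K.PosSemidef)
    (H : Matrix (Fin l₁) (Fin n) ℝ) : 0 ≤ Real.log (1 + H * K * Hᵀ).det :=
  Real.log_nonneg (one_le_det_one_add (hK.mul_mul_transpose_same H))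

/-- The rate of the two-stage Gaussian test. -/
theorem ofReal_log_det_add_le {K₁' K₁ KY KG Kc KP : Matrix (Fin n) (Fin n) ℝ} (hK₁' : K₁'.PosDef)
    (hK₁ : K₁.PosDef) (hKY : KY.PosDef) (hKG : KG.PosDef) (hKc : Kc.PosDef) (hKP : KP.PosSemidef)
    (hle : LoewnerLE KP KY) (hJ : KG⁻¹ = K₁⁻¹ + (KY⁻¹ - K₁'⁻¹)) {H₁ : Matrix (Fin l₁) (Fin n) ℝ}
    {H₃ : Matrix (Fin l₂) (Fin n) ℝ} (hH₁ : H₁ᵀ * H₁ = K₁⁻¹ - K₁'⁻¹)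
    (hH₃ : H₃ᵀ * H₃ = Kc⁻¹ - KG⁻¹) :
    ENNReal.ofReal (Real.log (1 + H₁ * K₁' * H₁ᵀ).det / 2) +
        ENNReal.ofReal (Real.log (1 + H₃ * posteriorCov KP H₁ * H₃ᵀ).det / 2) ≤
      ENNReal.ofReal
        ((Real.log K₁'.det + Real.log KG.det - Real.log Kc.det - Real.log K₁.det) / 2) := by
  have hPKG : posteriorCov KY H₁ = KG := by
    rw [posteriorCov_eq_inv hKY, hH₁,
      show KY⁻¹ + (K₁⁻¹ - K₁'⁻¹) = KG⁻¹ by rw [hJ]; abel, hKG.inv_inv]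
  have hPP := posSemidef_posteriorCov hKP H₁
  -- The first stage would leave `KG` from the prior `KY`; from the smaller, possibly singular,
  -- prior `KP` it leaves no more, so the second stage costs no more.
  have h1 := LoewnerLE.posteriorCov hKP hKY.posSemidef hle H₁
  rw [hPKG] at h1
  have h2 := det_one_add_mul_mul_transpose_mono hPP h1 H₃
  have h3 : Real.log (1 + H₃ * posteriorCov KP H₁ * H₃ᵀ).det ≤
      Real.log (1 + H₃ * KG * H₃ᵀ).det :=
    Real.log_le_log (posDef_one_add_mul_mul_transpose hPP H₃).det_pos h2
  rw [← ENNReal.ofReal_add (by have := log_det_one_add_nonneg hK₁'.posSemidef H₁; positivity)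
    (by have := log_det_one_add_nonneg hPP H₃; positivity)]
  refine ENNReal.ofReal_le_ofReal ?_
  rw [log_det_one_add hKG hKc hH₃] at h3
  rw [log_det_one_add hK₁' hK₁ hH₁]
  linarith

theorem posteriorCov_posteriorCov {K : Matrix (Fin n) (Fin n) ℝ} (hK : K.PosDef)
    (H : Matrix (Fin l₁) (Fin n) ℝ) (H' : Matrix (Fin l₂) (Fin n) ℝ) :
    posteriorCov (posteriorCov K H) H' = (K⁻¹ + (Hᵀ * H + H'ᵀ * H'))⁻¹ ∧
      (K⁻¹ + (Hᵀ * H + H'ᵀ * H')).PosDef := by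
  have h1 : (K⁻¹ + Hᵀ * H).PosDef := hK.inv.add_posSemidef (posSemidef_transpose_mul_self H)
  have h2 : (K⁻¹ + (Hᵀ * H + H'ᵀ * H')).PosDef := by
    rw [← add_assoc]
    exact h1.add_posSemidef (posSemidef_transpose_mul_self H')
  refine ⟨?_, h2⟩
  rw [posteriorCov_eq_inv hK, posteriorCov_eq_inv h1.inv, h1.inv_inv, add_assoc]

end MatrixBounds

/-! ### The covariance inequalities behind the Gaussian test. -/

section Summary

open Matrix

variable {Ω γ δ ε : Type*} [MeasurableSpace Ω] [MeasurableSpace γ] [MeasurableSpace δ]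
  [MeasurableSpace ε] {P : Measure Ω} {n m k₁ : ℕ} [StandardBorelSpace Ω] [StandardBorelSpace γ]
  [Nonempty γ] [StandardBorelSpace δ] [Nonempty δ]
  [IsProbabilityMeasure P]

/-- Every covariance here dominates `Kc`, so invertibility of `Kc` propagates. The inequalities say
that the differences of precisions required of the test are positive semidefinite. -/
theorem SideInformation.loewnerLE {X : Ω → Vec n} {Y : Ω → Vec m}
    {Y₁ : Ω → Vec k₁} {g : Vec m →L[ℝ] Vec k₁} {W : Ω → γ} {U : Ω → δ} {V : Ω → ε}
    (h : SideInformation P X Y Y₁ g (fun ω => (W ω, U ω))) (hW : Measurable W) (hU : Measurable U)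
    (hV : Measurable V) {KY K₁' K₁ Kc : Matrix (Fin n) (Fin n) ℝ} (hKYe : condCov P X Y = KY)
    (hK₁'e : condCov P X Y₁ = K₁') (hK₁e : (condCov P X fun ω => ((W ω, U ω), Y₁ ω)) = K₁)
    (hKce : (condCov P X fun ω => ((W ω, U ω, Y ω), V ω)) = Kc)
    (hKY : KY.PosDef) (hK₁' : K₁'.PosDef) (hKc : Kc.PosDef) :
    K₁.PosDef ∧ LoewnerLE K₁ K₁' ∧ (K₁⁻¹ + (KY⁻¹ - K₁'⁻¹)).PosDef ∧
      LoewnerLE Kc (K₁⁻¹ + (KY⁻¹ - K₁'⁻¹))⁻¹ := by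
  have hY := h.measurable_Y
  have hY₁ := h.measurable_Y₁
  have hgm : Measurable g := g.continuous.measurable
  have hX := h.hasGaussianLaw.fst.sqIntegrable
  subst hKYe hK₁'e hK₁e hKce
  have hae : (fun ω => ((W ω, U ω), Y₁ ω)) =ᵐ[P] fun ω => ((W ω, U ω), g (Y ω)) := by
    filter_upwards [h.eq_comp] with ω hω
    rw [hω]
  have hle₁ : LoewnerLE (condCov P X fun ω => ((W ω, U ω, Y ω), V ω))
      (condCov P X fun ω => ((W ω, U ω), Y₁ ω)) := by
    rw [condCov_congr hX (Z := fun ω => ((W ω, U ω), Y₁ ω)) (by fun_prop) (by fun_prop) hae]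
    exact condCov_comp_loewnerLE (Z := fun ω => ((W ω, U ω, Y ω), V ω)) hX (by fun_prop)
      (ρ := fun z => ((z.1.1, z.1.2.1), g z.1.2.2)) (by fun_prop)
  have hle₂ : LoewnerLE (condCov P X fun ω => ((W ω, U ω), Y₁ ω)) (condCov P X Y₁) :=
    condCov_comp_loewnerLE (Z := fun ω => ((W ω, U ω), Y₁ ω)) hX (by fun_prop) (ρ := Prod.snd)
      measurable_snd
  have hle₃ : LoewnerLE (condCov P X fun ω => ((W ω, U ω, Y ω), V ω))
      (condCov P X fun ω => ((W ω, U ω), Y ω)) :=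
    condCov_comp_loewnerLE (Z := fun ω => ((W ω, U ω, Y ω), V ω)) hX (by fun_prop)
      (ρ := fun z => ((z.1.1, z.1.2.1), z.1.2.2)) (by fun_prop)
  have hK₁ := hKc.of_loewnerLE hle₁
  exact ⟨hK₁, hle₂, h.posDef_fusion hKY hK₁,
    hle₃.trans (h.condCov_loewnerLE_fusion hKY hK₁' hK₁)⟩

end Summary

/-! ### The pair `(Y₁, Y₂)` as an element of `S_G`. -/

section MaximalSide

open Matrix

variable {k k₁ k₂ m p q r : ℕ} {μ : ProbabilityMeasure (Src k k₁ k₂)}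

/-- The map `(X, Y₁, Y₂) ↦ ((X, Y₁, Y₂), (Y₁, Y₂))`. -/
noncomputable def withSides (k k₁ k₂ : ℕ) : Src k k₁ k₂ →L[ℝ] SrcY k k₁ k₂ (k₁ + k₂) :=
  (ContinuousLinearMap.id ℝ (Src k k₁ k₂)).prod
    ((appendCLM k₁ k₂).comp (ContinuousLinearMap.snd ℝ (Vec k) (Vec k₁ × Vec k₂)))

theorem measurable_withSides : Measurable (withSides k k₁ k₂) :=
  (withSides k k₁ k₂).continuous.measurable

/-- The law of `((X, Y₁, Y₂), (Y₁, Y₂))`. -/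
noncomputable def sidesLaw (μ : ProbabilityMeasure (Src k k₁ k₂)) :
    ProbabilityMeasure (SrcY k k₁ k₂ (k₁ + k₂)) :=
  μ.map measurable_withSides.aemeasurable

theorem coe_sidesLaw : (sidesLaw μ : Measure (SrcY k k₁ k₂ (k₁ + k₂))) =
    (μ : Measure (Src k k₁ k₂)).map (withSides k k₁ k₂) := rfl

theorem ae_sidesLaw : ∀ᵐ ω ∂(sidesLaw μ : Measure (SrcY k k₁ k₂ (k₁ + k₂))),
    ω.1.2 = (headCLM k₁ k₂ ω.2, tailCLM k₁ k₂ ω.2) := by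
  have hm : MeasurableSet {ω : SrcY k k₁ k₂ (k₁ + k₂) |
      ω.1.2 = (headCLM k₁ k₂ ω.2, tailCLM k₁ k₂ ω.2)} :=
    measurableSet_eq_fun (by fun_prop) (by fun_prop)
  rw [coe_sidesLaw, ae_map_iff measurable_withSides.aemeasurable hm]
  refine .of_forall fun ω => ?_
  simp [withSides]

theorem sidesLaw_mem_SG (hμ : IsCenteredGaussian (μ : Measure (Src k k₁ k₂))) :
    sidesLaw μ ∈ SG μ (k₁ + k₂) := by
  refine ⟨?_, hμ.map (withSides k k₁ k₂), ?_⟩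
  · rw [coe_sidesLaw, Measure.map_map measurable_fst measurable_withSides]
    exact Measure.map_id
  -- `(Y₁, Y₂)` is a function of their concatenation, so a one-point noise space suffices.
  · refine IsMarkovChain.symm (isMarkovChain_of_indepFun (N := fun _ => ())
      (Φ := fun z => (headCLM k₁ k₂ z.1, tailCLM k₁ k₂ z.1)) (by fun_prop) (by fun_prop)
      (by fun_prop) (by fun_prop) (by fun_prop) ae_sidesLaw (indepFun_const_right _ _))

theorem covXgivenY_sidesLaw (hμ : IsCenteredGaussian (μ : Measure (Src k k₁ k₂))) :
    covXgivenY (sidesLaw μ : Measure (SrcY k k₁ k₂ (k₁ + k₂))) =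
      condCov (μ : Measure (Src k k₁ k₂)) (fun ω => srcX k k₁ k₂ ω)
        (fun ω => appendCLM k₁ k₂ ω.2) := by
  have h : IsCenteredGaussian ((μ : Measure (Src k k₁ k₂)).map (withSides k k₁ k₂)) := hμ.map _
  obtain ⟨M, hM⟩ := h.exists_gaussianResidual (P := (μ : Measure (Src k k₁ k₂)))
    measurable_withSides ((srcX k k₁ k₂).comp (ContinuousLinearMap.fst ℝ _ (Vec (k₁ + k₂))))
    (ContinuousLinearMap.snd ℝ _ _)
  exact (hM.condCov_eq (srcX k k₁ k₂).continuous.measurable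
    (hμ.hasGaussianLaw (srcX k k₁ k₂)).sqIntegrable
    ((appendCLM k₁ k₂).continuous.measurable.comp measurable_snd)).symm

/-- The pair `(Y₁, Y₂)` is the least informative element of `S_G`. -/
theorem covXgivenY_loewnerLE (P : ProbabilityMeasure (SrcY k k₁ k₂ m)) (hP : P ∈ SG μ m) :
    LoewnerLE (covXgivenY (P : Measure (SrcY k k₁ k₂ m)))
      (covXgivenY (sidesLaw μ : Measure (SrcY k k₁ k₂ (k₁ + k₂)))) := by
  have hμ := isCenteredGaussian_of_mem_SG hP
  have hPμ := hP.1
  let X : SrcY k k₁ k₂ m → Vec k := fun ω => srcX k k₁ k₂ ω.1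
  have hXm : Measurable X := (srcX k k₁ k₂).continuous.measurable.comp measurable_fst
  have hX : SqIntegrable (P : Measure (SrcY k k₁ k₂ m)) X :=
    (hP.2.1.hasGaussianLaw ((srcX k k₁ k₂).comp (ContinuousLinearMap.fst ℝ _ _))).sqIntegrable
  have h1 : condCov (P : Measure (SrcY k k₁ k₂ m)) X (fun ω => appendCLM k₁ k₂ ω.1.2) =
      covXgivenY (sidesLaw μ : Measure (SrcY k k₁ k₂ (k₁ + k₂))) := by
    have h : IsCenteredGaussian ((P : Measure (SrcY k k₁ k₂ m)).map Prod.fst) := by rwa [hPμ]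
    obtain ⟨M, hM⟩ := h.exists_gaussianResidual (P := (P : Measure (SrcY k k₁ k₂ m)))
      measurable_fst (srcX k k₁ k₂)
      ((appendCLM k₁ k₂).comp (ContinuousLinearMap.snd ℝ (Vec k) (Vec k₁ × Vec k₂)))
    rw [covXgivenY_sidesLaw hμ, ← hPμ]
    exact hM.condCov_eq hXm hX
      ((appendCLM k₁ k₂).continuous.measurable.comp (measurable_snd.comp measurable_fst))
  obtain ⟨M, hM⟩ := IsCenteredGaussian.exists_gaussianResidual (φ := id)
    (P := (P : Measure (SrcY k k₁ k₂ m))) measurable_id (by rw [Measure.map_id]; exact hP.2.1)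
    ((srcX k k₁ k₂).comp (ContinuousLinearMap.fst ℝ _ (Vec m))) (ContinuousLinearMap.snd ℝ _ _)
  rw [Measure.map_id] at hM
  have hMm := hM.measurable
  -- By `X ↔ Y ↔ (Y₁, Y₂)` the residual given `Y` is independent of `(Y, Y₁, Y₂)` too. Adjoining
  -- `(Y₁, Y₂)` to `Y` leaves the covariance unchanged, and then dropping `Y` can only raise it.
  have hind : IndepFun (fun ω : SrcY k k₁ k₂ m => X ω - M ω.2) (fun ω => (ω.2, ω.1.2))
      (P : Measure (SrcY k k₁ k₂ m)) :=
    (hP.2.2.symm).indepFun_prod (A := fun ω : SrcY k k₁ k₂ m => ω.1.2) (B := fun ω => ω.2)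
      (C := X) (by fun_prop) hXm (n := fun z => z.2 - M z.1) (t := Prod.fst) (b := id)
      (by fun_prop) measurable_fst measurable_id (fun _ => rfl) hM.indep
  have hres : GaussianResidual (P : Measure (SrcY k k₁ k₂ m)) X (fun ω => (ω.2, ω.1.2))
      (fun z => M z.1) (covXgivenY (P : Measure (SrcY k k₁ k₂ m))) :=
    ⟨hMm.comp measurable_fst, hM.hasGaussianLaw, hM.mean, hM.cov, hind⟩
  rw [← h1, ← hres.condCov_eq hXm hX (by fun_prop)]
  exact condCov_comp_loewnerLE (Z := fun ω : SrcY k k₁ k₂ m => (ω.2, ω.1.2)) hX (by fun_prop)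
    (ρ := fun z => appendCLM k₁ k₂ z.2) ((appendCLM k₁ k₂).continuous.measurable.comp measurable_snd)

end MaximalSide

/-! ### Auxiliaries over `(Y₁, Y₂)` as instances of `SideInformation`. -/

section Sides

open Matrix

variable {k k₁ k₂ p q r : ℕ} {μ : ProbabilityMeasure (Src k k₁ k₂)}
  {Q : ProbabilityMeasure (Full k k₁ k₂ (k₁ + k₂) p q r)}

theorem IsAuxiliary.integral_eq_zero_sides (hμ : IsCenteredGaussian (μ : Measure (Src k k₁ k₂)))
    (hQ : IsAuxiliary (sidesLaw μ) Q) {l : ℕ}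
    (L : SrcY k k₁ k₂ (k₁ + k₂) →L[ℝ] Vec l) :
    ∀ i, ∫ ω, L ω.1 i ∂(Q : Measure (Full k k₁ k₂ (k₁ + k₂) p q r)) = 0 := by
  intro i
  have h := (sidesLaw_mem_SG hμ).2.1.mean L i
  rw [← hQ.1, integral_map measurable_fst.aemeasurable] at h
  · exact h
  · exact ((measurable_pi_apply i).comp L.continuous.measurable).aestronglyMeasurable

theorem IsAuxiliary.hasGaussianLaw_cX_cY (hμ : IsCenteredGaussian (μ : Measure (Src k k₁ k₂)))
    (hQ : IsAuxiliary (sidesLaw μ) Q) :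
    HasGaussianLaw (fun ω => (cX ω, cY ω)) (Q : Measure (Full k k₁ k₂ (k₁ + k₂) p q r)) := by
  have h := (sidesLaw_mem_SG hμ).2.1.hasGaussianLaw
    (((srcX k k₁ k₂).comp (ContinuousLinearMap.fst ℝ _ (Vec (k₁ + k₂)))).prod
      (ContinuousLinearMap.snd ℝ _ _))
  rw [← hQ.1] at h
  exact HasGaussianLaw.of_map measurable_fst (ContinuousLinearMap.continuous _).measurable h

theorem IsAuxiliary.ae_sides (hQ : IsAuxiliary (sidesLaw μ) Q) :
    ∀ᵐ ω ∂(Q : Measure (Full k k₁ k₂ (k₁ + k₂) p q r)),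
      (cY₁ ω, cY₂ ω) = (headCLM k₁ k₂ (cY ω), tailCLM k₁ k₂ (cY ω)) := by
  have h := ae_sidesLaw (μ := μ)
  rw [← hQ.1] at h
  exact ae_of_ae_map measurable_fst.aemeasurable h

theorem IsAuxiliary.sideInformation₁ (hμ : IsCenteredGaussian (μ : Measure (Src k k₁ k₂)))
    (hQ : IsAuxiliary (sidesLaw μ) Q) :
    SideInformation (Q : Measure (Full k k₁ k₂ (k₁ + k₂) p q r)) cX cY cY₁ (headCLM k₁ k₂)
      (fun ω => (cW ω, cU ω)) where
  measurable_X := measurable_cX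
  measurable_Y := measurable_cY
  measurable_Y₁ := measurable_cY₁
  measurable_A := by fun_prop
  hasGaussianLaw := hQ.hasGaussianLaw_cX_cY hμ
  mean_X := hQ.integral_eq_zero_sides hμ ((srcX k k₁ k₂).comp (ContinuousLinearMap.fst ℝ _ _))
  mean_Y := hQ.integral_eq_zero_sides hμ (ContinuousLinearMap.snd ℝ _ _)
  mean_Y₁ := hQ.integral_eq_zero_sides hμ ((srcY₁ k k₁ k₂).comp (ContinuousLinearMap.fst ℝ _ _))
  eq_comp := hQ.ae_sides.mono fun _ h => congrArg Prod.fst h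
  markov := hQ.2.comp (f := fun z => (z.1, z.2.1)) (g := fun z => z.2.2) (by fun_prop)
    (by fun_prop)

theorem IsAuxiliary.sideInformation₂ (hμ : IsCenteredGaussian (μ : Measure (Src k k₁ k₂)))
    (hQ : IsAuxiliary (sidesLaw μ) Q) :
    SideInformation (Q : Measure (Full k k₁ k₂ (k₁ + k₂) p q r)) cX cY cY₂ (tailCLM k₁ k₂)
      (fun ω => (cW ω, cV ω)) where
  measurable_X := measurable_cX
  measurable_Y := measurable_cY
  measurable_Y₁ := measurable_cY₂
  measurable_A := by fun_prop
  hasGaussianLaw := hQ.hasGaussianLaw_cX_cY hμ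
  mean_X := hQ.integral_eq_zero_sides hμ ((srcX k k₁ k₂).comp (ContinuousLinearMap.fst ℝ _ _))
  mean_Y := hQ.integral_eq_zero_sides hμ (ContinuousLinearMap.snd ℝ _ _)
  mean_Y₁ := hQ.integral_eq_zero_sides hμ ((srcY₂ k k₁ k₂).comp (ContinuousLinearMap.fst ℝ _ _))
  eq_comp := hQ.ae_sides.mono fun _ h => congrArg Prod.snd h
  markov := hQ.2.comp (f := fun z => (z.1, z.2.2)) (g := fun z => z.2.2) (by fun_prop)
    (by fun_prop)

end Sides

/-! ### Matching the groupings of the conditioning variables. -/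

section Reorder

variable {k k₁ k₂ m p q r : ℕ} {μ : ProbabilityMeasure (Src k k₁ k₂)}
  {P : ProbabilityMeasure (SrcY k k₁ k₂ m)} {Q : ProbabilityMeasure (Full k k₁ k₂ m p q r)}

theorem condCov_cX_cY₁ (hP : P ∈ SG μ m) (hQ : IsAuxiliary P Q) :
    condCov (Q : Measure (Full k k₁ k₂ m p q r)) cX cY₁ =
      covXgivenY₁ (μ : Measure (Src k k₁ k₂)) := by
  obtain ⟨M, hM⟩ := exists_gaussianResidual_Y₁ hP hQ.1
  exact hM.condCov_eq measurable_cX (sqIntegrable_cX hP hQ.1) measurable_cY₁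

theorem condCov_cX_cY₂ (hP : P ∈ SG μ m) (hQ : IsAuxiliary P Q) :
    condCov (Q : Measure (Full k k₁ k₂ m p q r)) cX cY₂ =
      covXgivenY₂ (μ : Measure (Src k k₁ k₂)) := by
  obtain ⟨M, hM⟩ := exists_gaussianResidual_Y₂ hP hQ.1
  exact hM.condCov_eq measurable_cX (sqIntegrable_cX hP hQ.1) measurable_cY₂

theorem condCov_cX_cY (hP : P ∈ SG μ m) (hQ : IsAuxiliary P Q) :
    condCov (Q : Measure (Full k k₁ k₂ m p q r)) cX cY =
      covXgivenY (P : Measure (SrcY k k₁ k₂ m)) := by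
  obtain ⟨M, hM⟩ := exists_gaussianResidual_Y hP hQ.1
  exact hM.condCov_eq measurable_cX (sqIntegrable_cX hP hQ.1) measurable_cY

theorem condCov_cWU_cY₁ (hP : P ∈ SG μ m) (hQ : IsAuxiliary P Q) :
    (condCov (Q : Measure (Full k k₁ k₂ m p q r)) cX fun ω => ((cW ω, cU ω), cY₁ ω)) =
      covXgivenWUY₁ Q :=
  condCov_comp_eq (Z := fun ω => (cW ω, cU ω, cY₁ ω)) (sqIntegrable_cX hP hQ.1) (by fun_prop)
    (ρ := fun z => ((z.1, z.2.1), z.2.2)) (by fun_prop) (σ := fun z => (z.1.1, z.1.2, z.2))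
    (by fun_prop) fun _ => rfl

theorem condCov_cWV_cY₂ (hP : P ∈ SG μ m) (hQ : IsAuxiliary P Q) :
    (condCov (Q : Measure (Full k k₁ k₂ m p q r)) cX fun ω => ((cW ω, cV ω), cY₂ ω)) =
      covXgivenWVY₂ Q :=
  condCov_comp_eq (Z := fun ω => (cW ω, cV ω, cY₂ ω)) (sqIntegrable_cX hP hQ.1) (by fun_prop)
    (ρ := fun z => ((z.1, z.2.1), z.2.2)) (by fun_prop) (σ := fun z => (z.1.1, z.1.2, z.2))
    (by fun_prop) fun _ => rfl

theorem condCov_cWUY_cV (hP : P ∈ SG μ m) (hQ : IsAuxiliary P Q) :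
    (condCov (Q : Measure (Full k k₁ k₂ m p q r)) cX fun ω => ((cW ω, cU ω, cY ω), cV ω)) =
      covXgivenWUVY Q :=
  condCov_comp_eq (Z := fun ω => (cW ω, cU ω, cV ω, cY ω)) (sqIntegrable_cX hP hQ.1) (by fun_prop)
    (ρ := fun z => ((z.1, z.2.1, z.2.2.2), z.2.2.1)) (by fun_prop)
    (σ := fun z => (z.1.1, z.1.2.1, z.2, z.1.2.2)) (by fun_prop) fun _ => rfl

theorem condCov_cWVY_cU (hP : P ∈ SG μ m) (hQ : IsAuxiliary P Q) :
    (condCov (Q : Measure (Full k k₁ k₂ m p q r)) cX fun ω => ((cW ω, cV ω, cY ω), cU ω)) =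
      covXgivenWUVY Q :=
  condCov_comp_eq (Z := fun ω => (cW ω, cU ω, cV ω, cY ω)) (sqIntegrable_cX hP hQ.1) (by fun_prop)
    (ρ := fun z => ((z.1, z.2.2.1, z.2.2.2), z.2.1)) (by fun_prop)
    (σ := fun z => (z.1.1, z.2, z.1.2.1, z.1.2.2)) (by fun_prop) fun _ => rfl

end Reorder

/-! ### At `Y = (Y₁, Y₂)` and finite rate, ordinary constraints imply enhanced ones. -/

section Enhancement

open Matrix

variable {k k₁ k₂ k₀ p q r : ℕ} {μ : ProbabilityMeasure (Src k k₁ k₂)}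
  {Q : ProbabilityMeasure (Full k k₁ k₂ (k₁ + k₂) p q r)}
  {Γ₁ Γ₂ : Matrix (Fin k) (Fin k) ℝ → Matrix (Fin k₀) (Fin k₀) ℝ}
  {D₁ D₂ : Matrix (Fin k₀) (Fin k₀) ℝ}

theorem IsDistortionMap.loewnerLE_of_le (h : IsDistortionMap Γ₁) {A B : Matrix (Fin k) (Fin k) ℝ}
    (hA : A.PosSemidef) (hB : B.PosSemidef) (hAB : LoewnerLE A B) (hD : LoewnerLE (Γ₁ B) D₁) :
    LoewnerLE (Γ₁ A) D₁ := (h.mono A B hA hB hAB).trans hD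

/-- Finite rate makes `K_{X|W,U,V,Y}` invertible. Fusion of `(W, V, Y₂)` with `Y` then bounds the
enhanced matrix by `K_{X|W,V,Y₂}`, and `Γ₂` is monotone. -/
theorem mem_ClBar₁_of_mem_Cl (hμ : IsCenteredGaussian (μ : Measure (Src k k₁ k₂)))
    (hK₂ : (covXgivenY₂ (μ : Measure (Src k k₁ k₂))).PosDef)
    (hKY : (covXgivenY (sidesLaw μ : Measure (SrcY k k₁ k₂ (k₁ + k₂)))).PosDef)
    (hΓ₂ : IsDistortionMap Γ₂) (hQ : Q ∈ Cl Γ₁ Γ₂ D₁ D₂ (sidesLaw μ) p q r) (hR : Rlo₁ Q ≠ ∞) :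
    Q ∈ ClBar₁ Γ₁ Γ₂ D₁ D₂ μ (sidesLaw μ) p q r := by
  obtain ⟨hA, h1, h2⟩ := hQ
  have hP := sidesLaw_mem_SG hμ
  have hKc : (covXgivenWUVY Q).PosDef := by
    by_contra hn
    rw [← condCov_cWUY_cV hP hA] at hn
    rw [← condCov_cX_cY hP hA] at hKY
    exact hR ((hA.sideInformation₁ hμ).condMutualInfo_add_eq_top measurable_cW measurable_cU
      measurable_cV hKY hn)
  obtain ⟨hK, -, hJ, hle⟩ := (hA.sideInformation₂ hμ).loewnerLE measurable_cW measurable_cV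
    measurable_cU (condCov_cX_cY hP hA) (condCov_cX_cY₂ hP hA) (condCov_cWV_cY₂ hP hA)
    (condCov_cWVY_cU hP hA) hKY hK₂ hKc
  obtain ⟨h3, h4⟩ := hle.inv_sub_inv hKc hK hJ
  exact ⟨hA, h1, hKc, hΓ₂.loewnerLE_of_le h3.posSemidef hK.posSemidef h4 h2⟩

theorem mem_ClBar₂_of_mem_Cl (hμ : IsCenteredGaussian (μ : Measure (Src k k₁ k₂)))
    (hK₁ : (covXgivenY₁ (μ : Measure (Src k k₁ k₂))).PosDef)
    (hKY : (covXgivenY (sidesLaw μ : Measure (SrcY k k₁ k₂ (k₁ + k₂)))).PosDef)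
    (hΓ₁ : IsDistortionMap Γ₁) (hQ : Q ∈ Cl Γ₁ Γ₂ D₁ D₂ (sidesLaw μ) p q r) (hR : Rlo₂ Q ≠ ∞) :
    Q ∈ ClBar₂ Γ₁ Γ₂ D₁ D₂ μ (sidesLaw μ) p q r := by
  obtain ⟨hA, h1, h2⟩ := hQ
  have hP := sidesLaw_mem_SG hμ
  have hKc : (covXgivenWUVY Q).PosDef := by
    by_contra hn
    rw [← condCov_cWVY_cU hP hA] at hn
    rw [← condCov_cX_cY hP hA] at hKY
    exact hR ((hA.sideInformation₂ hμ).condMutualInfo_add_eq_top measurable_cW measurable_cV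
      measurable_cU hKY hn)
  obtain ⟨hK, -, hJ, hle⟩ := (hA.sideInformation₁ hμ).loewnerLE measurable_cW measurable_cU
    measurable_cV (condCov_cX_cY hP hA) (condCov_cX_cY₁ hP hA) (condCov_cWU_cY₁ hP hA)
    (condCov_cWUY_cV hP hA) hKY hK₁ hKc
  obtain ⟨h3, h4⟩ := hle.inv_sub_inv hKc hK hJ
  exact ⟨hA, hKc, hΓ₁.loewnerLE_of_le h3.posSemidef hK.posSemidef h4 h1, h2⟩

end Enhancement

/-! ### Replacing arbitrary auxiliaries by a Gaussian test. -/

section Achievability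

open Matrix

variable {k k₁ k₂ k₀ m p q r : ℕ} {μ : ProbabilityMeasure (Src k k₁ k₂)}
  {P : ProbabilityMeasure (SrcY k k₁ k₂ m)}
  {Q : ProbabilityMeasure (Full k k₁ k₂ (k₁ + k₂) p q r)}
  {Γ₁ Γ₂ : Matrix (Fin k) (Fin k) ℝ → Matrix (Fin k₀) (Fin k₀) ℝ}
  {D₁ D₂ : Matrix (Fin k₀) (Fin k₀) ℝ}

/-- The observation matrices of the Gaussian test that matches given covariances. -/
theorem exists_test_matrices {KY K₁' K₁ Kc : Matrix (Fin k) (Fin k) ℝ} (hK₁ : K₁.PosDef)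
    (hKc : Kc.PosDef) (hle : LoewnerLE K₁ K₁') (hJ : (K₁⁻¹ + (KY⁻¹ - K₁'⁻¹)).PosDef)
    (hleJ : LoewnerLE Kc (K₁⁻¹ + (KY⁻¹ - K₁'⁻¹))⁻¹) :
    ∃ H₁ H₃ : Matrix (Fin k) (Fin k) ℝ, H₁ᵀ * H₁ = K₁⁻¹ - K₁'⁻¹ ∧
      H₃ᵀ * H₃ = Kc⁻¹ - (K₁⁻¹ + (KY⁻¹ - K₁'⁻¹)) := by
  obtain ⟨H₁, hH₁⟩ := exists_transpose_mul_self_eq (LoewnerLE.inv hK₁ hle)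
  have h := LoewnerLE.inv hKc hleJ
  rw [hJ.inv_inv] at h
  obtain ⟨H₃, hH₃⟩ := exists_transpose_mul_self_eq h
  exact ⟨H₁, H₃, hH₁, hH₃⟩

/-- The precision of the Gaussian test relative to a prior covariance `K`. -/
theorem posteriorCov_test {K KY K₁' K₁ Kc H₁ H₃ : Matrix (Fin k) (Fin k) ℝ} (hK : K.PosDef)
    (hH₁ : H₁ᵀ * H₁ = K₁⁻¹ - K₁'⁻¹) (hH₃ : H₃ᵀ * H₃ = Kc⁻¹ - (K₁⁻¹ + (KY⁻¹ - K₁'⁻¹))) :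
    posteriorCov (posteriorCov K H₃) H₁ = (Kc⁻¹ - (KY⁻¹ - K⁻¹))⁻¹ ∧
      (Kc⁻¹ - (KY⁻¹ - K⁻¹)).PosDef := by
  have h := posteriorCov_posteriorCov hK H₃ H₁
  rwa [show K⁻¹ + (H₃ᵀ * H₃ + H₁ᵀ * H₁) = Kc⁻¹ - (KY⁻¹ - K⁻¹) by rw [hH₁, hH₃]; abel] at h

/-- The prior `K` cancels: for the test, the enhanced matrix does not depend on which `Y` in `S_G`
is used. -/
theorem inv_sub_inv_sub_cancel {K L KY Kc : Matrix (Fin k) (Fin k) ℝ}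
    (h : (Kc⁻¹ - (KY⁻¹ - K⁻¹)).PosDef) :
    (Kc⁻¹ - (KY⁻¹ - K⁻¹))⁻¹⁻¹ - (K⁻¹ - L⁻¹) = Kc⁻¹ - (KY⁻¹ - L⁻¹) := by
  rw [h.inv_inv]
  abel

/-- The original auxiliaries live over `(Y₁, Y₂)`, the test over an arbitrary `Y` in `S_G`. One
construction serves both comparisons of the bounds; `K_{X|Y}` has to be invertible only where the
enhanced constraints are stated. -/
theorem exists_gaussian_mem_ClBar₁ (hP : P ∈ SG μ m)
    (hK₁' : (covXgivenY₁ (μ : Measure (Src k k₁ k₂))).PosDef)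
    (hK₂' : (covXgivenY₂ (μ : Measure (Src k k₁ k₂))).PosDef)
    (hKY : (covXgivenY (sidesLaw μ : Measure (SrcY k k₁ k₂ (k₁ + k₂)))).PosDef)
    (hQ : Q ∈ ClBar₁ Γ₁ Γ₂ D₁ D₂ μ (sidesLaw μ) p q r) :
    ∃ Q' : ProbabilityMeasure (Full k k₁ k₂ m k 0 k), Q' ∈ Cl Γ₁ Γ₂ D₁ D₂ P k 0 k ∧
      IsCenteredGaussian (Q' : Measure (Full k k₁ k₂ m k 0 k)) ∧ Rlo₁ Q' ≤ Rlo₁ Q ∧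
      ((covXgivenY (P : Measure (SrcY k k₁ k₂ m))).PosDef →
        Q' ∈ ClBar₁ Γ₁ Γ₂ D₁ D₂ μ P k 0 k) := by
  have hμ := isCenteredGaussian_of_mem_SG hP
  have hS := sidesLaw_mem_SG hμ
  obtain ⟨hA, h1, hKc, h2⟩ := hQ
  have hI := hA.sideInformation₁ hμ
  obtain ⟨hK₁, hle, hJ, hleJ⟩ := hI.loewnerLE measurable_cW measurable_cU measurable_cV
    (condCov_cX_cY hS hA) (condCov_cX_cY₁ hS hA) (condCov_cWU_cY₁ hS hA) (condCov_cWUY_cV hS hA)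
    hKY hK₁' hKc
  obtain ⟨H₁, H₃, hH₁, hH₃⟩ := exists_test_matrices hK₁ hKc hle hJ hleJ
  obtain ⟨Q', hT⟩ := exists_isGaussianTest P hP.2.1 H₁ (0 : Matrix (Fin 0) (Fin k) ℝ) H₃
  obtain ⟨e1, i1⟩ := hT.covXgivenWUY₁_eq hP
  obtain ⟨e2, -⟩ := hT.covXgivenWVY₂_eq hP
  obtain ⟨e3, i3, -⟩ := hT.covXgivenWUVY_eq hP
  rw [posteriorCov_of_zero_rows] at e1 e3 i3
  -- `K₁'⁻¹ + H₁ᵀH₁ = K₁⁻¹`, so the first error covariance is reproduced exactly.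
  rw [posteriorCov_eq_inv hK₁', hH₁, add_sub_cancel, hK₁.inv_inv] at e1
  -- With prior `K_{X|Y₂}` the test has as its ordinary error covariance the very matrix in the
  -- enhanced constraint on `Q`.
  rw [(posteriorCov_test hK₂' hH₁ hH₃).1] at e2
  have hA' := hT.isAuxiliary
  refine ⟨Q', ⟨hA', e1 ▸ h1, e2 ▸ h2⟩, hT.gaussian, ?_, fun hKP => ⟨hA', e1 ▸ h1, ?_, ?_⟩⟩
  · have hKP : (covXgivenY (P : Measure (SrcY k k₁ k₂ m))).PosSemidef := by
      rw [← condCov_cX_cY hP hA']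
      exact posSemidef_condCov (sqIntegrable_cX hP hA'.1) _
    have hc := condMutualInfo_comp_le (P := (Q' : Measure (Full k k₁ k₂ m k 0 k)))
      measurable_cX measurable_cW measurable_cY₁ (f := fun w : Vec k => (w, (0 : Vec 0)))
      (by fun_prop)
    -- `Vec 0` has a single point, so the pair `(W, U)` is a function of `W`.
    have hcU : (fun ω : Full k k₁ k₂ m k 0 k => (cW ω, cU ω)) = fun ω => (cW ω, (0 : Vec 0)) :=
      funext fun ω => Prod.ext rfl (Subsingleton.elim _ _)
    refine le_trans ?_ (hI.le_condMutualInfo_add measurable_cW measurable_cU measurable_cV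
      (condCov_cX_cY hS hA) (condCov_cX_cY₁ hS hA) (condCov_cWU_cY₁ hS hA) rfl
      (condCov_cWUY_cV hS hA) hKY hK₁' hK₁ hKc)
    refine le_trans ?_ (ofReal_log_det_add_le hK₁' hK₁ hKY hJ.inv hKc hKP
      (covXgivenY_loewnerLE P hP) hJ.inv_inv hH₁ (by rw [hJ.inv_inv, hH₃]))
    rw [Rlo₁, hcU]
    exact add_le_add (hc.trans i1.le) i3.le
  · rw [e3, (posteriorCov_test hKP hH₁ hH₃).1]
    exact (posteriorCov_test hKP hH₁ hH₃).2.inv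
  · rw [e3, (posteriorCov_test hKP hH₁ hH₃).1,
      inv_sub_inv_sub_cancel (posteriorCov_test hKP hH₁ hH₃).2]
    exact h2

/-- The mirror image, with `V` empty: `W` matches `K_{X|W,V,Y₂}` and `U` supplies the rest of the
precision. -/
theorem exists_gaussian_mem_ClBar₂ (hP : P ∈ SG μ m)
    (hK₁' : (covXgivenY₁ (μ : Measure (Src k k₁ k₂))).PosDef)
    (hK₂' : (covXgivenY₂ (μ : Measure (Src k k₁ k₂))).PosDef)
    (hKY : (covXgivenY (sidesLaw μ : Measure (SrcY k k₁ k₂ (k₁ + k₂)))).PosDef)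
    (hQ : Q ∈ ClBar₂ Γ₁ Γ₂ D₁ D₂ μ (sidesLaw μ) p q r) :
    ∃ Q' : ProbabilityMeasure (Full k k₁ k₂ m k k 0), Q' ∈ Cl Γ₁ Γ₂ D₁ D₂ P k k 0 ∧
      IsCenteredGaussian (Q' : Measure (Full k k₁ k₂ m k k 0)) ∧ Rlo₂ Q' ≤ Rlo₂ Q ∧
      ((covXgivenY (P : Measure (SrcY k k₁ k₂ m))).PosDef →
        Q' ∈ ClBar₂ Γ₁ Γ₂ D₁ D₂ μ P k k 0) := by
  have hμ := isCenteredGaussian_of_mem_SG hP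
  have hS := sidesLaw_mem_SG hμ
  obtain ⟨hA, hKc, h1, h2⟩ := hQ
  have hI := hA.sideInformation₂ hμ
  obtain ⟨hK₂, hle, hJ, hleJ⟩ := hI.loewnerLE measurable_cW measurable_cV measurable_cU
    (condCov_cX_cY hS hA) (condCov_cX_cY₂ hS hA) (condCov_cWV_cY₂ hS hA) (condCov_cWVY_cU hS hA)
    hKY hK₂' hKc
  obtain ⟨H₁, H₂, hH₁, hH₂⟩ := exists_test_matrices hK₂ hKc hle hJ hleJ
  obtain ⟨Q', hT⟩ := exists_isGaussianTest P hP.2.1 H₁ H₂ (0 : Matrix (Fin 0) (Fin k) ℝ)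
  obtain ⟨e1, -⟩ := hT.covXgivenWUY₁_eq hP
  obtain ⟨e2, i2⟩ := hT.covXgivenWVY₂_eq hP
  obtain ⟨e3, -, i3⟩ := hT.covXgivenWUVY_eq hP
  rw [posteriorCov_of_zero_rows] at e2 e3 i3
  rw [posteriorCov_eq_inv hK₂', hH₁, add_sub_cancel, hK₂.inv_inv] at e2
  rw [(posteriorCov_test hK₁' hH₁ hH₂).1] at e1
  have hA' := hT.isAuxiliary
  refine ⟨Q', ⟨hA', e1 ▸ h1, e2 ▸ h2⟩, hT.gaussian, ?_, fun hKP => ⟨hA', ?_, ?_, e2 ▸ h2⟩⟩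
  · have hKP : (covXgivenY (P : Measure (SrcY k k₁ k₂ m))).PosSemidef := by
      rw [← condCov_cX_cY hP hA']
      exact posSemidef_condCov (sqIntegrable_cX hP hA'.1) _
    have hc := condMutualInfo_comp_le (P := (Q' : Measure (Full k k₁ k₂ m k k 0)))
      measurable_cX measurable_cW measurable_cY₂ (f := fun w : Vec k => (w, (0 : Vec 0)))
      (by fun_prop)
    have hcV : (fun ω : Full k k₁ k₂ m k k 0 => (cW ω, cV ω)) = fun ω => (cW ω, (0 : Vec 0)) :=
      funext fun ω => Prod.ext rfl (Subsingleton.elim _ _)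
    refine le_trans ?_ (hI.le_condMutualInfo_add measurable_cW measurable_cV measurable_cU
      (condCov_cX_cY hS hA) (condCov_cX_cY₂ hS hA) (condCov_cWV_cY₂ hS hA) rfl
      (condCov_cWVY_cU hS hA) hKY hK₂' hK₂ hKc)
    refine le_trans ?_ (ofReal_log_det_add_le hK₂' hK₂ hKY hJ.inv hKc hKP
      (covXgivenY_loewnerLE P hP) hJ.inv_inv hH₁ (by rw [hJ.inv_inv, hH₂]))
    rw [Rlo₂, hcV]
    exact add_le_add (hc.trans i2.le) i3.le
  · rw [e3, (posteriorCov_test hKP hH₁ hH₂).1]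
    exact (posteriorCov_test hKP hH₁ hH₂).2.inv
  · rw [e3, (posteriorCov_test hKP hH₁ hH₂).1,
      inv_sub_inv_sub_cancel (posteriorCov_test hKP hH₁ hH₂).2]
    exact h1

end Achievability

/-! ### Comparison of the three bounds. -/

section Bounds

variable {k k₁ k₂ k₀ : ℕ} {μ : ProbabilityMeasure (Src k k₁ k₂)}
  {Γ₁ Γ₂ : Matrix (Fin k) (Fin k) ℝ → Matrix (Fin k₀) (Fin k₀) ℝ}
  {D₁ D₂ : Matrix (Fin k₀) (Fin k₀) ℝ}

theorem RMLB_le_RMLBGauss : RMLB Γ₁ Γ₂ D₁ D₂ μ ≤ RMLBGauss Γ₁ Γ₂ D₁ D₂ μ := by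
  refine max_le_max ?_ ?_ <;>
    exact iSup_mono fun m => iSup_mono fun P => iSup_mono fun _ => iInf_mono fun p =>
      iInf_mono fun q => iInf_mono fun r => iInf_mono fun Q => le_iInf fun hQ => le_iInf fun _ =>
        iInf_le _ hQ

/-- Only the term `Y = (Y₁, Y₂)` of the right-hand suprema is needed: it already dominates the terms
on the left for every `Y` in `S_G`. -/
theorem RMLBGauss_le_RE2LB (hμ : IsCenteredGaussian (μ : Measure (Src k k₁ k₂)))
    (hK₁ : (covXgivenY₁ (μ : Measure (Src k k₁ k₂))).PosDef)
    (hK₂ : (covXgivenY₂ (μ : Measure (Src k k₁ k₂))).PosDef)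
    (hKY : (covXgivenY (sidesLaw μ : Measure (SrcY k k₁ k₂ (k₁ + k₂)))).PosDef) :
    RMLBGauss Γ₁ Γ₂ D₁ D₂ μ ≤ RE2LB Γ₁ Γ₂ D₁ D₂ μ := by
  refine max_le_max ?_ ?_
  · refine iSup_le fun m => iSup_le fun P => iSup_le fun hP => ?_
    refine le_trans ?_ (le_iSup₂_of_le (k₁ + k₂) (sidesLaw μ)
      (le_iSup₂_of_le (sidesLaw_mem_SG hμ) hKY le_rfl))
    refine le_iInf fun p => le_iInf fun q => le_iInf fun r => le_iInf₂ fun Q hQ => ?_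
    obtain ⟨Q', h1, h2, h3, -⟩ := exists_gaussian_mem_ClBar₁ hP hK₁ hK₂ hKY hQ
    exact iInf_le_of_le k (iInf₂_le_of_le 0 k (iInf₂_le_of_le Q' h1 (iInf_le_of_le h2 h3)))
  · refine iSup_le fun m => iSup_le fun P => iSup_le fun hP => ?_
    refine le_trans ?_ (le_iSup₂_of_le (k₁ + k₂) (sidesLaw μ)
      (le_iSup₂_of_le (sidesLaw_mem_SG hμ) hKY le_rfl))
    refine le_iInf fun p => le_iInf fun q => le_iInf fun r => le_iInf₂ fun Q hQ => ?_
    obtain ⟨Q', h1, h2, h3, -⟩ := exists_gaussian_mem_ClBar₂ hP hK₁ hK₂ hKY hQ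
    exact iInf_le_of_le k (iInf₂_le_of_le k 0 (iInf₂_le_of_le Q' h1 (iInf_le_of_le h2 h3)))

/-- Again `(Y₁, Y₂)` dominates. A feasible point of infinite rate imposes nothing, and one of finite
rate satisfies the enhanced constraints and is carried over to `P` by the Gaussian test. -/
theorem RE2LB_le_RMLB (hμ : IsCenteredGaussian (μ : Measure (Src k k₁ k₂)))
    (hK₁ : (covXgivenY₁ (μ : Measure (Src k k₁ k₂))).PosDef)
    (hK₂ : (covXgivenY₂ (μ : Measure (Src k k₁ k₂))).PosDef)
    (hKY : (covXgivenY (sidesLaw μ : Measure (SrcY k k₁ k₂ (k₁ + k₂)))).PosDef)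
    (hΓ₁ : IsDistortionMap Γ₁) (hΓ₂ : IsDistortionMap Γ₂) :
    RE2LB Γ₁ Γ₂ D₁ D₂ μ ≤ RMLB Γ₁ Γ₂ D₁ D₂ μ := by
  refine max_le_max ?_ ?_
  · refine iSup_le fun m => iSup_le fun P => iSup₂_le fun hP hKP => ?_
    refine le_trans ?_ (le_iSup₂_of_le (k₁ + k₂) (sidesLaw μ)
      (le_iSup_of_le (sidesLaw_mem_SG hμ) le_rfl))
    refine le_iInf fun p => le_iInf fun q => le_iInf fun r => le_iInf₂ fun Q hQ => ?_
    by_cases hR : Rlo₁ Q = ∞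
    · exact hR ▸ le_top
    obtain ⟨Q', -, -, h3, h4⟩ := exists_gaussian_mem_ClBar₁ hP hK₁ hK₂ hKY
      (mem_ClBar₁_of_mem_Cl hμ hK₂ hKY hΓ₂ hQ hR)
    exact iInf_le_of_le k (iInf₂_le_of_le 0 k (iInf₂_le_of_le Q' (h4 hKP) h3))
  · refine iSup_le fun m => iSup_le fun P => iSup₂_le fun hP hKP => ?_
    refine le_trans ?_ (le_iSup₂_of_le (k₁ + k₂) (sidesLaw μ)
      (le_iSup_of_le (sidesLaw_mem_SG hμ) le_rfl))
    refine le_iInf fun p => le_iInf fun q => le_iInf fun r => le_iInf₂ fun Q hQ => ?_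
    by_cases hR : Rlo₂ Q = ∞
    · exact hR ▸ le_top
    obtain ⟨Q', -, -, h3, h4⟩ := exists_gaussian_mem_ClBar₂ hP hK₁ hK₂ hKY
      (mem_ClBar₂_of_mem_Cl hμ hK₁ hKY hΓ₁ hQ hR)
    exact iInf_le_of_le k (iInf₂_le_of_le k 0 (iInf₂_le_of_le Q' (h4 hKP) h3))

end Bounds

end VecGaussianRD

theorem mainTheorem8 (k k₁ k₂ k₀ : ℕ)
    (μ : ProbabilityMeasure (VecGaussianRD.Src k k₁ k₂))
    (hμ : VecGaussianRD.IsCenteredGaussian (μ : Measure (VecGaussianRD.Src k k₁ k₂)))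
    (hK₁ : (VecGaussianRD.covXgivenY₁ (μ : Measure (VecGaussianRD.Src k k₁ k₂))).PosDef)
    (hK₂ : (VecGaussianRD.covXgivenY₂ (μ : Measure (VecGaussianRD.Src k k₁ k₂))).PosDef)
    (hY : ∃ (m : ℕ) (P : ProbabilityMeasure (VecGaussianRD.SrcY k k₁ k₂ m)),
      P ∈ VecGaussianRD.SG μ m ∧
        (VecGaussianRD.covXgivenY (P : Measure (VecGaussianRD.SrcY k k₁ k₂ m))).PosDef)
    (Γ₁ Γ₂ : Matrix (Fin k) (Fin k) ℝ → Matrix (Fin k₀) (Fin k₀) ℝ)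
    (hΓ₁ : VecGaussianRD.IsDistortionMap Γ₁) (hΓ₂ : VecGaussianRD.IsDistortionMap Γ₂)
    (D₁ D₂ : Matrix (Fin k₀) (Fin k₀) ℝ) (hD₁ : D₁.PosDef) (hD₂ : D₂.PosDef) :
    VecGaussianRD.RMLB Γ₁ Γ₂ D₁ D₂ μ = VecGaussianRD.RE2LB Γ₁ Γ₂ D₁ D₂ μ ∧
    VecGaussianRD.RMLBGauss Γ₁ Γ₂ D₁ D₂ μ = VecGaussianRD.RMLB Γ₁ Γ₂ D₁ D₂ μ := by
  obtain ⟨m, P, hP, hKP⟩ := hY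
  -- Since `(Y₁, Y₂)` has the largest error covariance in `S_G`, invertibility for one `Y` gives it
  -- for the pair.
  have hKY := hKP.of_loewnerLE (VecGaussianRD.covXgivenY_loewnerLE P hP)
  have h1 : VecGaussianRD.RMLB Γ₁ Γ₂ D₁ D₂ μ ≤ VecGaussianRD.RMLBGauss Γ₁ Γ₂ D₁ D₂ μ :=
    VecGaussianRD.RMLB_le_RMLBGauss
  have h2 : VecGaussianRD.RMLBGauss Γ₁ Γ₂ D₁ D₂ μ ≤ VecGaussianRD.RE2LB Γ₁ Γ₂ D₁ D₂ μ :=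
    VecGaussianRD.RMLBGauss_le_RE2LB hμ hK₁ hK₂ hKY
  have h3 := VecGaussianRD.RE2LB_le_RMLB (D₁ := D₁) (D₂ := D₂) hμ hK₁ hK₂ hKY hΓ₁ hΓ₂
  exact ⟨le_antisymm (h1.trans h2) h3, le_antisymm (h2.trans h3) h1⟩
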